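/- **Setting.** Let $q_0>0$ and $q_\pm\in\mathbb C$ with $|q_\pm|=q_0$. Let $t$ be a fixed time and let $x\mapsto q(x,t)$ be continuously differentiable with $q(x,t)\to q_\pm$ as $x\to\pm\infty$, $(1+|x|)(q(x,t)-q_\pm)\in L^1(\mathbb R^\pm)$ and $q_x(\cdot,t)\in L^1(\mathbb R)$ (for instance a time slice of a solution of the derivative nonlinear Schrödinger equation $iq_t+q_{xx}-i(|q|^2q)_x=0$). For $z\ne0$ put $k=\frac12(z-q_0^2/z)$, $\lambda=\frac12(z+q_0^2/z)$, $\theta(x,t;z)=k\lambda\,[x-(2k^2-q_0^2)t]$, $$X=ik^2\sigma_3+k\begin{pmatrix}0&q\\-q^*&0\end{pmatrix},\qquad E_\pm=\begin{pmatrix}1&iq_\pm/z\\ iq_\pm^*/z&1\end{pmatrix},$$ $\Sigma=(\mathbb R\cup i\mathbb R)\setminus\{0\}$ and $D^\pm=\{z:\pm\operatorname{Re}z\operatorname{Im}z>0\}$. The contour $\Sigma$ is oriented with $D^+$ on its left: the real half-axes run from $0$ to $\infty$, the imaginary half-axes from $\infty$ to $0$. For $z\in\Sigma$ the Jost solutions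 $\varPhi_\pm$ are the solutions of $\varPhi_x=X\varPhi$ with $\varPhi_\pm=E_\pm e^{i\theta\sigma_3}+o(1)$ as $x\to\pm\infty$. The columns $\varPhi_{+1},\varPhi_{-2}$ extend analytically to $D^+$ and $\varPhi_{-1},\varPhi_{+2}$ to $D^-$; there they are the solutions with $e^{-i\theta}\varPhi_{\pm1}\to E_{\pm1}$, respectively $e^{i\theta}\varPhi_{\pm2}\to E_{\pm2}$, as $x\to\pm\infty$. The scattering matrix $S=(s_{ij})$ is defined by $\varPhi_+=\varPhi_-S$ on $\Sigma\setminus\{\pm iq_0\}$, and $$s_{11}=\frac{\mathrm{Wr}(\varPhi_{+1},\varPhi_{-2})}{1+q_0^2/z^2},\qquad s_{22}=\frac{\mathrm{Wr}(\varPhi_{-1},\varPhi_{+2})}{1+q_0^2/z^2}$$ extend $s_{11}$ to $D^+$ and $s_{22}$ to $D^-$. Put $\rho=s_{21}/s_{11}$, $\tilde\rho=s_{12}/s_{22}$ and $$v_0=\frac12\int_{-\infty}^{\infty}\left(|q(x,t)|^2-q_0^2\right)dx .$$ **Assumptions.** There are no spectral singularities: $s_{11}s_{22}\neq0$ on $\Sigma\setminus\{\pm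 iq_0\}$, and $1/s_{11}$, $1/s_{22}$ extend continuously to the points $\pm iq_0$ (from $D^+\cup\Sigma$ and $D^-\cup\Sigma$ respectively). The zeros of $s_{11}$ in $\{\operatorname{Re}z>0,\ \operatorname{Im}z>0,\ |z|>q_0\}$ are exactly the distinct points $z_1,\dots,z_{N_1}$, its zeros on $\{q_0e^{i\phi}:0<\phi<\pi/2\}$ are exactly the distinct points $w_1,\dots,w_{N_2}$, and all of them are double ($s_{11}=s_{11}'=0\ne s_{11}''$); $N_1,N_2\ge0$. Let $\eta_n$, $1\le n\le 4N_1+2N_2$, be the points $\pm z_j$, $\pm q_0^2/z_j^*$, $\pm w_m$, and let $\hat\eta_n=-q_0^2/\eta_n$. **Trace formulae.** The integral defining $v_0$ converges absolutely and, with absolutely convergent integrals, $$s_{11}(z)=\exp\left(-\frac1{2\pi i}\int_\Sigma\frac{\log[1-\rho(\zeta)\tilde\rho(\zeta)]}{\zeta-z}\,d\zeta\right)\prod_{n=1}^{4N_1+2N_2}\left(\frac{z-\eta_n}{z-\hat\eta_n}\right)^2e^{-iv_0},\qquad z\in D^+,$$ $$s_{22}(z)=\exp\left(\frac1{2\pi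 i}\int_\Sigma\frac{\log[1-\rho(\zeta)\tilde\rho(\zeta)]}{\zeta-z}\,d\zeta\right)\prod_{n=1}^{4N_1+2N_2}\left(\frac{z-\hat\eta_n}{z-\eta_n}\right)^2e^{iv_0},\qquad z\in D^-.$$ **Theta condition.** The integral below converges absolutely, and there is $j\in\mathbb Z$ such that $$\arg\frac{q_-}{q_+}+2v_0=16\sum_{n=1}^{N_1}\arg z_n+8\sum_{m=1}^{N_2}\arg w_m+2j\pi+\frac1{2\pi}\int_\Sigma\frac{\log[1-\rho(\zeta)\tilde\rho(\zeta)]}{\zeta}\,d\zeta .$$ **Reflectionless case.** If $\rho=\tilde\rho=0$ on $\Sigma\setminus\{\pm iq_0\}$, then $S(q_0)=I$, $q_+=q_-$, and there is $j\in\mathbb Z$ such that $$v_0=8\sum_{n=1}^{N_1}\arg z_n+4\sum_{m=1}^{N_2}\arg w_m+j\pi .$$ -/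

import Mathlib

open Filter Topology MeasureTheory Matrix

namespace DNLS

noncomputable section

/-- The uniformized spectral parameter `k(z) = (z - q₀² / z) / 2`. -/
def specK (q0 : ℝ) (z : ℂ) : ℂ := (z - (q0 : ℂ) ^ 2 / z) / 2

/-- `λ(z) = (z + q₀² / z) / 2`; thus `λ² = k² + q₀²` and `k + λ = z`. -/
def specLam (q0 : ℝ) (z : ℂ) : ℂ := (z + (q0 : ℂ) ^ 2 / z) / 2

/-- The phase `θ(x, t; z) = k λ (x - (2 k² - q₀²) t)`. -/
def phase (q0 : ℝ) (x t : ℝ) (z : ℂ) : ℂ :=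
  specK q0 z * specLam q0 z * ((x : ℂ) - (2 * specK q0 z ^ 2 - (q0 : ℂ) ^ 2) * (t : ℂ))

/-- The Pauli matrix `σ₃`. -/
def sigma3 : Matrix (Fin 2) (Fin 2) ℂ := !![1, 0; 0, -1]

/-- The potential matrix `Q = [[0, q], [-q*, 0]]` (the case `σ = -1`). -/
def potMatrix (a : ℂ) : Matrix (Fin 2) (Fin 2) ℂ := !![0, a; -star a, 0]

/-- The `x`-part of the Lax pair as a function of `z`: `X = i k² σ₃ + k Q`, `k = k(z)`. -/
def laxX (q : ℝ → ℝ → ℂ) (q0 : ℝ) (x t : ℝ) (z : ℂ) : Matrix (Fin 2) (Fin 2) ℂ :=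
  (Complex.I * specK q0 z ^ 2) • sigma3 + specK q0 z • potMatrix (q x t)

/-- The background eigenvector matrix `E = [[1, i b / z], [i b* / z, 1]]`,
where `b` is the boundary value `q₊` or `q₋`. -/
def bgMatrix (b z : ℂ) : Matrix (Fin 2) (Fin 2) ℂ :=
  !![1, Complex.I * b / z; Complex.I * star b / z, 1]

/-- `Σ = (ℝ ∪ iℝ) \ {0}`. -/
def contour : Set ℂ := {z | (z.im = 0 ∨ z.re = 0) ∧ z ≠ 0}

/-- `D⁺ = {z : Re z · Im z > 0}`. -/
def Dplus : Set ℂ := {z | 0 < z.re * z.im}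

/-- `D⁻ = {z : Re z · Im z < 0}`. -/
def Dminus : Set ℂ := {z | z.re * z.im < 0}

/-- The two branch points `± i q₀` (where `λ = 0`). -/
def branchPts (q0 : ℝ) : Set ℂ := {Complex.I * (q0 : ℂ), -(Complex.I * (q0 : ℂ))}

/-- `φ` is the `j`-th column (`j = 0, 1`) of the Jost solution at the end `l` of the line
(`l = atTop` with boundary value `b = q₊`, or `l = atBot` with `b = q₋`), at the spectral
parameter `z`: it solves `φ_x = X φ`, and the modified column `μ_j = φ e^{∓ i θ}` (sign `-` for
the first column, `+` for the second) tends to the `j`-th column of `E(z)`.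

For `z ∈ Σ` the exponential is unimodular, so this is `Φ_j = E_j e^{± i θ} + o(1)`.  For the
columns and regions in which Jost columns are used off `Σ` (`Φ₊₁, Φ₋₂` in `D⁺` and `Φ₋₁, Φ₊₂` in
`D⁻`), the factor `e^{± i θ}` decays at the end in question, and this condition singles out the
analytic continuation of the column from `Σ`. -/
def IsJostColumn (q : ℝ → ℝ → ℂ) (q0 : ℝ) (b : ℂ) (l : Filter ℝ) (j : Fin 2) (t : ℝ) (z : ℂ)
    (φ : ℝ → Fin 2 → ℂ) : Prop :=
  (∀ x : ℝ, HasDerivAt φ (laxX q q0 x t z *ᵥ φ x) x) ∧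
    Tendsto (fun x : ℝ => Complex.exp (-(Complex.I * phase q0 x t z * sigma3 j j)) • φ x) l
      (𝓝 (fun i => bgMatrix b z i j))

/-- The `j`-th Jost column at the end `l`. -/
def jostColumn (q : ℝ → ℝ → ℂ) (q0 : ℝ) (b : ℂ) (l : Filter ℝ) (j : Fin 2) (t : ℝ) (z : ℂ) :
    ℝ → Fin 2 → ℂ :=
  Classical.epsilon (IsJostColumn q q0 b l j t z)

/-- The Wronskian determinant of two column vectors. -/
def wronskian (u v : Fin 2 → ℂ) : ℂ := u 0 * v 1 - u 1 * v 0

/-- `det E(z) = 1 + q₀² / z²`. -/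
def detE (q0 : ℝ) (z : ℂ) : ℂ := 1 + (q0 : ℂ) ^ 2 / z ^ 2

/-- `s₁₁ = Wr(Φ₊₁, Φ₋₂) / (1 + q₀² / z²)` on `D⁺ ∪ Σ \ {± i q₀}`.  In this and the next three
definitions the Wronskian, which does not depend on `x` because `X` is trace free, is taken at
`x = 0`; for `z ∈ Σ \ {± i q₀}` the four numbers are the entries of the matrix `S(z)` with
`Φ₊ = Φ₋ S`. -/
def s11 (q : ℝ → ℝ → ℂ) (q0 : ℝ) (qp qm : ℂ) (t : ℝ) (z : ℂ) : ℂ :=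
  wronskian (jostColumn q q0 qp atTop 0 t z 0) (jostColumn q q0 qm atBot 1 t z 0) / detE q0 z

/-- `s₂₂ = Wr(Φ₋₁, Φ₊₂) / (1 + q₀² / z²)` on `D⁻ ∪ Σ \ {± i q₀}`. -/
def s22 (q : ℝ → ℝ → ℂ) (q0 : ℝ) (qp qm : ℂ) (t : ℝ) (z : ℂ) : ℂ :=
  wronskian (jostColumn q q0 qm atBot 0 t z 0) (jostColumn q q0 qp atTop 1 t z 0) / detE q0 z

/-- `s₁₂ = Wr(Φ₊₂, Φ₋₂) / (1 + q₀² / z²)` on `Σ \ {± i q₀}`. -/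
def s12 (q : ℝ → ℝ → ℂ) (q0 : ℝ) (qp qm : ℂ) (t : ℝ) (z : ℂ) : ℂ :=
  wronskian (jostColumn q q0 qp atTop 1 t z 0) (jostColumn q q0 qm atBot 1 t z 0) / detE q0 z

/-- `s₂₁ = Wr(Φ₋₁, Φ₊₁) / (1 + q₀² / z²)` on `Σ \ {± i q₀}`. -/
def s21 (q : ℝ → ℝ → ℂ) (q0 : ℝ) (qp qm : ℂ) (t : ℝ) (z : ℂ) : ℂ :=
  wronskian (jostColumn q q0 qm atBot 0 t z 0) (jostColumn q q0 qp atTop 0 t z 0) / detE q0 z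

/-- The scattering matrix `S(z)`, `z ∈ Σ \ {± i q₀}`. -/
def scatMatrix (q : ℝ → ℝ → ℂ) (q0 : ℝ) (qp qm : ℂ) (t : ℝ) (z : ℂ) :
    Matrix (Fin 2) (Fin 2) ℂ :=
  !![s11 q q0 qp qm t z, s12 q q0 qp qm t z; s21 q q0 qp qm t z, s22 q q0 qp qm t z]

/-- The reflection coefficient `ρ = s₂₁ / s₁₁` on `Σ \ {± i q₀}`. -/
def rho (q : ℝ → ℝ → ℂ) (q0 : ℝ) (qp qm : ℂ) (t : ℝ) (z : ℂ) : ℂ :=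
  s21 q q0 qp qm t z / s11 q q0 qp qm t z

/-- The reflection coefficient `ρ̃ = s₁₂ / s₂₂` on `Σ \ {± i q₀}`. -/
def rhoTilde (q : ℝ → ℝ → ℂ) (q0 : ℝ) (qp qm : ℂ) (t : ℝ) (z : ℂ) : ℂ :=
  s12 q q0 qp qm t z / s22 q q0 qp qm t z

/-- `log (1 - ρ ρ̃)` on `Σ \ {± i q₀}`. -/
def logRefl (q : ℝ → ℝ → ℂ) (q0 : ℝ) (qp qm : ℂ) (t : ℝ) (ζ : ℂ) : ℂ :=
  Complex.log (1 - rho q q0 qp qm t ζ * rhoTilde q q0 qp qm t ζ)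

/-- The time slice `q(·, t)` satisfies the non-zero boundary conditions `q → q_±` as `x → ± ∞`,
`|q_±| = q₀ > 0`, with `(1 + |x|) (q - q_±) ∈ L¹(ℝ^±)`, and it is continuously differentiable
in `x` with `q_x ∈ L¹(ℝ)`. -/
structure NZBC (q : ℝ → ℝ → ℂ) (q0 : ℝ) (qp qm : ℂ) (t : ℝ) : Prop where
  pos : 0 < q0
  norm_qp : ‖qp‖ = q0
  norm_qm : ‖qm‖ = q0
  tendsto_top : Tendsto (fun x => q x t) atTop (𝓝 qp)
  tendsto_bot : Tendsto (fun x => q x t) atBot (𝓝 qm)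
  moment_top : IntegrableOn (fun x : ℝ => (1 + |x|) * ‖q x t - qp‖) (Set.Ioi 0)
  moment_bot : IntegrableOn (fun x : ℝ => (1 + |x|) * ‖q x t - qm‖) (Set.Iio 0)
  contDiff : ContDiff ℝ 1 (fun x => q x t)
  integrable_deriv : Integrable (deriv (fun x => q x t))

/-- No spectral singularities: `s₁₁ s₂₂ ≠ 0` on `Σ \ {± i q₀}`, and at the two branch points, at
which the scattering coefficients themselves are not defined, `1 / s₁₁` and `1 / s₂₂` extend
continuously. -/
structure NoSpectralSingularities (q : ℝ → ℝ → ℂ) (q0 : ℝ) (qp qm : ℂ) (t : ℝ) : Prop where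
  ne_zero : ∀ z ∈ contour \ branchPts q0, s11 q q0 qp qm t z * s22 q q0 qp qm t z ≠ 0
  inv_s11 : ∀ z₀ ∈ branchPts q0, ∃ c : ℂ,
    Tendsto (fun z => (s11 q q0 qp qm t z)⁻¹) (𝓝[(Dplus ∪ contour) \ branchPts q0] z₀) (𝓝 c)
  inv_s22 : ∀ z₀ ∈ branchPts q0, ∃ c : ℂ,
    Tendsto (fun z => (s22 q q0 qp qm t z)⁻¹) (𝓝[(Dminus ∪ contour) \ branchPts q0] z₀) (𝓝 c)

/-- The zeros of `f` in `U` are exactly the `N` distinct points `z n`, and all are double. -/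
def DoubleZerosIn (f : ℂ → ℂ) (U : Set ℂ) {N : ℕ} (z : Fin N → ℂ) : Prop :=
  Function.Injective z ∧ (∀ ζ : ℂ, (ζ ∈ U ∧ f ζ = 0) ↔ ∃ n, z n = ζ) ∧
    ∀ n, deriv f (z n) = 0 ∧ iteratedDeriv 2 f (z n) ≠ 0

/-- `{z : Re z > 0, Im z > 0, |z| > q₀}`. -/
def outerQuadrant (q0 : ℝ) : Set ℂ := {z | 0 < z.re ∧ 0 < z.im ∧ q0 < ‖z‖}

/-- `{q₀ e^{iφ} : 0 < φ < π / 2}`. -/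
def quarterArc (q0 : ℝ) : Set ℂ := {z | 0 < z.re ∧ 0 < z.im ∧ ‖z‖ = q0}

/-- The index set of the `4 N₁ + 2 N₂` points `η_n`. -/
abbrev EtaIndex (N₁ N₂ : ℕ) : Type :=
  (Fin N₁ ⊕ Fin N₁) ⊕ (Fin N₁ ⊕ Fin N₁) ⊕ (Fin N₂ ⊕ Fin N₂)

/-- The points `η`: `z_n`, `-z_n`, `q₀² / z_n*`, `-q₀² / z_n*`, `w_m`, `-w_m`. -/
def eta (q0 : ℝ) {N₁ N₂ : ℕ} (z : Fin N₁ → ℂ) (w : Fin N₂ → ℂ) : EtaIndex N₁ N₂ → ℂ :=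
  Sum.elim (Sum.elim (fun n => z n) (fun n => -z n))
    (Sum.elim
      (Sum.elim (fun n => (q0 : ℂ) ^ 2 / star (z n)) (fun n => -((q0 : ℂ) ^ 2 / star (z n))))
      (Sum.elim (fun m => w m) (fun m => -w m)))

/-- `η̂ = -q₀² / η`. -/
def etaHat (q0 : ℝ) {N₁ N₂ : ℕ} (z : Fin N₁ → ℂ) (w : Fin N₂ → ℂ) (n : EtaIndex N₁ N₂) : ℂ :=
  -((q0 : ℂ) ^ 2 / eta q0 z w n)

/-- The integral of `f` along the ray `{r d : r > 0}` from `0` to `∞`. -/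
def rayIntegral (f : ℂ → ℂ) (d : ℂ) : ℂ := ∫ r in Set.Ioi (0 : ℝ), f ((r : ℂ) * d) * d

/-- The integral along `Σ`, oriented so that `D⁺` lies to the left: the two real half-axes run
from `0` to `∞`, the two imaginary half-axes run from `∞` to `0`. -/
def contourIntegral (f : ℂ → ℂ) : ℂ :=
  rayIntegral f 1 + rayIntegral f (-1) - rayIntegral f Complex.I - rayIntegral f (-Complex.I)

/-- Absolute integrability along `Σ`. -/
def ContourIntegrable (f : ℂ → ℂ) : Prop :=
  ∀ d ∈ ({1, -1, Complex.I, -Complex.I} : Set ℂ),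
    IntegrableOn (fun r : ℝ => f ((r : ℂ) * d) * d) (Set.Ioi 0)

/-- `v₀ = ½ ∫ (|q|² - q₀²) dx`. -/
def v0 (q : ℝ → ℝ → ℂ) (q0 : ℝ) (t : ℝ) : ℝ := (1 / 2) * ∫ x : ℝ, (‖q x t‖ ^ 2 - q0 ^ 2)

/-- The potential is reflectionless: `ρ = ρ̃ = 0` on `Σ \ {± i q₀}`. -/
def Reflectionless (q : ℝ → ℝ → ℂ) (q0 : ℝ) (qp qm : ℂ) (t : ℝ) : Prop :=
  ∀ ζ ∈ contour \ branchPts q0, rho q q0 qp qm t ζ = 0 ∧ rhoTilde q q0 qp qm t ζ = 0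

end

end DNLS

/-! The trace formulae say that a holomorphic function on a half plane is determined by its zeros,
its limit at infinity and its modulus on the boundary. The symmetry z ↦ -z leaves s₁₁ unchanged
(`NZBC.s11_neg`), so s₁₁ is a function of u = z². Squaring sends D⁺ to the upper half plane and Σ to
the real line, and it folds the four rays of Σ with their orientation onto one line integral with
kernel 1/(s - u) (`contourIntegral_eq`).

Boundary modulus: det S = 1 and s₂₂ = s₁₁* on Σ, hence 1 - ρρ̃ = |s₁₁|⁻², so the logarithm in the
formulae is -2 log |s₁₁| (`NZBC.logRefl_eq`). Limit at infinity: the gauge change that diagonalizes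
the Lax equation to leading order leaves the scalar equation m' = (i/2)(|q|² - q₀²) m up to terms of
order 1/|z|, and integrating it over both half-lines gives s₁₁ → e^{-iv₀}
(`NZBC.jostValue_asymptotics`, `NZBC.s11_asymptotics`). Zeros: the inversion z ↦ q₀²/z* also acts on
the zeros of s₁₁, so the given points in the outer quadrant and on the arc account for all of them.
Dividing by the Blaschke product with double factors leaves a nonvanishing function tending to 1. It
has a logarithm decaying like |u|^{-1/2}, and the Schwarz formula recovers this logarithm from its
real part on the line (`schwarz_half_plane`, `eq_exp_integral_log`, `eq_prod_mul_exp_integral_log`).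
The formula for s₂₂ follows from s₂₂(z) = s₁₁(z*)*.

The analytic input is a Volterra equation for the Jost columns (`exists_volterra_solution`,
`NZBC.exists_jost_family`). The spectral projections of the background blow up at ±iq₀, but the
kernel built from them stays bounded up to a factor linear in y - x. The first moment of q - q₊ pays
for that factor. Hence s₁₁ grows at most like 1/(1 + q₀²/z²) at ±iq₀. Together with the boundedness
of 1/s₁₁ there, log |s₁₁| has at most a logarithmic singularity, which is integrable.

The theta condition is the limit z → 0. The inversion gives s₁₁(z) = (q₋/q₊) s₁₁(q₀²/z*)*, so s₁₁ →
(q₋/q₊) e^{iv₀} at the origin, and comparison with the trace formula fixes an argument modulo 2π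
(`NZBC.theta_exp`, `NZBC.theta_condition`). In the reflectionless case k(q₀) = 0 makes the Jost
columns constant at z = q₀. There s₁₂ = 0 forces q₊ = q₋. -/

namespace DNLS

noncomputable section

/-! ### Integrals over half-lines and holomorphic parameter integrals. -/

section Improper

variable {F : Type*} [NormedAddCommGroup F]

lemma integrableOn_Ioi_of_continuous {f : ℝ → F} (hf : Continuous f) {a : ℝ}
    (h : IntegrableOn f (Set.Ioi a)) (b : ℝ) : IntegrableOn f (Set.Ioi b) := by
  refine (((hf.integrableOn_Icc (a := b) (b := a)).mono_set
    (Set.Ioc_subset_Icc_self)).union h).mono_set ?_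
  intro y hy
  by_cases hya : y ≤ a
  · exact Or.inl ⟨hy, hya⟩
  · exact Or.inr (not_le.1 hya)

lemma hasDerivAt_integral_Ioi [NormedSpace ℝ F] [CompleteSpace F] {f : ℝ → F} (hf : Continuous f) {a : ℝ}
    (h : IntegrableOn f (Set.Ioi a)) (x : ℝ) :
    HasDerivAt (fun x => ∫ y in Set.Ioi x, f y) (-f x) x := by
  have h1 : (fun x => ∫ y in Set.Ioi x, f y)
      = fun x => (∫ y in Set.Ioi a, f y) - ∫ y in a..x, f y := by
    funext x
    rw [← intervalIntegral.integral_Ioi_sub_Ioi' h (integrableOn_Ioi_of_continuous hf h x)]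
    abel
  rw [h1, ← zero_sub]
  exact (hasDerivAt_const _ _).sub (intervalIntegral.integral_hasDerivAt_right
    (hf.intervalIntegrable _ _) (hf.stronglyMeasurableAtFilter _ _) hf.continuousAt)

end Improper

section HolomorphicIntegral

variable {α : Type*} [MeasurableSpace α] {μ : Measure α}
  {F : Type*} [NormedAddCommGroup F] [NormedSpace ℂ F]

/-- Holomorphic dependence of an integral on a parameter, under an integrable domination. -/
lemma differentiableOn_integral {U : Set ℂ} (hU : IsOpen U) {f : ℂ → α → F} {g : α → ℝ}
    (hm : ∀ z ∈ U, AEStronglyMeasurable (f z) μ)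
    (hd : ∀ᵐ a ∂μ, DifferentiableOn ℂ (fun z => f z a) U)
    (hb : ∀ᵐ a ∂μ, ∀ z ∈ U, ‖f z a‖ ≤ g a) (hg : Integrable g μ) :
    DifferentiableOn ℂ (fun z => ∫ a, f z a ∂μ) U := by
  intro z₀ hz₀
  obtain ⟨r, hr, hrU⟩ := Metric.isOpen_iff.1 hU z₀ hz₀
  have hr2 : 0 < r / 2 := by positivity
  have hsub : ∀ z ∈ Metric.ball z₀ (r / 2), Metric.closedBall z (r / 4) ⊆ U := by
    intro z hz y hy
    apply hrU
    rw [Metric.mem_ball] at *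
    rw [Metric.mem_closedBall] at hy
    have := dist_triangle y z z₀
    linarith
  have hsubU : Metric.ball z₀ (r / 2) ⊆ U := fun z hz =>
    hsub z hz (Metric.mem_closedBall_self (by positivity))
  have hint : Integrable (f z₀) μ := hg.mono' (hm z₀ hz₀) (hb.mono fun a ha => ha z₀ hz₀)
  -- The derivative is an almost everywhere limit of difference quotients along a sequence, which
  -- gives its measurability in the integration variable.
  have hmeas' : AEStronglyMeasurable (fun a => deriv (fun z => f z a) z₀) μ := by
    obtain ⟨u, hu0, hut⟩ : ∃ u : ℕ → ℂ, (∀ n, u n ≠ 0 ∧ z₀ + u n ∈ U) ∧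
        Tendsto u atTop (𝓝 0) := by
      refine ⟨fun n => ((r / 2 * (1 / ((n : ℝ) + 1)) : ℝ) : ℂ), fun n => ⟨?_, ?_⟩, ?_⟩
      · exact Complex.ofReal_ne_zero.2 (by positivity)
      · apply hrU
        rw [Metric.mem_ball, dist_self_add_left, Complex.norm_real, Real.norm_of_nonneg (by positivity)]
        have : 1 / ((n : ℝ) + 1) ≤ 1 := by
          rw [div_le_one (by positivity)]; linarith [(Nat.cast_nonneg n : (0:ℝ) ≤ n)]
        nlinarith
      · have : Tendsto (fun n : ℕ => r / 2 * (1 / ((n : ℝ) + 1))) atTop (𝓝 (r / 2 * 0)) :=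
          tendsto_one_div_add_atTop_nhds_zero_nat.const_mul _
        rw [mul_zero] at this
        exact_mod_cast (Complex.continuous_ofReal.tendsto 0).comp this
    refine aestronglyMeasurable_of_tendsto_ae atTop
      (f := fun n a => (u n)⁻¹ • (f (z₀ + u n) a - f z₀ a))
      (fun n => ((hm _ (hu0 n).2).sub (hm z₀ hz₀)).const_smul _) ?_
    filter_upwards [hd] with a ha
    have h1 := (ha.differentiableAt (hU.mem_nhds hz₀)).hasDerivAt
    rw [hasDerivAt_iff_tendsto_slope_zero] at h1
    exact h1.comp (tendsto_nhdsWithin_iff.2 ⟨hut, Eventually.of_forall fun n => (hu0 n).1⟩)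
  -- Cauchy's estimate on circles of radius r/4, which stay inside U for centres within r/2 of z₀,
  -- turns the bound g on f into the bound g/(r/4) on the derivative.
  have key := hasDerivAt_integral_of_dominated_loc_of_deriv_le (μ := μ) (F := f)
    (F' := fun z a => deriv (fun z => f z a) z) (x₀ := z₀) (bound := fun a => g a / (r / 4))
    (Metric.ball_mem_nhds z₀ hr2)
    ((hU.eventually_mem hz₀).mono fun z hz => hm z hz) hint hmeas' ?_ (hg.div_const _) ?_
  · exact key.2.differentiableAt.differentiableWithinAt
  · filter_upwards [hb, hd] with a ha hda z hz
    refine Complex.norm_deriv_le_of_forall_mem_sphere_norm_le (by positivity) ?_ ?_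
    · refine DifferentiableOn.diffContOnCl (hda.mono ?_)
      exact (closure_mono Metric.ball_subset_closedBall).trans
        (by rw [Metric.isClosed_closedBall.closure_eq]; exact hsub z hz)
    · intro w hw
      exact ha w (hsub z hz (Metric.sphere_subset_closedBall hw))
  · filter_upwards [hd] with a ha z hz
    exact (ha.differentiableAt (hU.mem_nhds (hsubU hz))).hasDerivAt

end HolomorphicIntegral

/-! ### Volterra equations on a half-line, with holomorphic dependence on the spectral parameter. -/

section Volterra

variable {E : Type*} [NormedAddCommGroup E] [NormedSpace ℂ E]

/-- The successive approximations of the Volterra equation `m x = v + ∫_x^∞ K x y (m y) dy`. -/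
def volterraTerm (K : ℝ → ℝ → E →L[ℂ] E) (v : E) : ℕ → ℝ → E
  | 0 => fun _ => v
  | n + 1 => fun x => ∫ y in Set.Ioi x, K x y (volterraTerm K v n y)

/-- The integrand is the derivative of -½ exp(2 ∫_y^∞ g). The factor 2 in the exponent is chosen so
that each integration against g gains a factor 1/2. -/
lemma integral_Ioi_mul_exp {g : ℝ → ℝ} (hg : Continuous g) (hg0 : ∀ y, 0 ≤ g y) {a : ℝ}
    (hgi : IntegrableOn g (Set.Ioi a)) (x : ℝ) :
    IntegrableOn (fun y => g y * Real.exp (2 * ∫ s in Set.Ioi y, g s)) (Set.Ioi x) ∧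
    ∫ y in Set.Ioi x, g y * Real.exp (2 * ∫ s in Set.Ioi y, g s) ≤
      1 / 2 * Real.exp (2 * ∫ s in Set.Ioi x, g s) := by
  have hd : ∀ y ∈ Set.Ici x, HasDerivAt (fun y => -(1 / 2) * Real.exp (2 * ∫ s in Set.Ioi y, g s))
      (g y * Real.exp (2 * ∫ s in Set.Ioi y, g s)) y := by
    intro y _
    convert! (((hasDerivAt_integral_Ioi hg hgi y).const_mul 2).exp).const_mul (-(1 / 2)) using 1
    ring
  have ht : Tendsto (fun y => -(1 / 2) * Real.exp (2 * ∫ s in Set.Ioi y, g s)) atTop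
      (𝓝 (-(1 / 2) * Real.exp (2 * 0))) := by
    refine Tendsto.const_mul _ ((Real.continuous_exp.tendsto _).comp (Tendsto.const_mul _ ?_))
    exact tendsto_integral_Ioi_zero tendsto_id
  have hnn : ∀ y ∈ Set.Ioi x, 0 ≤ g y * Real.exp (2 * ∫ s in Set.Ioi y, g s) := fun y _ =>
    mul_nonneg (hg0 y) (Real.exp_pos _).le
  refine ⟨integrableOn_Ioi_deriv_of_nonneg' hd hnn ht, ?_⟩
  rw [integral_Ioi_of_hasDerivAt_of_nonneg' hd hnn ht]
  simp

/-- Measured against the weight exp(2 ∫_x^∞ g), the Volterra operator is a contraction with constant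
1/2, without any smallness of g. The series of approximations is then dominated by a geometric one.
-/
lemma norm_volterraTerm_le {K : ℝ → ℝ → E →L[ℂ] E} {v : E} {a : ℝ} {g : ℝ → ℝ}
    (hg : Continuous g) (hg0 : ∀ y, 0 ≤ g y) (hgi : IntegrableOn g (Set.Ioi a))
    (hK : ∀ x, a ≤ x → ∀ y, x < y → ‖K x y‖ ≤ g y) (n : ℕ) :
    ∀ x, a ≤ x → ‖volterraTerm K v n x‖ ≤
      ‖v‖ * (1 / 2) ^ n * Real.exp (2 * ∫ y in Set.Ioi x, g y) := by
  induction n with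
  | zero =>
    intro x _
    have : 1 ≤ Real.exp (2 * ∫ y in Set.Ioi x, g y) :=
      Real.one_le_exp (mul_nonneg zero_le_two (integral_nonneg hg0))
    simpa [volterraTerm] using le_mul_of_one_le_right (norm_nonneg v) this
  | succ n ih =>
    intro x hx
    obtain ⟨h1, h2⟩ := integral_Ioi_mul_exp hg hg0 hgi x
    calc ‖volterraTerm K v (n + 1) x‖
        ≤ ∫ y in Set.Ioi x, ‖v‖ * (1 / 2) ^ n * (g y * Real.exp (2 * ∫ s in Set.Ioi y, g s)) := by
          refine norm_integral_le_of_norm_le (h1.const_mul _) ?_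
          refine (ae_restrict_iff' measurableSet_Ioi).2 (Eventually.of_forall fun y hy => ?_)
          have hy' : x < y := hy
          calc ‖K x y (volterraTerm K v n y)‖ ≤ ‖K x y‖ * ‖volterraTerm K v n y‖ :=
                (K x y).le_opNorm _
            _ ≤ g y * (‖v‖ * (1 / 2) ^ n * Real.exp (2 * ∫ s in Set.Ioi y, g s)) :=
                mul_le_mul (hK x hx y hy') (ih y (hx.trans hy'.le)) (norm_nonneg _) (hg0 y)
            _ = _ := by ring
      _ = ‖v‖ * (1 / 2) ^ n * ∫ y in Set.Ioi x, g y * Real.exp (2 * ∫ s in Set.Ioi y, g s) :=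
          integral_const_mul _ _
      _ ≤ ‖v‖ * (1 / 2) ^ n * (1 / 2 * Real.exp (2 * ∫ y in Set.Ioi x, g y)) := by gcongr
      _ = _ := by ring

/-- The kernel `(P + e^{c (y - x)} R) D(y)`. -/
def splitKernel (P R : E →L[ℂ] E) (c : ℂ) (D : ℝ → E →L[ℂ] E) (x y : ℝ) : E →L[ℂ] E :=
  (P + Complex.exp (c * ((y : ℂ) - x)) • R) ∘L D y

lemma norm_exp_mul_ofReal_le_one {c : ℂ} (hc : c.re ≤ 0) {s : ℝ} (hs : 0 ≤ s) :
    ‖Complex.exp (c * s)‖ ≤ 1 := by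
  rw [Complex.norm_exp, Complex.re_mul_ofReal, Real.exp_le_one_iff]
  exact mul_nonpos_of_nonpos_of_nonneg hc hs

variable {P R : E →L[ℂ] E} {c : ℂ} {D : ℝ → E →L[ℂ] E} {f : ℝ → E}

lemma integrableOn_exp_smul (hc : c.re ≤ 0) (hD : Continuous D) (hf : Continuous f)
    {x : ℝ} (hi : IntegrableOn (fun y => D y (f y)) (Set.Ioi x)) :
    IntegrableOn (fun y : ℝ => Complex.exp (c * y) • D y (f y)) (Set.Ioi x) := by
  refine Integrable.mono' (hi.norm.const_mul (‖Complex.exp (c * x)‖))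
    (by fun_prop : Continuous fun y : ℝ => Complex.exp (c * y) • D y (f y)).aestronglyMeasurable ?_
  refine (ae_restrict_iff' measurableSet_Ioi).2 (Eventually.of_forall fun y hy => ?_)
  have hy' : x < y := hy
  rw [norm_smul]
  gcongr
  have : Complex.exp (c * y) = Complex.exp (c * x) * Complex.exp (c * ((y - x : ℝ) : ℂ)) := by
    rw [← Complex.exp_add]; congr 1; push_cast; ring
  rw [this, norm_mul]
  exact mul_le_of_le_one_right (norm_nonneg _)
    (norm_exp_mul_ofReal_le_one hc (sub_nonneg.2 hy'.le))

/-- Writing e^{c(y-x)} as e^{-cx} e^{cy} moves the variable x out of the integrand, so that the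
Volterra integral can be differentiated by the fundamental theorem of calculus. -/
lemma integral_splitKernel [CompleteSpace E] (hc : c.re ≤ 0) (hD : Continuous D) (hf : Continuous f)
    (hi : ∀ x, IntegrableOn (fun y => D y (f y)) (Set.Ioi x)) (x : ℝ) :
    ∫ y in Set.Ioi x, splitKernel P R c D x y (f y) =
      P (∫ y in Set.Ioi x, D y (f y)) +
        Complex.exp (-(c * x)) • R (∫ y : ℝ in Set.Ioi x, Complex.exp (c * y) • D y (f y)) := by
  have h2 := integrableOn_exp_smul hc hD hf (hi x)
  rw [← ContinuousLinearMap.integral_comp_comm P (hi x),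
    ← ContinuousLinearMap.integral_comp_comm R h2, ← integral_smul, ← integral_add]
  · congr 1
    funext y
    simp only [splitKernel, ContinuousLinearMap.comp_apply, _root_.add_apply,
      _root_.smul_apply, map_smul, smul_smul]
    rw [← Complex.exp_add]
    congr 3
    ring
  · exact P.integrable_comp (hi x)
  · exact (R.integrable_comp h2).smul _

lemma hasDerivAt_integral_splitKernel [CompleteSpace E] (hc : c.re ≤ 0) (hD : Continuous D) (hf : Continuous f)
    (hi : ∀ x, IntegrableOn (fun y => D y (f y)) (Set.Ioi x)) (x : ℝ) :
    HasDerivAt (fun x => ∫ y in Set.Ioi x, splitKernel P R c D x y (f y))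
      (-(P (D x (f x)) + R (D x (f x))) - c • (Complex.exp (-(c * x)) •
        R (∫ y : ℝ in Set.Ioi x, Complex.exp (c * y) • D y (f y)))) x := by
  have h0 : (fun x => ∫ y in Set.Ioi x, splitKernel P R c D x y (f y)) = fun x =>
      P (∫ y in Set.Ioi x, D y (f y)) +
        Complex.exp (-(c * x)) • R (∫ y : ℝ in Set.Ioi x, Complex.exp (c * y) • D y (f y)) :=
    funext (integral_splitKernel hc hD hf hi)
  rw [h0]
  have h1 := hasDerivAt_integral_Ioi (by fun_prop : Continuous fun y => D y (f y)) (hi 0) x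
  have h2 := hasDerivAt_integral_Ioi
    (by fun_prop : Continuous fun y : ℝ => Complex.exp (c * y) • D y (f y))
    (integrableOn_exp_smul hc hD hf (hi 0)) x
  have h3 : HasDerivAt (fun x : ℝ => Complex.exp (-(c * x)))
      (Complex.exp (-(c * x)) * (-c)) x := by
    have : HasDerivAt (fun x : ℝ => -(c * (x : ℂ))) (-(c * 1)) x :=
      ((Complex.ofRealCLM.hasDerivAt (x := x)).const_mul c).neg
    simpa using this.cexp
  have h4 := ((P.restrictScalars ℝ).hasFDerivAt.comp_hasDerivAt x h1).add
    (h3.smul ((R.restrictScalars ℝ).hasFDerivAt.comp_hasDerivAt x h2))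
  refine HasDerivAt.congr_deriv h4 ?_
  simp only [ContinuousLinearMap.coe_restrictScalars', map_neg, map_smul, smul_neg, smul_smul,
    ← Complex.exp_add, Function.comp]
  rw [neg_add_cancel, Complex.exp_zero, one_smul, mul_neg, neg_smul,
    mul_comm (Complex.exp _)]
  abel

variable [CompleteSpace E] {S U : Set ℂ} {P R : ℂ → E →L[ℂ] E} {c : ℂ → ℂ} {v : ℂ → E}
  {D : ℂ → ℝ → E →L[ℂ] E} {B : ℝ}

/-- The solution is the sum of the successive approximations. The bound `hK` concerns only the
combined kernel and is uniform in z. The operators P and R may separately be unbounded on S, which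
is what happens near the branch points. Uniform convergence transports continuity on S and
holomorphy on U to the sum. -/
theorem exists_volterra_solution (hU : IsOpen U) (hUS : U ⊆ S)
    (hPc : ContinuousOn P S) (hRc : ContinuousOn R S) (hcc : ContinuousOn c S)
    (hvc : ContinuousOn v S) (hDc : ∀ y, ContinuousOn (fun z => D z y) S)
    (hPd : DifferentiableOn ℂ P U) (hRd : DifferentiableOn ℂ R U) (hcd : DifferentiableOn ℂ c U)
    (hvd : DifferentiableOn ℂ v U) (hDd : ∀ y, DifferentiableOn ℂ (fun z => D z y) U)
    (hDx : ∀ z ∈ S, Continuous (D z)) (hre : ∀ z ∈ S, (c z).re ≤ 0) (hB : ∀ z ∈ S, ‖v z‖ ≤ B)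
    (hK : ∀ a : ℝ, ∃ g : ℝ → ℝ, Continuous g ∧ (∀ y, 0 ≤ g y) ∧ IntegrableOn g (Set.Ioi a) ∧
      ∀ z ∈ S, ∀ x, a ≤ x → ∀ y, x < y → ‖splitKernel (P z) (R z) (c z) (D z) x y‖ ≤ g y)
    (hDi : ∀ z ∈ S, ∀ x, IntegrableOn (fun y => ‖D z y‖) (Set.Ioi x))
    (hPR : ∀ z ∈ S, P z + R z = 1) (hRP : ∀ z ∈ S, R z * P z = 0)
    (hRR : ∀ z ∈ S, R z * R z = R z) (hRv : ∀ z ∈ S, R z (v z) = 0) :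
    ∃ m : ℂ → ℝ → E,
      (∀ z ∈ S, ∀ x, HasDerivAt (m z) (-(D z x (m z x)) - c z • R z (m z x)) x) ∧
      (∀ z ∈ S, Tendsto (m z) atTop (𝓝 (v z))) ∧
      (∀ x, ContinuousOn (fun z => m z x) S) ∧ (∀ x, DifferentiableOn ℂ (fun z => m z x) U) ∧
      ∀ x, ∃ M, ∀ z ∈ S, ‖m z x‖ ≤ M := by
  set K : ℂ → ℝ → ℝ → E →L[ℂ] E := fun z => splitKernel (P z) (R z) (c z) (D z) with hKdef
  set T : ℂ → ℕ → ℝ → E := fun z => volterraTerm (K z) (v z) with hT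
  have hTsucc : ∀ z n x, T z (n + 1) x = ∫ y in Set.Ioi x, K z x y (T z n y) := fun _ _ _ => rfl
  have hbound : ∀ a, ∃ M, 0 ≤ M ∧ ∀ z ∈ S, ∀ n x, a ≤ x → ‖T z n x‖ ≤ M * (1 / 2) ^ n := by
    intro a
    obtain ⟨g, hg, hg0, hgi, hgK⟩ := hK a
    refine ⟨|B| * Real.exp (2 * ∫ y in Set.Ioi a, g y), by positivity, fun z hz n x hx => ?_⟩
    have h1 := norm_volterraTerm_le (v := v z) hg hg0 hgi (hgK z hz) n x hx
    have h2 : ∫ y in Set.Ioi x, g y ≤ ∫ y in Set.Ioi a, g y :=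
      setIntegral_mono_set hgi (Eventually.of_forall hg0) (Set.Ioi_subset_Ioi hx).eventuallyLE
    calc ‖T z n x‖ ≤ ‖v z‖ * (1 / 2) ^ n * Real.exp (2 * ∫ y in Set.Ioi x, g y) := h1
      _ ≤ |B| * (1 / 2) ^ n * Real.exp (2 * ∫ y in Set.Ioi a, g y) := by
          gcongr
          exact (hB z hz).trans (le_abs_self B)
      _ = _ := by ring
  have hDf : ∀ z ∈ S, ∀ f : ℝ → E, Continuous f → (∀ a, ∃ M, ∀ x, a ≤ x → ‖f x‖ ≤ M) →
      ∀ x, IntegrableOn (fun y => D z y (f y)) (Set.Ioi x) := by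
    intro z hz f hf hfb x
    obtain ⟨M, hM⟩ := hfb x
    have := hDx z hz
    refine Integrable.mono' ((hDi z hz x).mul_const M)
      (by fun_prop : Continuous fun y => D z y (f y)).aestronglyMeasurable ?_
    refine (ae_restrict_iff' measurableSet_Ioi).2 (Eventually.of_forall fun y hy => ?_)
    exact ((D z y).le_opNorm _).trans (by gcongr; exact hM y (le_of_lt hy))
  have hTb : ∀ z ∈ S, ∀ n, ∀ a, ∃ M, ∀ x, a ≤ x → ‖T z n x‖ ≤ M := by
    intro z hz n a
    obtain ⟨M, -, hM⟩ := hbound a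
    exact ⟨_, fun x hx => hM z hz n x hx⟩
  have hTx : ∀ z ∈ S, ∀ n, Continuous (T z n) := by
    intro z hz n
    induction n with
    | zero => exact continuous_const
    | succ n ih =>
      exact continuous_iff_continuousAt.2 fun x => (hasDerivAt_integral_splitKernel (hre z hz)
        (hDx z hz) ih (hDf z hz _ ih (hTb z hz n)) x).continuousAt
  have hKy : ∀ z ∈ S, ∀ x, Continuous (K z x) := by
    intro z hz x
    have := hDx z hz
    change Continuous fun y => splitKernel (P z) (R z) (c z) (D z) x y
    simp only [splitKernel]
    fun_prop
  have hKTm : ∀ n x, ∀ z ∈ S,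
      AEStronglyMeasurable (fun y => K z x y (T z n y)) (volume.restrict (Set.Ioi x)) := by
    intro n x z hz
    have h1 := hKy z hz x
    have h2 := hTx z hz n
    exact (by fun_prop : Continuous fun y => K z x y (T z n y)).aestronglyMeasurable
  have hKTb : ∀ x, ∃ g : ℝ → ℝ, ∃ M, 0 ≤ M ∧ IntegrableOn g (Set.Ioi x) ∧ (∀ y, 0 ≤ g y) ∧
      (∀ z ∈ S, ∀ y ∈ Set.Ioi x, ‖K z x y‖ ≤ g y) ∧
      ∀ n, ∀ z ∈ S, ∀ y ∈ Set.Ioi x, ‖K z x y (T z n y)‖ ≤ g y * (M * (1 / 2) ^ n) := by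
    intro x
    obtain ⟨g, hg, hg0, hgi, hgK⟩ := hK x
    obtain ⟨M, hM0, hM⟩ := hbound x
    refine ⟨g, M, hM0, hgi, hg0, fun z hz y hy => hgK z hz x le_rfl y hy, fun n z hz y hy => ?_⟩
    exact ((K z x y).le_opNorm _).trans (mul_le_mul (hgK z hz x le_rfl y hy)
      (hM z hz n y (le_of_lt hy)) (norm_nonneg _) (hg0 y))
  have hKc : ∀ x y, ContinuousOn (fun z => K z x y) S := by
    intro x y
    have := hDc y
    simp only [hKdef, splitKernel]
    fun_prop
  have hKd : ∀ x y, DifferentiableOn ℂ (fun z => K z x y) U := by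
    intro x y
    have := hDd y
    simp only [hKdef, splitKernel]
    fun_prop
  have hTc : ∀ n x, ContinuousOn (fun z => T z n x) S := by
    intro n
    induction n with
    | zero => exact fun x => hvc
    | succ n ih =>
      intro x
      obtain ⟨g, M, -, hgi, -, -, hgK⟩ := hKTb x
      exact continuousOn_of_dominated (hKTm n x)
        (fun z hz => (ae_restrict_iff' measurableSet_Ioi).2
          (Eventually.of_forall fun y hy => hgK n z hz y hy)) (hgi.mul_const _)
        (Eventually.of_forall fun y => (hKc x y).clm_apply (ih y))
  have hTd : ∀ n x, DifferentiableOn ℂ (fun z => T z n x) U := by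
    intro n
    induction n with
    | zero => exact fun x => hvd
    | succ n ih =>
      intro x
      obtain ⟨g, M, -, hgi, -, -, hgK⟩ := hKTb x
      exact differentiableOn_integral hU (fun z hz => hKTm n x z (hUS hz))
        (Eventually.of_forall fun y => (hKd x y).clm_apply (ih y))
        ((ae_restrict_iff' measurableSet_Ioi).2
          (Eventually.of_forall fun y hy z hz => hgK n z (hUS hz) y hy)) (hgi.mul_const _)
  have hgeom : Summable fun n : ℕ => ((1 : ℝ) / 2) ^ n := summable_geometric_two
  have hsum : ∀ z ∈ S, ∀ x, Summable fun n => T z n x := by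
    intro z hz x
    obtain ⟨M, -, hM⟩ := hbound x
    exact Summable.of_norm_bounded (hgeom.mul_left M) fun n => hM z hz n x le_rfl
  set m : ℂ → ℝ → E := fun z x => ∑' n, T z n x with hm
  have hmb : ∀ a, ∃ M, 0 ≤ M ∧ ∀ z ∈ S, ∀ x, a ≤ x → ‖m z x‖ ≤ M := by
    intro a
    obtain ⟨M, hM0, hM⟩ := hbound a
    exact ⟨M * 2, by positivity, fun z hz x hx =>
      tsum_of_norm_bounded (hasSum_geometric_two.mul_left M) fun n => hM z hz n x hx⟩
  have hmx : ∀ z ∈ S, Continuous (m z) := by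
    intro z hz
    refine continuous_iff_continuousAt.2 fun x => ?_
    obtain ⟨M, -, hM⟩ := hbound (x - 1)
    have : ContinuousOn (m z) (Set.Ici (x - 1)) :=
      continuousOn_tsum (fun n => (hTx z hz n).continuousOn) (hgeom.mul_left M)
        fun n y hy => hM z hz n y hy
    exact this.continuousAt (Ici_mem_nhds (by linarith))
  have hmint : ∀ z ∈ S, ∀ x, IntegrableOn (fun y => D z y (m z y)) (Set.Ioi x) := fun z hz =>
    hDf z hz _ (hmx z hz) fun a => by
      obtain ⟨M, -, hM⟩ := hmb a
      exact ⟨M, fun x hx => hM z hz x hx⟩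
  have heq : ∀ z ∈ S, ∀ x, m z x = v z + ∫ y in Set.Ioi x, K z x y (m z y) := by
    intro z hz x
    obtain ⟨g, M, hM0, hgi, hg0, -, hgK⟩ := hKTb x
    have h1 : HasSum (fun n => ∫ y in Set.Ioi x, K z x y (T z n y))
        (∫ y in Set.Ioi x, K z x y (m z y)) := by
      refine hasSum_integral_of_dominated_convergence (fun n y => g y * (M * (1 / 2) ^ n))
        (fun n => hKTm n x z hz) (fun n => (ae_restrict_iff' measurableSet_Ioi).2
          (Eventually.of_forall fun y hy => hgK n z hz y hy))
        (Eventually.of_forall fun y => (hgeom.mul_left M).mul_left _) ?_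
        (Eventually.of_forall fun y => (K z x y).hasSum (hsum z hz y).hasSum)
      simp_rw [tsum_mul_left]
      exact hgi.mul_const _
    change ∑' n, T z n x = _
    rw [(hsum z hz x).tsum_eq_zero_add, ← h1.tsum_eq]
    rfl
  refine ⟨m, fun z hz x => ?_, fun z hz => ?_, fun x => ?_, fun x => ?_, fun x => ?_⟩
  · have h1 := (hasDerivAt_integral_splitKernel (P := P z) (R := R z) (hre z hz) (hDx z hz)
      (hmx z hz) (hmint z hz) x).const_add (v z)
    -- Applying R to the integral equation annihilates v and the P part, so the exponential term
    -- produced by differentiation is R m. This closes the differential equation.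
    have h2 : R z (m z x) = Complex.exp (-(c z * x)) • R z
        (∫ y : ℝ in Set.Ioi x, Complex.exp (c z * y) • D z y (m z y)) := by
      have hRP' : ∀ u, R z (P z u) = 0 := fun u => by
        simpa using congrArg (fun A : E →L[ℂ] E => A u) (hRP z hz)
      have hRR' : ∀ u, R z (R z u) = R z u := fun u => by
        simpa using congrArg (fun A : E →L[ℂ] E => A u) (hRR z hz)
      conv_lhs => rw [heq z hz x, integral_splitKernel (hre z hz) (hDx z hz) (hmx z hz) (hmint z hz)]
      rw [map_add, map_add, hRv z hz, hRP', map_smul, hRR', zero_add, zero_add]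
    have h3 : P z (D z x (m z x)) + R z (D z x (m z x)) = D z x (m z x) := by
      simpa using congrArg (fun A : E →L[ℂ] E => A (D z x (m z x))) (hPR z hz)
    rw [h2, ← h3]
    exact h1.congr_of_eventuallyEq (Eventually.of_forall fun y => heq z hz y)
  · obtain ⟨g, hg, hg0, hgi, hgK⟩ := hK 0
    obtain ⟨M, hM0, hM⟩ := hmb 0
    have h0 : Tendsto (fun x => (∫ y in Set.Ioi x, g y) * M) atTop (𝓝 (0 * M)) :=
      (tendsto_integral_Ioi_zero tendsto_id).mul_const M
    rw [zero_mul] at h0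
    rw [tendsto_iff_norm_sub_tendsto_zero]
    refine squeeze_zero' (Eventually.of_forall fun _ => norm_nonneg _) ?_ h0
    filter_upwards [eventually_ge_atTop (0 : ℝ)] with x hx
    rw [heq z hz x, add_sub_cancel_left, ← integral_mul_const]
    refine norm_integral_le_of_norm_le ((hgi.mono_set (Set.Ioi_subset_Ioi hx)).mul_const M) ?_
    refine (ae_restrict_iff' measurableSet_Ioi).2 (Eventually.of_forall fun y hy => ?_)
    exact ((K z x y).le_opNorm _).trans (mul_le_mul (hgK z hz x hx y hy)
      (hM z hz y (hx.trans (le_of_lt hy))) (norm_nonneg _) (hg0 y))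
  · obtain ⟨M, -, hM⟩ := hbound x
    exact continuousOn_tsum (fun n => hTc n x) (hgeom.mul_left M) fun n z hz => hM z hz n x le_rfl
  · obtain ⟨M, -, hM⟩ := hbound x
    exact Complex.differentiableOn_tsum_of_summable_norm (hgeom.mul_left M) (fun n => hTd n x) hU
      fun n z hz => hM z (hUS hz) n x le_rfl
  · obtain ⟨M, -, hM⟩ := hmb x
    exact ⟨M, fun z hz => hM z hz x le_rfl⟩

end Volterra

end

/-! ### The Lax operator, the admissible spectral set and uniqueness of the Jost columns. -/

noncomputable section

/-- A `2 × 2` matrix as a continuous linear operator. -/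
def matCLM (M : Matrix (Fin 2) (Fin 2) ℂ) : (Fin 2 → ℂ) →L[ℂ] (Fin 2 → ℂ) :=
  LinearMap.toContinuousLinearMap (Matrix.toLin' M)

@[simp] lemma matCLM_apply (M : Matrix (Fin 2) (Fin 2) ℂ) (v : Fin 2 → ℂ) :
    matCLM M v = M *ᵥ v := rfl

lemma norm_matCLM_potMatrix_le (a : ℂ) : ‖matCLM (potMatrix a)‖ ≤ ‖a‖ := by
  refine ContinuousLinearMap.opNorm_le_bound _ (norm_nonneg _) fun v => ?_
  refine (pi_norm_le_iff_of_nonneg (by positivity)).2 fun i => ?_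
  fin_cases i
  · simpa [potMatrix, Matrix.mulVec, dotProduct, Fin.sum_univ_two] using
      mul_le_mul_of_nonneg_left (norm_le_pi_norm v 1) (norm_nonneg a)
  · simpa [potMatrix, Matrix.mulVec, dotProduct, Fin.sum_univ_two] using
      mul_le_mul_of_nonneg_left (norm_le_pi_norm v 0) (norm_nonneg a)

lemma continuous_matCLM_potMatrix {α : Type*} [TopologicalSpace α] {f : α → ℂ}
    (hf : Continuous f) : Continuous fun x => matCLM (potMatrix (f x)) := by
  have : (fun x => matCLM (potMatrix (f x))) = fun x =>
      f x • matCLM !![0, 1; 0, 0] + star (f x) • matCLM !![0, 0; -1, 0] := by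
    funext x
    ext v i
    fin_cases i <;> simp [potMatrix, Matrix.mulVec, dotProduct, Fin.sum_univ_two]
  rw [this]
  have h2 : Continuous fun x => star (f x) := continuous_star.comp hf
  fun_prop

lemma specK_mul_specLam (q0 : ℝ) (z : ℂ) :
    specK q0 z * specLam q0 z = (z ^ 2 - ((q0 : ℂ) ^ 2 / z) ^ 2) / 4 := by
  simp only [specK, specLam]; ring

lemma specLam_sq (q0 : ℝ) {z : ℂ} (hz : z ≠ 0) :
    specLam q0 z ^ 2 = specK q0 z ^ 2 + (q0 : ℂ) ^ 2 := by
  simp only [specK, specLam]; field_simp; ring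

/-- The sign of Im(kλ), which decides at which end e^{±iθ} decays, is the sign of Re z · Im z. This
is the origin of D⁺ and D⁻. -/
lemma im_specK_mul_specLam (q0 : ℝ) (z : ℂ) :
    (specK q0 z * specLam q0 z).im =
      z.re * z.im * (1 + q0 ^ 4 / Complex.normSq z ^ 2) / 2 := by
  rw [specK_mul_specLam]
  by_cases hz : z = 0
  · simp [hz]
  have hn : Complex.normSq z ≠ 0 := by simpa using hz
  rw [div_eq_mul_inv ((q0 : ℂ) ^ 2)]
  have h1 : (((q0 : ℂ) ^ 2 * z⁻¹) ^ 2).im = -(2 * q0 ^ 4 * (z.re * z.im) / Complex.normSq z ^ 2) := by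
    have : ((q0 : ℂ) ^ 2 * z⁻¹) = ((q0 ^ 2 : ℝ) : ℂ) * z⁻¹ := by push_cast; ring
    rw [this, pow_two, Complex.mul_im, Complex.re_ofReal_mul, Complex.im_ofReal_mul,
      Complex.inv_re, Complex.inv_im]
    field_simp; ring
  rw [show (4 : ℂ) = ((4 : ℝ) : ℂ) by norm_num, Complex.div_ofReal_im, Complex.sub_im, h1, pow_two,
    Complex.mul_im]
  field_simp; ring

lemma im_specK_mul_specLam_nonneg (q0 : ℝ) {z : ℂ} (hz : 0 ≤ z.re * z.im) :
    0 ≤ (specK q0 z * specLam q0 z).im := by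
  rw [im_specK_mul_specLam]; positivity

/-- `(D⁺ ∪ Σ) \ {± i q₀}`. -/
def admissible (q0 : ℝ) : Set ℂ := {z | 0 ≤ z.re * z.im ∧ z ≠ 0 ∧ specLam q0 z ≠ 0}

lemma specLam_eq_zero_iff {q0 : ℝ} {z : ℂ} (hz : z ≠ 0) :
    specLam q0 z = 0 ↔ z ∈ branchPts q0 := by
  have h1 : specLam q0 z = (z - Complex.I * q0) * (z + Complex.I * q0) / (2 * z) := by
    simp only [specLam]
    field_simp
    linear_combination ((q0:ℂ)^2) * Complex.I_sq
  rw [h1, div_eq_zero_iff, mul_eq_zero, sub_eq_zero, add_eq_zero_iff_eq_neg]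
  simp [branchPts, hz]

lemma Dplus_subset_admissible {q0 : ℝ} : Dplus ⊆ admissible q0 := by
  intro z hz
  have hz' : 0 < z.re * z.im := hz
  have h0 : z ≠ 0 := by rintro rfl; simp at hz'
  refine ⟨hz'.le, h0, fun h => ?_⟩
  rcases (specLam_eq_zero_iff h0).1 h with h | h
  · rw [h] at hz'; simp at hz'
  · rw [Set.mem_singleton_iff.1 h] at hz'; simp at hz'

lemma isOpen_Dplus : IsOpen Dplus :=
  isOpen_lt continuous_const (Complex.continuous_re.mul Complex.continuous_im)

lemma ne_zero_of_mem_Dplus {z : ℂ} (hz : z ∈ Dplus) : z ≠ 0 :=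
  (Dplus_subset_admissible (q0 := 0) hz).2.1

section Uniqueness

variable {q : ℝ → ℝ → ℂ} {q0 : ℝ} {qp qm : ℂ} {t : ℝ}

lemma NZBC.continuous (h : NZBC q q0 qp qm t) : Continuous fun x => q x t := h.contDiff.continuous

lemma NZBC.bounded (h : NZBC q q0 qp qm t) : ∃ M, 0 ≤ M ∧ ∀ x, ‖q x t‖ ≤ M := by
  have h1 : ∀ᶠ x in atTop, ‖q x t‖ < ‖qp‖ + 1 := h.tendsto_top.norm.eventually_lt_const (by simp)
  have h2 : ∀ᶠ x in atBot, ‖q x t‖ < ‖qm‖ + 1 := h.tendsto_bot.norm.eventually_lt_const (by simp)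
  obtain ⟨a, ha⟩ := eventually_atTop.1 h1
  obtain ⟨b, hb⟩ := eventually_atBot.1 h2
  obtain ⟨C, hC⟩ := (isCompact_Icc (a := b) (b := a)).exists_bound_of_continuousOn
    h.continuous.continuousOn
  refine ⟨max C (max (‖qp‖ + 1) (‖qm‖ + 1)), by positivity, fun x => ?_⟩
  rcases le_total a x with hx | hx
  · exact (ha x hx).le.trans (by simp)
  rcases le_total x b with hx' | hx'
  · exact (hb x hx').le.trans (by simp)
  · exact (hC x ⟨hx', hx⟩).trans (by simp)

lemma laxX_mulVec (q : ℝ → ℝ → ℂ) (q0 x t : ℝ) (z : ℂ) (v : Fin 2 → ℂ) :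
    laxX q q0 x t z *ᵥ v = ![Complex.I * specK q0 z ^ 2 * v 0 + specK q0 z * q x t * v 1,
      -(specK q0 z * star (q x t) * v 0) - Complex.I * specK q0 z ^ 2 * v 1] := by
  funext i
  fin_cases i <;>
    simp [laxX, sigma3, potMatrix, Matrix.mulVec, dotProduct, Fin.sum_univ_two]
  ring

/-- Because q is bounded on the line, the Lax system is Lipschitz with one constant for all x, and
global uniqueness applies. -/
lemma NZBC.lax_unique (h : NZBC q q0 qp qm t) (z : ℂ) {φ ψ : ℝ → Fin 2 → ℂ}
    (hφ : ∀ x, HasDerivAt φ (laxX q q0 x t z *ᵥ φ x) x)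
    (hψ : ∀ x, HasDerivAt ψ (laxX q q0 x t z *ᵥ ψ x) x) {x₀ : ℝ} (h0 : φ x₀ = ψ x₀) : φ = ψ := by
  obtain ⟨M, hM0, hM⟩ := h.bounded
  set C : ℝ := ‖(Complex.I * specK q0 z ^ 2) • matCLM sigma3‖ + ‖specK q0 z‖ * M with hC
  refine ODE_solution_unique_univ (v := fun x v => laxX q q0 x t z *ᵥ v) (s := fun _ => Set.univ)
    (K := C.toNNReal) (t₀ := x₀) (fun x => ?_) (fun x => ⟨hφ x, trivial⟩) (fun x => ⟨hψ x, trivial⟩) h0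
  have hX : ∀ v, laxX q q0 x t z *ᵥ v = ((Complex.I * specK q0 z ^ 2) • matCLM sigma3 +
      specK q0 z • matCLM (potMatrix (q x t))) v := by
    intro v
    simp [laxX, Matrix.add_mulVec, Matrix.smul_mulVec]
  simp_rw [hX]
  refine ((ContinuousLinearMap.lipschitz _).weaken ?_).lipschitzOnWith
  refine NNReal.le_toNNReal_of_coe_le ?_
  rw [coe_nnnorm]
  refine (norm_add_le _ _).trans (add_le_add le_rfl ?_)
  rw [norm_smul]
  exact mul_le_mul_of_nonneg_left ((norm_matCLM_potMatrix_le _).trans (hM x)) (norm_nonneg _)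

lemma hasDerivAt_wronskian {z : ℂ} {φ ψ : ℝ → Fin 2 → ℂ}
    (hφ : ∀ x, HasDerivAt φ (laxX q q0 x t z *ᵥ φ x) x)
    (hψ : ∀ x, HasDerivAt ψ (laxX q q0 x t z *ᵥ ψ x) x) (x : ℝ) :
    HasDerivAt (fun x => wronskian (φ x) (ψ x)) 0 x := by
  have h1 := fun i => hasDerivAt_pi.1 (hφ x) i
  have h2 := fun i => hasDerivAt_pi.1 (hψ x) i
  refine HasDerivAt.congr_deriv (((h1 0).mul (h2 1)).sub ((h1 1).mul (h2 0))) ?_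
  simp only [laxX_mulVec, Matrix.cons_val_zero, Matrix.cons_val_one]
  ring

lemma wronskian_eq {z : ℂ} {φ ψ : ℝ → Fin 2 → ℂ}
    (hφ : ∀ x, HasDerivAt φ (laxX q q0 x t z *ᵥ φ x) x)
    (hψ : ∀ x, HasDerivAt ψ (laxX q q0 x t z *ᵥ ψ x) x) (x y : ℝ) :
    wronskian (φ x) (ψ x) = wronskian (φ y) (ψ y) :=
  is_const_of_deriv_eq_zero (fun x => (hasDerivAt_wronskian hφ hψ x).differentiableAt)
    (fun x => (hasDerivAt_wronskian hφ hψ x).deriv) x y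

lemma wronskian_smul_smul (a b : ℂ) (u v : Fin 2 → ℂ) :
    wronskian (a • u) (b • v) = a * b * wronskian u v := by
  simp [wronskian]; ring

lemma continuous_wronskian : Continuous fun p : (Fin 2 → ℂ) × (Fin 2 → ℂ) => wronskian p.1 p.2 := by
  simp only [wronskian]; fun_prop

lemma wronskian_eq_zero_iff {u v : Fin 2 → ℂ} (hv : v ≠ 0) (h : wronskian u v = 0) :
    ∃ c : ℂ, u = c • v := by
  simp only [wronskian] at h
  by_cases h0 : v 0 = 0
  · have h1 : v 1 ≠ 0 := fun h1 => hv (by ext i; fin_cases i <;> simp [h0, h1])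
    refine ⟨u 1 / v 1, ?_⟩
    have : u 0 = 0 := by simpa [h0, h1] using h
    ext i; fin_cases i <;> simp [h0, h1, this]
  · refine ⟨u 0 / v 0, ?_⟩
    ext i; fin_cases i
    · simp [h0]
    · simp; field_simp; linear_combination -h

lemma phase_eq (q0 x t : ℝ) (z : ℂ) : phase q0 x t z = specK q0 z * specLam q0 z * x +
    phase q0 0 t z := by
  simp only [phase]; push_cast; ring

/-- Two candidates have a constant Wronskian W, and e^{-2iθ} W tends to the Wronskian of E₁ with
itself, which is 0. Since Im(kλ) ≥ 0, the factor e^{-2iθ} does not tend to 0 at +∞, so W = 0. The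
candidates are then proportional, and the first entry 1 of E₁ makes the ratio 1. -/
lemma NZBC.jost_unique (h : NZBC q q0 qp qm t) {b z : ℂ} (hz : 0 ≤ z.re * z.im)
    {φ ψ : ℝ → Fin 2 → ℂ} (hφ : IsJostColumn q q0 b atTop 0 t z φ)
    (hψ : IsJostColumn q q0 b atTop 0 t z ψ) : φ = ψ := by
  have hW := wronskian_eq hφ.1 hψ.1
  set a := specK q0 z * specLam q0 z with ha
  have ha0 : 0 ≤ a.im := im_specK_mul_specLam_nonneg q0 hz
  have hlim : Tendsto (fun x : ℝ => Complex.exp (-(Complex.I * phase q0 x t z * sigma3 0 0)) *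
      Complex.exp (-(Complex.I * phase q0 x t z * sigma3 0 0)) * wronskian (φ 0) (ψ 0)) atTop
      (𝓝 0) := by
    have := (continuous_wronskian.tendsto _).comp (hφ.2.prodMk_nhds hψ.2)
    simp only [Function.comp_def, wronskian_smul_smul] at this
    have h2 : wronskian (fun i => bgMatrix b z i 0) (fun i => bgMatrix b z i 0) = 0 := by
      simp [wronskian]; ring
    rw [h2] at this
    exact this.congr fun x => by rw [hW x 0]
  have hW0 : wronskian (φ 0) (ψ 0) = 0 := by
    by_contra hne
    have h3 := hlim.norm
    rw [norm_zero] at h3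
    set c := ‖Complex.exp (-(2 * (Complex.I * phase q0 0 t z)))‖ * ‖wronskian (φ 0) (ψ 0)‖ with hc
    have hcpos : 0 < c := mul_pos (norm_pos_iff.2 (Complex.exp_ne_zero _)) (norm_pos_iff.2 hne)
    have h4 : ∀ᶠ x : ℝ in atTop, c ≤ ‖Complex.exp (-(Complex.I * phase q0 x t z * sigma3 0 0)) *
      Complex.exp (-(Complex.I * phase q0 x t z * sigma3 0 0)) * wronskian (φ 0) (ψ 0)‖ := by
      filter_upwards [eventually_ge_atTop (0 : ℝ)] with x hx
      rw [← Complex.exp_add, norm_mul, hc, phase_eq q0 x t z]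
      have : -(Complex.I * (specK q0 z * specLam q0 z * x + phase q0 0 t z) * sigma3 0 0) +
          -(Complex.I * (specK q0 z * specLam q0 z * x + phase q0 0 t z) * sigma3 0 0) =
          -(2 * (Complex.I * phase q0 0 t z)) + -(2 * Complex.I * a) * x := by
        simp [sigma3, ha]; ring
      rw [this, Complex.exp_add, norm_mul]
      gcongr
      refine le_mul_of_one_le_right (norm_nonneg _) ?_
      rw [Complex.norm_exp, Complex.re_mul_ofReal, Real.one_le_exp_iff]
      refine mul_nonneg ?_ hx
      simpa using ha0
    exact absurd (ge_of_tendsto h3 h4) (not_le.2 hcpos)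
  have hE : (fun i => bgMatrix b z i 0) ≠ 0 := fun h0 => by
    simpa [bgMatrix] using congrFun h0 0
  have hψ0 : ψ 0 ≠ 0 := by
    intro h0
    have : ψ = fun _ => 0 := h.lax_unique z hψ.1 (fun x => by simpa using hasDerivAt_const x _) h0
    have h5 := hψ.2
    rw [this] at h5
    simp only [smul_zero] at h5
    exact hE (tendsto_nhds_unique h5 tendsto_const_nhds)
  obtain ⟨c, hc⟩ := wronskian_eq_zero_iff hψ0 hW0
  have hφψ : φ = fun x => c • ψ x := by
    refine h.lax_unique z hφ.1 (fun x => ?_) hc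
    rw [Matrix.mulVec_smul]
    exact (hψ.1 x).const_smul c
  have h6 := hφ.2
  rw [hφψ] at h6
  have h7 := hψ.2.const_smul c
  simp only [smul_comm c] at h7
  have h8 := congrFun (tendsto_nhds_unique h6 h7) 0
  have hc1 : c = 1 := by simpa [bgMatrix] using h8.symm
  rw [hφψ, hc1]
  simp

end Uniqueness

end

/-! ### Existence, continuity and holomorphy of the first Jost column at +∞. -/

noncomputable section

/-- Mean value inequality on the convex left half plane, where the derivative of exp has modulus at
most 1. -/
lemma norm_exp_sub_one_le_of_re_nonpos {w : ℂ} (hw : w.re ≤ 0) : ‖Complex.exp w - 1‖ ≤ ‖w‖ := by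
  have hconv : Convex ℝ {w : ℂ | w.re ≤ 0} := convex_halfSpace_re_le 0
  have := hconv.norm_image_sub_le_of_norm_hasDerivWithin_le (f := Complex.exp) (f' := Complex.exp)
    (C := 1) (x := 0) (y := w) (fun x _ => (Complex.hasDerivAt_exp x).hasDerivWithinAt)
    (fun x hx => by rw [Complex.norm_exp]; exact Real.exp_le_one_iff.2 hx) (by simp) hw
  simpa using this

/-- The operator `i k σ₃ + Q_b`, whose square is `-λ²`. -/
def bgOp (q0 : ℝ) (b z : ℂ) : (Fin 2 → ℂ) →L[ℂ] (Fin 2 → ℂ) :=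
  (Complex.I * specK q0 z) • matCLM sigma3 + matCLM (potMatrix b)

lemma bgOp_apply (q0 : ℝ) (b z : ℂ) (v : Fin 2 → ℂ) : bgOp q0 b z v =
    ![Complex.I * specK q0 z * v 0 + b * v 1, -(star b * v 0) - Complex.I * specK q0 z * v 1] := by
  funext i
  fin_cases i <;> simp [bgOp, sigma3, potMatrix, dotProduct, Fin.sum_univ_two]
  ring

lemma bgOp_mul_self {q0 : ℝ} {b z : ℂ} (hb : ‖b‖ = q0) (hz : z ≠ 0) :
    bgOp q0 b z * bgOp q0 b z = (-specLam q0 z ^ 2) • 1 := by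
  have hbb : b * (starRingEnd ℂ) b = (q0 : ℂ) ^ 2 := by
    rw [← hb]; exact Complex.mul_conj' b
  ext v i
  simp only [mul_apply_eq_comp, bgOp_apply, specLam_sq q0 hz]
  fin_cases i
  · simp
    linear_combination (-v 0) * hbb + (specK q0 z ^ 2 * v 0) * Complex.I_sq
  · simp
    linear_combination (-v 1) * hbb + (specK q0 z ^ 2 * v 1) * Complex.I_sq

lemma bgOp_bgMatrix {q0 : ℝ} {b z : ℂ} (hb : ‖b‖ = q0) (hz : z ≠ 0) :
    bgOp q0 b z (fun i => bgMatrix b z i 0) =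
      (Complex.I * specLam q0 z) • fun i => bgMatrix b z i 0 := by
  have hbb : b * (starRingEnd ℂ) b = (q0 : ℂ) ^ 2 := by
    rw [← hb]; exact Complex.mul_conj' b
  rw [bgOp_apply]
  ext i
  fin_cases i
  · simp [bgMatrix, specK, specLam]
    field_simp
    linear_combination 2 * hbb
  · simp [bgMatrix, specK, specLam]
    field_simp
    linear_combination (-(2 * (starRingEnd ℂ) b * z ^ 2)) * Complex.I_sq

/-- The spectral projection `½ (1 + s Y / (i λ))`, `s = ±1`, of the background operator. -/
def bgProj (s : ℂ) (q0 : ℝ) (b z : ℂ) : (Fin 2 → ℂ) →L[ℂ] (Fin 2 → ℂ) :=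
  (1 / 2 : ℂ) • (1 + (s * (Complex.I * specLam q0 z)⁻¹) • bgOp q0 b z)

section

variable {q0 : ℝ} {b z : ℂ}

lemma bgProj_add : bgProj 1 q0 b z + bgProj (-1) q0 b z = 1 := by
  ext1 v
  simp only [bgProj, _root_.smul_apply, _root_.add_apply, one_apply_eq_self]
  module

/-- With s, s' = ±1 this one identity contains both idempotency and mutual annihilation of the two
spectral projections. -/
lemma bgProj_mul (hb : ‖b‖ = q0) (hz : z ≠ 0) (hl : specLam q0 z ≠ 0) (s s' : ℂ) :
    bgProj s q0 b z * bgProj s' q0 b z =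
      (1 / 4 : ℂ) • ((1 + s * s') • 1 + ((s + s') * (Complex.I * specLam q0 z)⁻¹) • bgOp q0 b z) := by
  ext1 v
  have hY : bgOp q0 b z (bgOp q0 b z v) = (-specLam q0 z ^ 2) • v :=
    congrArg (fun A : (Fin 2 → ℂ) →L[ℂ] (Fin 2 → ℂ) => A v) (bgOp_mul_self hb hz)
  have hI : s * (Complex.I * specLam q0 z)⁻¹ * (s' * (Complex.I * specLam q0 z)⁻¹) *
      -specLam q0 z ^ 2 = s * s' := by
    have := Complex.I_ne_zero
    field_simp
    linear_combination (-(s * s')) * Complex.I_sq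
  simp only [bgProj, mul_apply_eq_comp, _root_.smul_apply, _root_.add_apply, one_apply_eq_self,
    map_smul, map_add, hY]
  rw [← hI]
  module

lemma bgProj_neg_apply_bgMatrix (hb : ‖b‖ = q0) (hz : z ≠ 0) (hl : specLam q0 z ≠ 0) :
    bgProj (-1) q0 b z (fun i => bgMatrix b z i 0) = 0 := by
  have : (Complex.I * specLam q0 z) ≠ 0 := mul_ne_zero Complex.I_ne_zero hl
  simp only [bgProj, _root_.smul_apply, _root_.add_apply, bgOp_bgMatrix hb hz, smul_smul,
    one_apply_eq_self]
  rw [mul_assoc, inv_mul_cancel₀ this]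
  simp

/-- Factoring e^{iθ} out of the column removes the scalar ikλ from the background operator. What
remains acts only on the range of the second projection, which is the form c R required by the
Volterra equation. -/
lemma specK_smul_bgOp (hl : specLam q0 z ≠ 0) : specK q0 z • bgOp q0 b z =
    (Complex.I * (specK q0 z * specLam q0 z)) • 1 -
      (2 * Complex.I * (specK q0 z * specLam q0 z)) • bgProj (-1) q0 b z := by
  have h1 : 2 * Complex.I * (specK q0 z * specLam q0 z) * ((1 / 2 : ℂ) *
      (-1 * (Complex.I * specLam q0 z)⁻¹)) = - specK q0 z := by
    have := Complex.I_ne_zero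
    field_simp
  simp only [bgProj, smul_add, smul_smul]
  rw [h1]
  module

/-- With e the exponential, the combination is ½(1 + e) + ½(1 - e)(iλ)⁻¹Y. Since 1 - e = O(|kλ| s),
the pole 1/λ cancels. The bound is therefore uniform up to the branch points, at the price of the
factor s. -/
lemma norm_specK_smul_bgProj_le (hz : 0 ≤ z.re * z.im) (hl : specLam q0 z ≠ 0) {s : ℝ}
    (hs : 0 ≤ s) :
    ‖specK q0 z • (bgProj 1 q0 b z +
        Complex.exp (2 * Complex.I * (specK q0 z * specLam q0 z) * s) • bgProj (-1) q0 b z)‖ ≤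
      ‖specK q0 z‖ + ‖specK q0 z‖ ^ 2 * s * ‖bgOp q0 b z‖ := by
  set a := specK q0 z * specLam q0 z with ha
  set e := Complex.exp (2 * Complex.I * a * s) with he
  have hre : (2 * Complex.I * a).re ≤ 0 := by
    have : 0 ≤ a.im := im_specK_mul_specLam_nonneg q0 hz
    simpa using this
  have h1 : specK q0 z • (bgProj 1 q0 b z + e • bgProj (-1) q0 b z) =
      (specK q0 z * (1 / 2 * (1 + e))) • 1 +
        (specK q0 z * (1 / 2 * (1 - e) * (Complex.I * specLam q0 z)⁻¹)) • bgOp q0 b z := by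
    simp only [bgProj]; module
  have h2 : ‖e‖ ≤ 1 := norm_exp_mul_ofReal_le_one hre hs
  have h3 : ‖1 - e‖ ≤ 2 * (‖specK q0 z‖ * ‖specLam q0 z‖) * s := by
    rw [norm_sub_rev]
    refine (norm_exp_sub_one_le_of_re_nonpos ?_).trans (le_of_eq ?_)
    · rw [Complex.re_mul_ofReal]; exact mul_nonpos_of_nonpos_of_nonneg hre hs
    · simp [ha, abs_of_nonneg hs]
  rw [h1]
  refine (norm_add_le _ _).trans (add_le_add ?_ ?_)
  · rw [norm_smul, norm_mul, norm_mul]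
    have h4 : ‖1 + e‖ ≤ 2 := (norm_add_le _ _).trans (by rw [norm_one]; linarith)
    have h5 : ‖(1 : (Fin 2 → ℂ) →L[ℂ] (Fin 2 → ℂ))‖ ≤ 1 := ContinuousLinearMap.norm_id_le
    have h6 : ‖(1 / 2 : ℂ)‖ = 1 / 2 := by norm_num
    rw [h6]
    calc ‖specK q0 z‖ * (1 / 2 * ‖1 + e‖) * ‖(1 : (Fin 2 → ℂ) →L[ℂ] (Fin 2 → ℂ))‖
        ≤ ‖specK q0 z‖ * (1 / 2 * 2) * 1 := by gcongr
      _ = _ := by ring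
  · rw [norm_smul]
    gcongr
    have hl' : 0 < ‖specLam q0 z‖ := norm_pos_iff.2 hl
    rw [norm_mul, norm_mul, norm_mul, norm_inv, norm_mul, Complex.norm_I, one_mul]
    have h6 : ‖(1 / 2 : ℂ)‖ = 1 / 2 := by norm_num
    rw [h6]
    calc ‖specK q0 z‖ * (1 / 2 * ‖1 - e‖ * ‖specLam q0 z‖⁻¹)
        ≤ ‖specK q0 z‖ * (1 / 2 * (2 * (‖specK q0 z‖ * ‖specLam q0 z‖) * s) * ‖specLam q0 z‖⁻¹) := by
          gcongr
      _ = _ := by field_simp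

end

variable {q : ℝ → ℝ → ℂ} {q0 : ℝ} {qp qm : ℂ} {t : ℝ}

lemma NZBC.integrableOn_moment (h : NZBC q q0 qp qm t) (a : ℝ) :
    IntegrableOn (fun x : ℝ => (1 + |x|) * ‖q x t - qp‖) (Set.Ioi a) :=
  integrableOn_Ioi_of_continuous (by have := h.continuous; fun_prop) h.moment_top a

lemma NZBC.integrableOn_sub (h : NZBC q q0 qp qm t) (a : ℝ) :
    IntegrableOn (fun x : ℝ => ‖q x t - qp‖) (Set.Ioi a) := by
  refine (h.integrableOn_moment a).mono' ?_ (Eventually.of_forall fun x => ?_)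
  · exact (by have := h.continuous; fun_prop :
      Continuous fun x : ℝ => ‖q x t - qp‖).aestronglyMeasurable
  · rw [norm_norm]
    exact le_mul_of_one_le_left (norm_nonneg _) (by linarith [abs_nonneg x])

/-- A bound on k keeps z away from 0 because q₀²/z = z - 2k. This makes the normalization vector E₁
bounded. -/
lemma norm_inv_le_of_norm_specK_le {q0 κ : ℝ} (hq0 : 0 < q0) {z : ℂ} (hz : z ≠ 0)
    (h : ‖specK q0 z‖ ≤ κ) : ‖z⁻¹‖ ≤ 1 + (1 + 2 * κ) / q0 ^ 2 := by
  have hκ : 0 ≤ κ := (norm_nonneg _).trans h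
  have hz' : 0 < ‖z‖ := norm_pos_iff.2 hz
  rw [norm_inv]
  rcases le_total 1 ‖z‖ with h1 | h1
  · have : ‖z‖⁻¹ ≤ 1 := inv_le_one_of_one_le₀ h1
    have : 0 ≤ (1 + 2 * κ) / q0 ^ 2 := by positivity
    linarith
  · have h2 : (q0 : ℂ) ^ 2 / z = z - 2 * specK q0 z := by simp only [specK]; ring
    have h3 : q0 ^ 2 / ‖z‖ ≤ 1 + 2 * κ := by
      have : ‖(q0 : ℂ) ^ 2 / z‖ = q0 ^ 2 / ‖z‖ := by simp
      rw [← this, h2]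
      refine (norm_sub_le _ _).trans ?_
      rw [norm_mul]
      simp only [Complex.norm_ofNat]
      linarith
    have : ‖z‖⁻¹ ≤ (1 + 2 * κ) / q0 ^ 2 := by
      rw [le_div_iff₀ (by positivity)]
      calc ‖z‖⁻¹ * q0 ^ 2 = q0 ^ 2 / ‖z‖ := by ring
        _ ≤ _ := h3
    linarith

lemma continuousOn_specK (q0 : ℝ) : ContinuousOn (specK q0) {z | z ≠ 0} := by
  unfold specK
  fun_prop (disch := simp)

lemma differentiableOn_specK (q0 : ℝ) : DifferentiableOn ℂ (specK q0) {z | z ≠ 0} := by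
  unfold specK
  fun_prop (disch := simp)

lemma differentiableOn_specLam (q0 : ℝ) : DifferentiableOn ℂ (specLam q0) {z | z ≠ 0} := by
  unfold specLam
  fun_prop (disch := simp)

/-- The Volterra theorem is applied to m = e^{-iθ} Φ₊₁ with perturbation k(Q - Q₊). Restricting to
|k| < κ gives one dominating function for all z, including z close to ±iq₀. The final uniform bound
is what controls s₁₁ at the branch points. -/
theorem NZBC.exists_jost_family (h : NZBC q q0 qp qm t) (κ : ℝ) :
    ∃ m : ℂ → ℝ → Fin 2 → ℂ,
      (∀ z ∈ admissible q0, ‖specK q0 z‖ < κ → IsJostColumn q q0 qp atTop 0 t z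
        fun x => Complex.exp (Complex.I * phase q0 x t z) • m z x) ∧
      ContinuousOn (fun z => m z 0) (admissible q0 ∩ {z | ‖specK q0 z‖ < κ}) ∧
      DifferentiableOn ℂ (fun z => m z 0) (Dplus ∩ {z | ‖specK q0 z‖ < κ}) ∧
      ∃ M, ∀ z ∈ admissible q0, ‖specK q0 z‖ < κ → ‖m z 0‖ ≤ M := by
  have hqc := h.continuous
  set S := admissible q0 ∩ {z | ‖specK q0 z‖ < κ} with hS
  set U := Dplus ∩ {z | ‖specK q0 z‖ < κ} with hUdef
  have hUS : U ⊆ S := Set.inter_subset_inter_left _ Dplus_subset_admissible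
  have hU : IsOpen U := by
    have : ContinuousOn (fun z => ‖specK q0 z‖) Dplus :=
      ((continuousOn_specK q0).mono fun z hz => ne_zero_of_mem_Dplus hz).norm
    exact this.isOpen_inter_preimage isOpen_Dplus isOpen_Iio
  have hS0 : S ⊆ {z | z ≠ 0} := fun z hz => hz.1.2.1
  have hkS : ContinuousOn (specK q0) S := (continuousOn_specK q0).mono hS0
  have hkU : DifferentiableOn ℂ (specK q0) U := (differentiableOn_specK q0).mono (hUS.trans hS0)
  have hlS : ContinuousOn (specLam q0) S := ((differentiableOn_specLam q0).mono hS0).continuousOn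
  have hlU : DifferentiableOn ℂ (specLam q0) U :=
    (differentiableOn_specLam q0).mono (hUS.trans hS0)
  have hIl : ∀ z ∈ S, Complex.I * specLam q0 z ≠ 0 := fun z hz =>
    mul_ne_zero Complex.I_ne_zero hz.1.2.2
  have hPc : ∀ s, ContinuousOn (bgProj s q0 qp) S := by
    intro s
    have : ContinuousOn (fun z => (Complex.I * specLam q0 z)⁻¹) S :=
      (continuousOn_const.mul hlS).inv₀ hIl
    unfold bgProj bgOp
    fun_prop
  have hPd : ∀ s, DifferentiableOn ℂ (bgProj s q0 qp) U := by
    intro s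
    have : DifferentiableOn ℂ (fun z => (Complex.I * specLam q0 z)⁻¹) U :=
      (hlU.const_mul _).inv fun z hz => hIl z (hUS hz)
    unfold bgProj bgOp
    fun_prop
  have hvc : ∀ T : Set ℂ, T ⊆ S → ∀ i, ContinuousOn (fun z => bgMatrix qp z i 0) T := by
    intro T hT i
    have : ∀ z ∈ T, z ≠ 0 := fun z hz => hS0 (hT hz)
    fin_cases i
    · simpa [bgMatrix] using continuousOn_const
    · simp only [bgMatrix]; simp
      fun_prop (disch := assumption)
  have hvd : ∀ i, DifferentiableOn ℂ (fun z => bgMatrix qp z i 0) U := by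
    intro i
    have : ∀ z ∈ U, z ≠ 0 := fun z hz => hS0 (hUS hz)
    fin_cases i
    · simp only [bgMatrix]; simp
    · simp only [bgMatrix]; simp
      fun_prop (disch := assumption)
  have hpot : Continuous fun y => matCLM (potMatrix (q y t - qp)) :=
    continuous_matCLM_potMatrix (hqc.sub continuous_const)
  have key := exists_volterra_solution (S := S) (U := U)
    (P := bgProj 1 q0 qp) (R := bgProj (-1) q0 qp)
    (c := fun z => 2 * Complex.I * (specK q0 z * specLam q0 z))
    (v := fun z i => bgMatrix qp z i 0)
    (D := fun z y => (-specK q0 z) • matCLM (potMatrix (q y t - qp)))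
    (B := 1 + q0 * (1 + (1 + 2 * κ) / q0 ^ 2)) hU hUS (hPc 1) (hPc (-1)) (by fun_prop)
    (continuousOn_pi.2 fun i => hvc S subset_rfl i) (fun y => by fun_prop) (hPd 1) (hPd (-1))
    (by fun_prop) (differentiableOn_pi.2 hvd) (fun y => by fun_prop)
    (fun z _ => by fun_prop) ?_ ?_ ?_ ?_ (fun z _ => bgProj_add) ?_ ?_ ?_
  rotate_left
  · intro z hz
    have : 0 ≤ (specK q0 z * specLam q0 z).im := im_specK_mul_specLam_nonneg q0 hz.1.1
    have h2 : (2 * Complex.I * (specK q0 z * specLam q0 z)).re =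
      -(2 * (specK q0 z * specLam q0 z).im) := by
      generalize specK q0 z * specLam q0 z = a
      simp
    rw [h2]; linarith
  · intro z hz
    have hκ : 0 ≤ κ := (norm_nonneg _).trans hz.2.le
    have h0 := norm_inv_le_of_norm_specK_le h.pos (hS0 hz) hz.2.le
    have hq0 := h.pos
    have hnn : 0 ≤ (1 + 2 * κ) / q0 ^ 2 := by positivity
    refine (pi_norm_le_iff_of_nonneg (by positivity)).2 fun i => ?_
    fin_cases i
    · simp [bgMatrix]; positivity
    · have h1 : ‖bgMatrix qp z 1 0‖ = q0 * ‖z⁻¹‖ := by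
        simp [bgMatrix, h.norm_qp, div_eq_mul_inv]
      change ‖bgMatrix qp z 1 0‖ ≤ _
      rw [h1]
      nlinarith
  · intro a
    set Y0 : ℝ := κ * ‖matCLM sigma3‖ + ‖matCLM (potMatrix qp)‖ with hY0
    set C : ℝ := |κ| + |κ| ^ 2 * (1 + |a|) * |Y0| with hC
    refine ⟨fun y => C * ((1 + |y|) * ‖q y t - qp‖), by fun_prop, fun y => by positivity,
      (h.integrableOn_moment a).const_mul C, fun z hz x hx y hxy => ?_⟩
    have hκ : 0 ≤ κ := (norm_nonneg _).trans hz.2.le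
    have hk : ‖specK q0 z‖ ≤ κ := hz.2.le
    have hY : ‖bgOp q0 qp z‖ ≤ Y0 := by
      refine (norm_add_le _ _).trans (add_le_add ?_ le_rfl)
      rw [norm_smul, norm_mul, Complex.norm_I, one_mul]
      gcongr
    have hY00 : 0 ≤ Y0 := (norm_nonneg _).trans hY
    have h1 : splitKernel (bgProj 1 q0 qp z) (bgProj (-1) q0 qp z)
        (2 * Complex.I * (specK q0 z * specLam q0 z))
        (fun y => (-specK q0 z) • matCLM (potMatrix (q y t - qp))) x y =
        -((specK q0 z • (bgProj 1 q0 qp z +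
        Complex.exp (2 * Complex.I * (specK q0 z * specLam q0 z) * ((y - x : ℝ) : ℂ)) •
          bgProj (-1) q0 qp z)) ∘L matCLM (potMatrix (q y t - qp))) := by
      simp only [splitKernel]
      push_cast
      rw [ContinuousLinearMap.comp_smul, ContinuousLinearMap.smul_comp, neg_smul]
    rw [h1, norm_neg]
    refine (ContinuousLinearMap.opNorm_comp_le _ _).trans ?_
    have h2 := norm_specK_smul_bgProj_le (b := qp) hz.1.1 hz.1.2.2 (sub_nonneg.2 hxy.le)
    -- Since x ≥ a, the linear growth of the kernel is absorbed by the weight 1 + |y| of the first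
    -- moment.
    have h3 : y - x ≤ (1 + |a|) * (1 + |y|) := by
      have := neg_abs_le a
      have := le_abs_self y
      nlinarith [abs_nonneg a, abs_nonneg y, mul_nonneg (abs_nonneg a) (abs_nonneg y)]
    have h4 : ‖specK q0 z‖ + ‖specK q0 z‖ ^ 2 * (y - x) * ‖bgOp q0 qp z‖ ≤ C * (1 + |y|) := by
      rw [hC, abs_of_nonneg hκ, abs_of_nonneg hY00]
      calc ‖specK q0 z‖ + ‖specK q0 z‖ ^ 2 * (y - x) * ‖bgOp q0 qp z‖
          ≤ κ * (1 + |y|) + κ ^ 2 * ((1 + |a|) * (1 + |y|)) * Y0 := by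
            refine add_le_add ?_ ?_
            · exact hk.trans (le_mul_of_one_le_right hκ (by linarith [abs_nonneg y]))
            · have : 0 ≤ y - x := by linarith
              gcongr
        _ = _ := by ring
    calc _ ≤ (C * (1 + |y|)) * ‖q y t - qp‖ :=
          mul_le_mul (h2.trans h4) (norm_matCLM_potMatrix_le _) (norm_nonneg _) (by positivity)
      _ = _ := by ring
  · intro z hz x
    have h1 : Continuous fun y => ‖(-specK q0 z) • matCLM (potMatrix (q y t - qp))‖ := by fun_prop
    refine ((h.integrableOn_sub x).const_mul ‖specK q0 z‖).mono' h1.aestronglyMeasurable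
      (Eventually.of_forall fun y => ?_)
    rw [norm_norm, norm_smul, norm_neg]
    exact mul_le_mul_of_nonneg_left (norm_matCLM_potMatrix_le _) (norm_nonneg _)
  · intro z hz
    rw [bgProj_mul h.norm_qp (hS0 hz) hz.1.2.2]
    ext1 v
    simp only [_root_.smul_apply, _root_.add_apply, one_apply_eq_self, _root_.zero_apply]
    module
  · intro z hz
    rw [bgProj_mul h.norm_qp (hS0 hz) hz.1.2.2]
    simp only [bgProj]
    module
  · intro z hz
    exact bgProj_neg_apply_bgMatrix h.norm_qp (hS0 hz) hz.1.2.2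
  · obtain ⟨m, hm1, hm2, hm3, hm4, hm5⟩ := key
    refine ⟨m, fun z hz hk => ⟨fun x => ?_, ?_⟩, hm3 0, hm4 0, ?_⟩
    · have h1 := hm1 z ⟨hz, hk⟩ x
      have h2 : HasDerivAt (fun x : ℝ => Complex.exp (Complex.I * phase q0 x t z))
          (Complex.exp (Complex.I * phase q0 x t z) *
            (Complex.I * (specK q0 z * specLam q0 z))) x := by
        have h3 : HasDerivAt (fun x : ℝ => Complex.I * phase q0 x t z)
            (Complex.I * (specK q0 z * specLam q0 z * 1)) x := by
          simp only [phase]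
          exact (((Complex.ofRealCLM.hasDerivAt (x := x)).sub_const _).const_mul _).const_mul _
        simpa using h3.cexp
      refine (h2.smul h1).congr_deriv ?_
      have h4 : laxX q q0 x t z *ᵥ (Complex.exp (Complex.I * phase q0 x t z) • m z x) =
          Complex.exp (Complex.I * phase q0 x t z) • ((specK q0 z • bgOp q0 qp z) (m z x) +
            specK q0 z • matCLM (potMatrix (q x t - qp)) (m z x)) := by
        rw [Matrix.mulVec_smul, laxX_mulVec]
        congr 1
        rw [_root_.smul_apply, bgOp_apply]
        funext i
        fin_cases i <;> simp [potMatrix, dotProduct, Fin.sum_univ_two] <;> ring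
      rw [h4, specK_smul_bgOp hz.2.2]
      simp only [_root_.sub_apply, _root_.smul_apply, one_apply_eq_self]
      module
    · have h1 := hm2 z ⟨hz, hk⟩
      refine h1.congr fun x => ?_
      rw [smul_smul, ← Complex.exp_add]
      simp [sigma3]
    · obtain ⟨M, hM⟩ := hm5 0
      exact ⟨M, fun z hz hk => hM z ⟨hz, hk⟩⟩

/-- The normalized value at `x = 0` of the first Jost column at `+∞`. -/
def jostValue (q : ℝ → ℝ → ℂ) (q0 : ℝ) (b : ℂ) (t : ℝ) (z : ℂ) : Fin 2 → ℂ :=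
  Complex.exp (-(Complex.I * phase q0 0 t z)) • jostColumn q q0 b atTop 0 t z 0

lemma NZBC.isJostColumn (h : NZBC q q0 qp qm t) {z : ℂ} (hz : z ∈ admissible q0) :
    IsJostColumn q q0 qp atTop 0 t z (jostColumn q q0 qp atTop 0 t z) := by
  obtain ⟨m, hm, -⟩ := h.exists_jost_family (‖specK q0 z‖ + 1)
  exact Classical.epsilon_spec (p := IsJostColumn q q0 qp atTop 0 t z) ⟨_, hm z hz (by linarith)⟩

/-- By uniqueness the families obtained for different κ all coincide with the chosen column, so
their regularity passes to `jostValue`. -/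
lemma NZBC.exists_jostValue (h : NZBC q q0 qp qm t) (κ : ℝ) :
      ContinuousOn (jostValue q q0 qp t) (admissible q0 ∩ {z | ‖specK q0 z‖ < κ}) ∧
      DifferentiableOn ℂ (jostValue q q0 qp t) (Dplus ∩ {z | ‖specK q0 z‖ < κ}) ∧
      ∃ M, ∀ z ∈ admissible q0, ‖specK q0 z‖ < κ → ‖jostValue q q0 qp t z‖ ≤ M := by
  obtain ⟨m, hm1, hm2, hm3, M, hM⟩ := h.exists_jost_family κ
  have key : ∀ z ∈ admissible q0, ‖specK q0 z‖ < κ → jostValue q q0 qp t z = m z 0 := by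
    intro z hz hk
    have := h.jost_unique hz.1 (h.isJostColumn hz) (hm1 z hz hk)
    rw [jostValue, this, smul_smul, ← Complex.exp_add]
    simp
  exact ⟨hm2.congr fun z hz => key z hz.1 hz.2,
    hm3.congr fun z hz => key z (Dplus_subset_admissible hz.1) hz.2,
    M, fun z hz hk => by rw [key z hz hk]; exact hM z hz hk⟩

lemma NZBC.continuousOn_jostValue (h : NZBC q q0 qp qm t) :
    ContinuousOn (jostValue q q0 qp t) (admissible q0) := by
  intro z hz
  obtain ⟨h1, -⟩ := h.exists_jostValue (‖specK q0 z‖ + 1)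
  have hk : ‖specK q0 z‖ < ‖specK q0 z‖ + 1 := by linarith
  refine (h1 z ⟨hz, hk⟩).mono_of_mem_nhdsWithin ?_
  have h2 : ContinuousWithinAt (fun z => ‖specK q0 z‖) (admissible q0) z :=
    (((continuousOn_specK q0).mono fun w hw => hw.2.1) z hz).norm
  exact inter_mem self_mem_nhdsWithin (h2.eventually_lt_const hk)

lemma NZBC.differentiableOn_jostValue (h : NZBC q q0 qp qm t) :
    DifferentiableOn ℂ (jostValue q q0 qp t) Dplus := by
  intro z hz
  obtain ⟨-, h1, -⟩ := h.exists_jostValue (‖specK q0 z‖ + 1)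
  have hk : ‖specK q0 z‖ < ‖specK q0 z‖ + 1 := by linarith
  refine (h1 z ⟨hz, hk⟩).mono_of_mem_nhdsWithin ?_
  have h2 : ContinuousWithinAt (fun z => ‖specK q0 z‖) Dplus z :=
    (((continuousOn_specK q0).mono fun w hw => ne_zero_of_mem_Dplus hw) z hz).norm
  exact inter_mem self_mem_nhdsWithin (h2.eventually_lt_const hk)

end

/-! ### Asymptotics of the Jost column for large z. -/

noncomputable section

variable {q : ℝ → ℝ → ℂ} {q0 : ℝ} {qp qm : ℂ} {t : ℝ}

/-- If `(p y)' = p r` with `|p|` nonincreasing and `r` dominated, then `p y` stays close to its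
limit. -/
lemma norm_mul_sub_limit_le {p y r : ℝ → ℂ} {h : ℝ → ℝ} {L : ℂ} (hp : Continuous p)
    (hr : Continuous r)
    (hd : ∀ x, HasDerivAt (fun s => p s * y s) (p x * r x) x)
    (hmono : ∀ x, 0 ≤ x → ∀ s, x ≤ s → ‖p s‖ ≤ ‖p x‖)
    (hrh : ∀ x, 0 ≤ x → ‖r x‖ ≤ h x) (hh : IntegrableOn h (Set.Ioi 0))
    (hL : Tendsto (fun s => p s * y s) atTop (𝓝 L)) {x : ℝ} (hx : 0 ≤ x) :
    ‖p x * y x - L‖ ≤ ‖p x‖ * ∫ s in Set.Ioi 0, h s := by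
  have hhx : IntegrableOn h (Set.Ioi x) := hh.mono_set (Set.Ioi_subset_Ioi hx)
  have hb : ∀ᵐ s ∂(volume.restrict (Set.Ioi x)), ‖p s * r s‖ ≤ ‖p x‖ * h s := by
    refine (ae_restrict_iff' measurableSet_Ioi).2 (Eventually.of_forall fun s hs => ?_)
    have hs' : x ≤ s := le_of_lt hs
    rw [norm_mul]
    exact mul_le_mul (hmono x hx s hs') (hrh s (hx.trans hs')) (norm_nonneg _) (norm_nonneg _)
  have hi : IntegrableOn (fun s => p s * r s) (Set.Ioi x) :=
    (hhx.const_mul _).mono' (hp.mul hr).aestronglyMeasurable hb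
  have h1 := integral_Ioi_of_hasDerivAt_of_tendsto' (a := x) (fun s _ => hd s) hi hL
  rw [norm_sub_rev, ← h1]
  refine (norm_integral_le_of_norm_le (hhx.const_mul _) hb).trans ?_
  rw [integral_const_mul]
  refine mul_le_mul_of_nonneg_left (setIntegral_mono_set hh ?_
    (Set.Ioi_subset_Ioi hx).eventuallyLE) (norm_nonneg _)
  exact (ae_restrict_iff' measurableSet_Ioi).2 (Eventually.of_forall fun s hs =>
    (norm_nonneg _).trans (hrh s (le_of_lt hs)))

lemma NZBC.continuous_deriv (h : NZBC q q0 qp qm t) : Continuous (deriv fun x => q x t) :=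
  h.contDiff.continuous_deriv le_rfl

lemma NZBC.hasDerivAt (h : NZBC q q0 qp qm t) (x : ℝ) :
    HasDerivAt (fun x => q x t) (deriv (fun x => q x t) x) x :=
  ((h.contDiff.differentiable one_ne_zero) x).hasDerivAt

lemma NZBC.integrableOn_normSq_sub (h : NZBC q q0 qp qm t) :
    IntegrableOn (fun x => ‖q x t‖ ^ 2 - q0 ^ 2) (Set.Ioi 0) := by
  obtain ⟨M, hM0, hM⟩ := h.bounded
  have hc := h.continuous
  refine ((h.integrableOn_sub 0).const_mul (M + q0)).mono'
    (by fun_prop : Continuous fun x => ‖q x t‖ ^ 2 - q0 ^ 2).aestronglyMeasurable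
    (Eventually.of_forall fun x => ?_)
  have h1 : ‖q x t‖ ^ 2 - q0 ^ 2 = (‖q x t‖ + q0) * (‖q x t‖ - ‖qp‖) := by rw [h.norm_qp]; ring
  have hq0 := h.pos
  rw [h1, norm_mul, Real.norm_of_nonneg (by positivity)]
  exact mul_le_mul (by linarith [hM x]) (abs_norm_sub_norm_le _ _) (norm_nonneg _) (by positivity)

/-- Absorption: a finite supremum M with M ≤ A + M/2 satisfies M ≤ 2A. -/
lemma le_of_forall_le_add_half {f : ℝ → ℝ} {A : ℝ} (hb : BddAbove (f '' Set.Ici 0))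
    (h : ∀ M, (∀ x, 0 ≤ x → f x ≤ M) → ∀ x, 0 ≤ x → f x ≤ A + M / 2) :
    ∀ x, 0 ≤ x → f x ≤ 2 * A := by
  set M := sSup (f '' Set.Ici 0)
  have hM : ∀ x, 0 ≤ x → f x ≤ M := fun x hx => le_csSup hb ⟨x, hx, rfl⟩
  have h1 : M ≤ A + M / 2 := by
    refine csSup_le ⟨f 0, 0, Set.self_mem_Ici, rfl⟩ ?_
    rintro _ ⟨x, hx, rfl⟩
    exact h M hM x hx
  intro x hx
  linarith [hM x hx]

lemma bddAbove_norm_image_Ici {F : Type*} [NormedAddCommGroup F] {f : ℝ → F} (hf : Continuous f)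
    {L : F} (hL : Tendsto f atTop (𝓝 L)) : BddAbove ((fun x => ‖f x‖) '' Set.Ici 0) := by
  obtain ⟨a, ha⟩ := eventually_atTop.1 (hL.norm.eventually_lt_const (lt_add_one ‖L‖))
  obtain ⟨C, hC⟩ := (isCompact_Icc (a := 0) (b := a)).exists_bound_of_continuousOn hf.continuousOn
  refine ⟨max C (‖L‖ + 1), ?_⟩
  rintro _ ⟨x, hx, rfl⟩
  rcases le_total a x with h | h
  · exact (ha x h).le.trans (le_max_right _ _)
  · exact (hC x ⟨hx, h⟩).trans (le_max_left _ _)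

-- The term kQ in X grows with z, so the Volterra equation gives no expansion at infinity. The
-- x-dependent gauge (m₀, m₁) below, the adjugate of the background matrix with q(x) in place of q₊,
-- removes the off-diagonal part to leading order. The price is a term with q_x, whence the
-- integrability of q_x. The diagonal phase that survives is (i/2)(|q|² - q₀²).
set_option maxHeartbeats 1000000 in
theorem NZBC.jostValue_asymptotics (h : NZBC q q0 qp qm t) :
    ∃ C R : ℝ, 0 ≤ C ∧ 1 ≤ R ∧ ∀ z : ℂ, 0 ≤ z.re * z.im → R ≤ ‖z‖ →
      ‖jostValue q q0 qp t z 0 - Complex.exp (-(Complex.I / 2 *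
        ((∫ x in Set.Ioi 0, (‖q x t‖ ^ 2 - q0 ^ 2) : ℝ) : ℂ)))‖ ≤ C / ‖z‖ ∧
      ‖jostValue q q0 qp t z 1‖ ≤ C / ‖z‖ := by
  obtain ⟨M₀, hM₀, hM⟩ := h.bounded
  have hq0 := h.pos
  have hqc := h.continuous
  have hqd := h.continuous_deriv
  set w : ℝ → ℝ := fun x => ‖q x t‖ ^ 2 - q0 ^ 2 with hw
  set q' : ℝ → ℂ := deriv fun x => q x t with hq'
  have hwc : Continuous w := by fun_prop
  have hwi : IntegrableOn w (Set.Ioi 0) := h.integrableOn_normSq_sub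
  set Q : ℝ := M₀ + q0 + 1 with hQ
  have hQ1 : 1 ≤ Q := by linarith
  have hqQ : ∀ x, ‖q x t‖ ≤ Q := fun x => (hM x).trans (by linarith)
  set g : ℝ → ℝ := fun x => |w x| + ‖q' x‖ with hg
  have hgi : IntegrableOn g (Set.Ioi 0) := hwi.norm.add h.integrable_deriv.norm.integrableOn
  set H : ℝ := ∫ x in Set.Ioi 0, g x with hH
  have hg0 : ∀ x, 0 ≤ g x := fun x => by positivity
  have hH0 : 0 ≤ H := integral_nonneg hg0
  -- The first summand makes the error coefficient (Q²H + Q)/|z| at most 1/2, as the absorption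
  -- needs. The second gives |z| ≥ R > q₀, away from the branch points.
  set R : ℝ := 2 * (Q ^ 2 * H + Q) + 2 * Q with hR
  have hRQ : Q ≤ R := by have : 0 ≤ Q ^ 2 * H := by positivity
                         linarith
  refine ⟨4 * (Q ^ 2 * H + Q) + Q ^ 2, R, by positivity, hQ1.trans hRQ, fun z hz hRz => ?_⟩
  have hz1 : 1 ≤ ‖z‖ := hQ1.trans (hRQ.trans hRz)
  have hz0 : z ≠ 0 := norm_pos_iff.1 (by linarith)
  have hzpos : 0 < ‖z‖ := by linarith
  have hadm : z ∈ admissible q0 := by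
    refine ⟨hz, hz0, fun hl => ?_⟩
    have hzn : ‖z‖ = q0 := by
      rcases (specLam_eq_zero_iff hz0).1 hl with h1 | h1
      · rw [h1]; simp [abs_of_pos hq0]
      · rw [Set.mem_singleton_iff.1 h1]; simp [abs_of_pos hq0]
    linarith
  set φ := jostColumn q q0 qp atTop 0 t z with hφ
  obtain ⟨hode, hlim⟩ := h.isJostColumn hadm
  rw [← hφ] at hode hlim
  set k := specK q0 z with hk
  set a := specK q0 z * specLam q0 z with ha
  have ha0 : 0 ≤ a.im := im_specK_mul_specLam_nonneg q0 hz
  set e : ℝ → ℂ := fun x => Complex.exp (-(Complex.I * phase q0 x t z * sigma3 0 0)) with he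
  have hed : ∀ x, HasDerivAt e (e x * (-(Complex.I * a))) x := by
    intro x
    have h3 : HasDerivAt (fun x : ℝ => -(Complex.I * phase q0 x t z * sigma3 0 0))
        (-(Complex.I * (a * 1) * sigma3 0 0)) x := by
      simp only [phase]
      exact (((((Complex.ofRealCLM.hasDerivAt (x := x)).sub_const _).const_mul _).const_mul
        _).mul_const _).neg
    have h4 := h3.cexp
    simpa [sigma3, he] using h4
  set f : ℝ → Fin 2 → ℂ := fun x => e x • φ x with hf
  have hf0 : jostValue q q0 qp t z = f 0 := by
    simp [jostValue, hf, he, hφ, sigma3]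
  have hfd : ∀ x, HasDerivAt f ![(Complex.I * k ^ 2 - Complex.I * a) * f x 0 + k * q x t * f x 1,
      -(k * star (q x t) * f x 0) - (Complex.I * k ^ 2 + Complex.I * a) * f x 1] x := by
    intro x
    refine ((hed x).smul (hode x)).congr_deriv ?_
    rw [laxX_mulVec]
    funext i
    fin_cases i <;> simp [hf] <;> ring
  have hfd0 : ∀ x, HasDerivAt (fun x => f x 0)
      ((Complex.I * k ^ 2 - Complex.I * a) * f x 0 + k * q x t * f x 1) x := fun x =>
    hasDerivAt_pi.1 (hfd x) 0
  have hfd1 : ∀ x, HasDerivAt (fun x => f x 1)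
      (-(k * star (q x t) * f x 0) - (Complex.I * k ^ 2 + Complex.I * a) * f x 1) x := fun x =>
    hasDerivAt_pi.1 (hfd x) 1
  have hfc : Continuous f := continuous_iff_continuousAt.2 fun x => (hfd x).continuousAt
  have hfc0 : Continuous fun x => f x 0 := (continuous_apply 0).comp hfc
  have hfc1 : Continuous fun x => f x 1 := (continuous_apply 1).comp hfc
  have hfl : Tendsto f atTop (𝓝 fun i => bgMatrix qp z i 0) := hlim
  have hfl0 : Tendsto (fun x => f x 0) atTop (𝓝 1) := by
    simpa [bgMatrix] using tendsto_pi_nhds.1 hfl 0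
  have hfl1 : Tendsto (fun x => f x 1) atTop (𝓝 (Complex.I * star qp / z)) := by
    simpa [bgMatrix] using tendsto_pi_nhds.1 hfl 1
  have hsq : Continuous fun x => star (q x t) := continuous_star.comp hqc
  have hsq' : Continuous fun x => star (q' x) := continuous_star.comp hqd
  have hqD : ∀ x, HasDerivAt (fun x => q x t) (q' x) x := h.hasDerivAt
  have hsqD : ∀ x, HasDerivAt (fun x => star (q x t)) (star (q' x)) x := fun x => (hqD x).star
  set m0 : ℝ → ℂ := fun x => f x 0 - Complex.I / z * q x t * f x 1 with hm0
  set m1 : ℝ → ℂ := fun x => f x 1 - Complex.I / z * star (q x t) * f x 0 with hm1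
  -- The remainders r₀ and r₁ carry a factor 1/z in every term. In particular k/z - 1/2 =
  -- -q₀²/(2z²).
  set r0 : ℝ → ℂ := fun x => Complex.I * (k / z - 1 / 2) * w x * f x 0 +
    Complex.I / 2 * w x * (Complex.I / z * q x t) * f x 1 - Complex.I / z * q' x * f x 1 with hr0
  set r1 : ℝ → ℂ := fun x => -(Complex.I * (k / z - 1 / 2) * w x * f x 1) -
    Complex.I / 2 * w x * (Complex.I / z * star (q x t)) * f x 0 -
    Complex.I / z * star (q' x) * f x 0 with hr1
  have hwq : ∀ x, (w x : ℂ) = q x t * star (q x t) - (q0 : ℂ) ^ 2 := by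
    intro x
    rw [Complex.star_def, Complex.mul_conj']
    simp [hw]
  have hwC : Continuous fun x => (w x : ℂ) := by fun_prop
  have hkz : k = (z - (q0 : ℂ) ^ 2 / z) / 2 := rfl
  have haz : a = (z - (q0 : ℂ) ^ 2 / z) / 2 * ((z + (q0 : ℂ) ^ 2 / z) / 2) := rfl
  have hm0d : ∀ x, HasDerivAt m0 (Complex.I / 2 * w x * m0 x + r0 x) x := by
    intro x
    refine ((hfd0 x).sub (((hqD x).const_mul (Complex.I / z)).mul (hfd1 x))).congr_deriv ?_
    simp only [hm0, hr0, hwq, hkz, haz]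
    field_simp
    ring_nf
    simp only [Complex.I_sq]
    ring
  have hm1d : ∀ x, HasDerivAt m1 ((-(2 * Complex.I * a) - Complex.I / 2 * w x) * m1 x + r1 x) x := by
    intro x
    refine ((hfd1 x).sub (((hsqD x).const_mul (Complex.I / z)).mul (hfd0 x))).congr_deriv ?_
    simp only [hm1, hr1, hwq, hkz, haz]
    field_simp
    ring_nf
    simp only [Complex.I_sq]
    ring
  -- The factor e^A integrates the diagonal term of m₀. It is unimodular and equals 1 at x = 0, so
  -- the whole phase appears in the limit at infinity.
  set A : ℝ → ℂ := fun x => -(Complex.I / 2 * ((∫ s in (0 : ℝ)..x, w s : ℝ) : ℂ)) with hA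
  have hAd : ∀ x, HasDerivAt A (-(Complex.I / 2 * w x)) x := by
    intro x
    have := intervalIntegral.integral_hasDerivAt_right (hwc.intervalIntegrable 0 x)
      (hwc.stronglyMeasurableAtFilter _ _) hwc.continuousAt
    exact (this.ofReal_comp.const_mul _).neg
  have hAc : Continuous A := continuous_iff_continuousAt.2 fun x => (hAd x).continuousAt
  have hAre : ∀ x, (A x).re = 0 := by
    intro x
    simp [hA]
  set W : ℝ := ∫ x in Set.Ioi 0, w x with hWdef
  have hAl : Tendsto (fun x => Complex.exp (A x)) atTop
      (𝓝 (Complex.exp (-(Complex.I / 2 * (W : ℂ))))) := by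
    have h1 : Tendsto (fun x => ∫ s in (0 : ℝ)..x, w s) atTop (𝓝 W) :=
      intervalIntegral_tendsto_integral_Ioi 0 hwi tendsto_id
    have h2 := (Complex.continuous_ofReal.tendsto _).comp h1
    exact (Complex.continuous_exp.tendsto _).comp ((h2.const_mul (Complex.I / 2)).neg)
  have hbb : qp * star qp = (q0 : ℂ) ^ 2 := by
    rw [← h.norm_qp]; exact Complex.mul_conj' qp
  have hm0l : Tendsto m0 atTop (𝓝 (detE q0 z)) := by
    have h1 := hfl0.sub ((h.tendsto_top.const_mul (Complex.I / z)).mul hfl1)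
    convert! h1 using 2
    simp only [detE]
    field_simp
    linear_combination (Complex.I ^ 2) * hbb + (q0 : ℂ) ^ 2 * Complex.I_sq
  have hm1l : Tendsto m1 atTop (𝓝 0) := by
    have h1 := hfl1.sub (((h.tendsto_top.star).const_mul (Complex.I / z)).mul hfl0)
    convert! h1 using 2
    ring
  have hr0c : Continuous r0 := by fun_prop
  have hr1c : Continuous r1 := by fun_prop
  have hkz2 : ‖k / z - 1 / 2‖ ≤ Q ^ 2 / 2 / ‖z‖ := by
    have : k / z - 1 / 2 = -((q0 : ℂ) ^ 2 / (2 * z ^ 2)) := by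
      rw [hkz]; field_simp; ring
    rw [this, norm_neg]
    simp only [norm_div, norm_pow, norm_mul, Complex.norm_real, Complex.norm_ofNat,
      Real.norm_of_nonneg hq0.le]
    rw [div_div, div_le_div_iff₀ (by positivity) (by positivity)]
    have : q0 ^ 2 ≤ Q ^ 2 := by gcongr; linarith
    nlinarith [mul_le_mul this hz1 (by norm_num) (by positivity),
      mul_nonneg (sq_nonneg Q) hzpos.le]
  have hrle : ∀ {N : ℝ} {u v b b' : ℂ} {x : ℝ}, ‖u‖ ≤ N → ‖v‖ ≤ N → ‖b‖ ≤ Q → ‖b'‖ = ‖q' x‖ →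
      ‖Complex.I * (k / z - 1 / 2) * w x * u‖ + ‖Complex.I / 2 * w x * (Complex.I / z * b) * v‖ +
        ‖Complex.I / z * b' * v‖ ≤ Q ^ 2 / ‖z‖ * N * g x := by
    intro N u v b b' x hu hv hb hb'
    have hN : 0 ≤ N := (norm_nonneg _).trans hu
    simp only [norm_mul, norm_div, Complex.norm_I, Complex.norm_real, Complex.norm_ofNat, one_mul,
      hb', Real.norm_eq_abs]
    have hQQ : Q ≤ Q ^ 2 := by nlinarith
    calc ‖k / z - 1 / 2‖ * |w x| * ‖u‖ + 1 / 2 * |w x| * (1 / ‖z‖ * ‖b‖) * ‖v‖ +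
        1 / ‖z‖ * ‖q' x‖ * ‖v‖
        ≤ Q ^ 2 / 2 / ‖z‖ * |w x| * N + 1 / 2 * |w x| * (1 / ‖z‖ * Q ^ 2) * N +
          Q ^ 2 / ‖z‖ * ‖q' x‖ * N := by
          gcongr
          · exact hb.trans hQQ
          · nlinarith
      _ = _ := by simp only [hg]; ring
  -- An a priori bound N for f on the half-line controls the distance of m₀ and m₁ from their
  -- limits, with coefficient O(1/|z|) in N.
  have key : ∀ N, (∀ x, 0 ≤ x → ‖f x‖ ≤ N) →
      (∀ x, 0 ≤ x → ‖Complex.exp (A x) * m0 x -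
        Complex.exp (-(Complex.I / 2 * (W : ℂ))) * detE q0 z‖ ≤ Q ^ 2 * H / ‖z‖ * N) ∧
      ∀ x, 0 ≤ x → ‖m1 x‖ ≤ Q ^ 2 * H / ‖z‖ * N := by
    intro N hN
    have hN0 : ∀ x, 0 ≤ x → ‖f x 0‖ ≤ N := fun x hx => (norm_le_pi_norm _ _).trans (hN x hx)
    have hN1 : ∀ x, 0 ≤ x → ‖f x 1‖ ≤ N := fun x hx => (norm_le_pi_norm _ _).trans (hN x hx)
    have hInt : ∫ x in Set.Ioi 0, Q ^ 2 / ‖z‖ * N * g x = Q ^ 2 * H / ‖z‖ * N := by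
      rw [integral_const_mul]; ring
    have hb0 : ∀ x, 0 ≤ x → ‖r0 x‖ ≤ Q ^ 2 / ‖z‖ * N * g x := fun x hx =>
      ((norm_sub_le _ _).trans (add_le_add (norm_add_le _ _) le_rfl)).trans
        (hrle (hN0 x hx) (hN1 x hx) (hqQ x) rfl)
    have hb1 : ∀ x, 0 ≤ x → ‖r1 x‖ ≤ Q ^ 2 / ‖z‖ * N * g x := fun x hx =>
      ((norm_sub_le _ _).trans (add_le_add (norm_sub_le _ _) le_rfl)).trans
        (by rw [norm_neg]; exact hrle (hN1 x hx) (hN0 x hx) (by rw [norm_star]; exact hqQ x)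
              (norm_star _))
    constructor
    · intro x hx
      have h1 := norm_mul_sub_limit_le (p := fun x => Complex.exp (A x)) (y := m0) (r := r0)
        (by fun_prop) hr0c (fun x => ?_) (fun x _ s _ => ?_) hb0 (hgi.const_mul _)
        (hAl.mul hm0l) hx
      · rwa [hInt, Complex.norm_exp, hAre, Real.exp_zero, one_mul] at h1
      · refine ((hAd x).cexp.mul (hm0d x)).congr_deriv ?_
        ring
      · simp [Complex.norm_exp, hAre]
    · intro x hx
      have hnorm : ∀ x : ℝ, ‖Complex.exp (2 * Complex.I * a * x - A x)‖ =
          Real.exp (-(2 * a.im) * x) := by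
        intro x
        rw [Complex.norm_exp, Complex.sub_re, hAre, Complex.re_mul_ofReal]
        congr 1
        generalize a = a
        simp
      have hpm : ∀ x : ℝ, 0 ≤ x → ∀ s : ℝ, x ≤ s → ‖Complex.exp (2 * Complex.I * a * s - A s)‖ ≤
          ‖Complex.exp (2 * Complex.I * a * x - A x)‖ := by
        intro x _ s hs
        rw [hnorm, hnorm, Real.exp_le_exp]
        nlinarith
      have h1 := norm_mul_sub_limit_le (p := fun x => Complex.exp (2 * Complex.I * a * x - A x))
        (y := m1) (r := r1) (L := 0)
        (by fun_prop) hr1c (fun x => ?_) hpm hb1 (hgi.const_mul _) ?_ hx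
      · rw [hInt, sub_zero, norm_mul] at h1
        exact le_of_mul_le_mul_left h1 (norm_pos_iff.2 (Complex.exp_ne_zero _))
      · have h2 : HasDerivAt (fun x : ℝ => 2 * Complex.I * a * x - A x)
            (2 * Complex.I * a * 1 - -(Complex.I / 2 * w x)) x :=
          ((Complex.ofRealCLM.hasDerivAt (x := x)).const_mul _).sub (hAd x)
        refine (h2.cexp.mul (hm1d x)).congr_deriv ?_
        ring
      -- The integrating factor is nonincreasing in modulus and m₁ → 0, so their product tends to 0.
      -- The factor then cancels from both sides of the estimate.
      · have h3 : Tendsto (fun s => ‖Complex.exp (2 * Complex.I * a * (0 : ℝ) - A 0)‖ * ‖m1 s‖)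
            atTop (𝓝 0) := by
          simpa using hm1l.norm.const_mul ‖Complex.exp (2 * Complex.I * a * (0 : ℝ) - A 0)‖
        refine squeeze_zero_norm' ?_ h3
        filter_upwards [eventually_ge_atTop (0 : ℝ)] with s hs
        rw [norm_mul]
        exact mul_le_mul_of_nonneg_right (hpm 0 le_rfl s hs) (norm_nonneg _)
  have hdet : ‖detE q0 z - 1‖ ≤ Q ^ 2 / ‖z‖ := by
    simp only [detE, add_sub_cancel_left, norm_div, norm_pow, Complex.norm_real,
      Real.norm_of_nonneg hq0.le]
    have : q0 ^ 2 ≤ Q ^ 2 := by gcongr; linarith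
    rw [div_le_div_iff₀ (by positivity) hzpos]
    nlinarith [mul_le_mul this hz1 (by norm_num) (by positivity),
      mul_nonneg (sq_nonneg Q) hzpos.le]
  have hdet2 : ‖detE q0 z‖ ≤ 2 := by
    have h1 : ‖detE q0 z‖ ≤ 1 + ‖(q0 : ℂ) ^ 2 / z ^ 2‖ := by
      refine (norm_add_le _ _).trans (by simp)
    have h2 : ‖(q0 : ℂ) ^ 2 / z ^ 2‖ ≤ 1 := by
      rw [← div_pow, norm_pow]
      refine pow_le_one₀ (norm_nonneg _) ?_
      rw [norm_div, div_le_one hzpos, Complex.norm_real, Real.norm_of_nonneg hq0.le]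
      linarith
    linarith
  have hQH : (Q ^ 2 * H + Q) / ‖z‖ ≤ 1 / 2 := by
    rw [div_le_iff₀ hzpos]; linarith
  have hexpA : ∀ x, ‖Complex.exp (A x)‖ = 1 := fun x => by simp [Complex.norm_exp, hAre]
  have hexpW : ‖Complex.exp (-(Complex.I / 2 * (W : ℂ)))‖ = 1 := by
    simp [Complex.norm_exp]
  have hf_le : ∀ N, (∀ x, 0 ≤ x → ‖f x‖ ≤ N) → ∀ x, 0 ≤ x →
      ‖f x 0 - m0 x‖ ≤ Q / ‖z‖ * N ∧ ‖f x 1 - m1 x‖ ≤ Q / ‖z‖ * N := by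
    intro N hN x hx
    have hN0 : ‖f x 0‖ ≤ N := (norm_le_pi_norm _ _).trans (hN x hx)
    have hN1 : ‖f x 1‖ ≤ N := (norm_le_pi_norm _ _).trans (hN x hx)
    constructor
    · simp only [hm0, sub_sub_cancel, norm_mul, norm_div, Complex.norm_I]
      calc 1 / ‖z‖ * ‖q x t‖ * ‖f x 1‖ ≤ 1 / ‖z‖ * Q * N := by gcongr; exact hqQ x
        _ = _ := by ring
    · simp only [hm1, sub_sub_cancel, norm_mul, norm_div, Complex.norm_I, norm_star]
      calc 1 / ‖z‖ * ‖q x t‖ * ‖f x 0‖ ≤ 1 / ‖z‖ * Q * N := by gcongr; exact hqQ x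
        _ = _ := by ring
  -- The limit vector of the gauged column has size at most |det E| ≤ 2. The errors amount to at
  -- most N/2, and absorption gives the bound 2 · 2.
  have hf4 : ∀ x, 0 ≤ x → ‖f x‖ ≤ 2 * 2 := by
    refine le_of_forall_le_add_half (bddAbove_norm_image_Ici hfc hfl) fun N hN x hx => ?_
    have hN0 : 0 ≤ N := (norm_nonneg _).trans (hN 0 le_rfl)
    obtain ⟨k0, k1⟩ := key N hN
    obtain ⟨l0, l1⟩ := hf_le N hN x hx
    have hsum : Q ^ 2 * H / ‖z‖ * N + Q / ‖z‖ * N ≤ N / 2 := by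
      calc _ = (Q ^ 2 * H + Q) / ‖z‖ * N := by ring
        _ ≤ 1 / 2 * N := by gcongr
        _ = _ := by ring
    refine (pi_norm_le_iff_of_nonneg (by positivity)).2 fun i => ?_
    have hm0x : ‖m0 x‖ ≤ 2 + Q ^ 2 * H / ‖z‖ * N := by
      have h1 : ‖m0 x‖ = ‖Complex.exp (A x) * m0 x‖ := by rw [norm_mul, hexpA, one_mul]
      have h2 : ‖Complex.exp (-(Complex.I / 2 * (W : ℂ))) * detE q0 z‖ ≤ 2 := by
        rw [norm_mul, hexpW, one_mul]; exact hdet2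
      have h3 := norm_le_norm_add_norm_sub' (Complex.exp (A x) * m0 x)
        (Complex.exp (-(Complex.I / 2 * (W : ℂ))) * detE q0 z)
      have h4 := k0 x hx
      rw [h1]; linarith
    fin_cases i
    · have := norm_le_norm_add_norm_sub' (f x 0) (m0 x)
      change ‖f x 0‖ ≤ _
      linarith
    · have := norm_le_norm_add_norm_sub' (f x 1) (m1 x)
      have := k1 x hx
      change ‖f x 1‖ ≤ _
      linarith
  obtain ⟨k0, k1⟩ := key _ hf4
  obtain ⟨l0, l1⟩ := hf_le _ hf4 0 le_rfl
  have hk0 := k0 0 le_rfl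
  have hk1 := k1 0 le_rfl
  have hA0 : A 0 = 0 := by simp [hA]
  rw [hA0, Complex.exp_zero, one_mul] at hk0
  have e1 : (4 * (Q ^ 2 * H + Q) + Q ^ 2) / ‖z‖ =
    Q ^ 2 * H / ‖z‖ * (2 * 2) + Q / ‖z‖ * (2 * 2) + Q ^ 2 / ‖z‖ := by ring
  rw [hf0, e1]
  constructor
  · have e2 : f 0 0 - Complex.exp (-(Complex.I / 2 * (W : ℂ))) = (f 0 0 - m0 0) +
        (m0 0 - Complex.exp (-(Complex.I / 2 * (W : ℂ))) * detE q0 z) +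
        Complex.exp (-(Complex.I / 2 * (W : ℂ))) * (detE q0 z - 1) := by ring
    rw [e2]
    refine norm_add₃_le.trans ?_
    rw [norm_mul _ (detE q0 z - 1), hexpW, one_mul]
    linarith
  · have := norm_le_norm_add_norm_sub' (f 0 1) (m1 0)
    have : 0 ≤ Q ^ 2 / ‖z‖ := by positivity
    linarith

end

/-! ### Symmetries of the Jost columns: reversal of the line, conjugation, sign change and
inversion. -/

noncomputable section

variable {q : ℝ → ℝ → ℂ} {q0 : ℝ} {qp qm : ℂ} {t : ℝ}

/-- The reflected potential `q̃(x, t) = q(-x, -t)*`, which exchanges the two ends of the line. -/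
def reflectPot (q : ℝ → ℝ → ℂ) : ℝ → ℝ → ℂ := fun x t => star (q (-x) (-t))

lemma reflectPot_neg (q : ℝ → ℝ → ℂ) (x t : ℝ) : reflectPot q x (-t) = star (q (-x) t) := by
  simp [reflectPot]

lemma NZBC.reflect (h : NZBC q q0 qp qm t) : NZBC (reflectPot q) q0 (star qm) (star qp) (-t) where
  pos := h.pos
  norm_qp := by rw [norm_star, h.norm_qm]
  norm_qm := by rw [norm_star, h.norm_qp]
  tendsto_top := by
    simp only [reflectPot_neg]
    exact (h.tendsto_bot.comp tendsto_neg_atTop_atBot).star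
  tendsto_bot := by
    simp only [reflectPot_neg]
    exact (h.tendsto_top.comp tendsto_neg_atBot_atTop).star
  moment_top := by
    have h1 := ((Measure.measurePreserving_neg volume).integrableOn_comp_preimage
      (Homeomorph.neg ℝ).measurableEmbedding).2 h.moment_bot
    have h2 : Neg.neg ⁻¹' Set.Iio (0 : ℝ) = Set.Ioi 0 := by ext x; simp
    rw [h2] at h1
    refine h1.congr_fun (fun x _ => ?_) measurableSet_Ioi
    simp only [Function.comp, reflectPot_neg, abs_neg, ← star_sub, norm_star]
  moment_bot := by
    have h1 := ((Measure.measurePreserving_neg volume).integrableOn_comp_preimage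
      (Homeomorph.neg ℝ).measurableEmbedding).2 h.moment_top
    have h2 : Neg.neg ⁻¹' Set.Ioi (0 : ℝ) = Set.Iio 0 := by ext x; simp
    rw [h2] at h1
    refine h1.congr_fun (fun x _ => ?_) measurableSet_Iio
    simp only [Function.comp, reflectPot_neg, abs_neg, ← star_sub, norm_star]
  contDiff := by
    simp only [reflectPot_neg]
    have h1 : ContDiff ℝ 1 fun x => q (-x) t := h.contDiff.comp contDiff_neg
    exact Complex.conjCLE.contDiff.comp h1
  integrable_deriv := by
    have h1 : (deriv fun x => reflectPot q x (-t)) =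
        fun x => star (-(deriv (fun x => q x t) (-x))) := by
      funext x
      simp only [reflectPot_neg]
      have h2 : HasDerivAt (fun x => q (-x) t) (-(deriv (fun x => q x t) (-x))) x := by
        have h3 := (h.hasDerivAt (-x)).scomp x (hasDerivAt_neg x)
        rw [neg_one_smul] at h3
        exact h3
      exact h2.star.deriv
    rw [h1]
    have h3 : Integrable fun x => -(deriv (fun x => q x t) (-x)) := h.integrable_deriv.comp_neg.neg
    exact (Complex.conjCLE : ℂ →L[ℝ] ℂ).integrable_comp h3

/-- Exchange of the two components. -/
def swapVec (v : Fin 2 → ℂ) : Fin 2 → ℂ := ![v 1, v 0]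

/-- The antilinear map `(a, b) ↦ (-b*, a*)`. -/
def conjVec (v : Fin 2 → ℂ) : Fin 2 → ℂ := ![-star (v 1), star (v 0)]

@[simp] lemma swapVec_swapVec (v : Fin 2 → ℂ) : swapVec (swapVec v) = v := by
  ext i; fin_cases i <;> simp [swapVec]

lemma hasDerivAt_fin_two {φ : ℝ → Fin 2 → ℂ} {φ' : Fin 2 → ℂ} {x : ℝ} :
    HasDerivAt φ φ' x ↔ HasDerivAt (fun x => φ x 0) (φ' 0) x ∧
      HasDerivAt (fun x => φ x 1) (φ' 1) x := by
  rw [hasDerivAt_pi, Fin.forall_fin_two]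

lemma tendsto_fin_two {l : Filter ℝ} {φ : ℝ → Fin 2 → ℂ} {v : Fin 2 → ℂ} :
    Tendsto φ l (𝓝 v) ↔ Tendsto (fun x => φ x 0) l (𝓝 (v 0)) ∧
      Tendsto (fun x => φ x 1) l (𝓝 (v 1)) := by
  rw [tendsto_pi_nhds, Fin.forall_fin_two]

lemma isJostColumn_iff {b z : ℂ} {l : Filter ℝ} {j : Fin 2} {φ : ℝ → Fin 2 → ℂ} :
    IsJostColumn q q0 b l j t z φ ↔
      (∀ x, HasDerivAt (fun x => φ x 0)
        (Complex.I * specK q0 z ^ 2 * φ x 0 + specK q0 z * q x t * φ x 1) x) ∧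
      (∀ x, HasDerivAt (fun x => φ x 1)
        (-(specK q0 z * star (q x t) * φ x 0) - Complex.I * specK q0 z ^ 2 * φ x 1) x) ∧
      Tendsto (fun x : ℝ => Complex.exp (-(Complex.I * phase q0 x t z * sigma3 j j)) * φ x 0) l
        (𝓝 (bgMatrix b z 0 j)) ∧
      Tendsto (fun x : ℝ => Complex.exp (-(Complex.I * phase q0 x t z * sigma3 j j)) * φ x 1) l
        (𝓝 (bgMatrix b z 1 j)) := by
  simp only [IsJostColumn, laxX_mulVec, hasDerivAt_fin_two, tendsto_fin_two, forall_and]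
  simp [and_assoc]

lemma phase_neg_neg (q0 x t : ℝ) (z : ℂ) : phase q0 (-x) (-t) z = -phase q0 x t z := by
  simp only [phase]; push_cast; ring

lemma specK_star (q0 : ℝ) (z : ℂ) : specK q0 (star z) = star (specK q0 z) := by
  simp [specK]

lemma specLam_star (q0 : ℝ) (z : ℂ) : specLam q0 (star z) = star (specLam q0 z) := by
  simp [specLam]

lemma phase_star (q0 x t : ℝ) (z : ℂ) : phase q0 x t (star z) = star (phase q0 x t z) := by
  simp only [phase, specK_star, specLam_star]; simp

/-- Reversing x and t changes the sign of θ, and exchanging the components compensates it.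
Everything proved for Φ₊₁ thus becomes available for Φ₋₂, at the same z. -/
lemma IsJostColumn.reflect {b z : ℂ} {φ : ℝ → Fin 2 → ℂ} (h : IsJostColumn q q0 b atBot 1 t z φ) :
    IsJostColumn (reflectPot q) q0 (star b) atTop 0 (-t) z fun x => swapVec (φ (-x)) := by
  rw [isJostColumn_iff] at h ⊢
  obtain ⟨h1, h2, h3, h4⟩ := h
  simp only [reflectPot_neg, swapVec, Matrix.cons_val_zero, Matrix.cons_val_one, star_star]
  refine ⟨fun x => ?_, fun x => ?_, ?_, ?_⟩
  · refine ((h2 (-x)).scomp x (hasDerivAt_neg x)).congr_deriv ?_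
    simp
  · refine ((h1 (-x)).scomp x (hasDerivAt_neg x)).congr_deriv ?_
    simp; ring
  · refine ((h4.comp tendsto_neg_atTop_atBot).congr fun x => ?_).trans_eq ?_
    · have := phase_neg_neg q0 (-x) t z
      rw [neg_neg] at this
      simp [this, sigma3]
    · simp [bgMatrix]
  · refine ((h3.comp tendsto_neg_atTop_atBot).congr fun x => ?_).trans_eq ?_
    · have := phase_neg_neg q0 (-x) t z
      rw [neg_neg] at this
      simp [this, sigma3]
    · simp [bgMatrix]

lemma IsJostColumn.of_reflect {b z : ℂ} {φ : ℝ → Fin 2 → ℂ}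
    (h : IsJostColumn (reflectPot q) q0 (star b) atTop 0 (-t) z φ) :
    IsJostColumn q q0 b atBot 1 t z fun x => swapVec (φ (-x)) := by
  rw [isJostColumn_iff] at h ⊢
  obtain ⟨h1, h2, h3, h4⟩ := h
  simp only [reflectPot_neg, swapVec, Matrix.cons_val_zero, Matrix.cons_val_one, star_star] at *
  refine ⟨fun x => ?_, fun x => ?_, ?_, ?_⟩
  · refine ((h2 (-x)).scomp x (hasDerivAt_neg x)).congr_deriv ?_
    simp
  · refine ((h1 (-x)).scomp x (hasDerivAt_neg x)).congr_deriv ?_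
    simp; ring
  · refine ((h4.comp tendsto_neg_atBot_atTop).congr fun x => ?_).trans_eq ?_
    · simp [phase_neg_neg, sigma3]
    · simp [bgMatrix]
  · refine ((h3.comp tendsto_neg_atBot_atTop).congr fun x => ?_).trans_eq ?_
    · simp [phase_neg_neg, sigma3]
    · simp [bgMatrix]

/-- The antilinear map `conjVec` intertwines X(z*) with X(z), because k(z*) = k(z)*. It carries
first columns to second columns and is the source of s₂₂(z) = s₁₁(z*)*. -/
lemma IsJostColumn.conj {b z : ℂ} {l : Filter ℝ} {φ : ℝ → Fin 2 → ℂ}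
    (h : IsJostColumn q q0 b l 0 t (star z) φ) :
    IsJostColumn q q0 b l 1 t z fun x => conjVec (φ x) := by
  rw [isJostColumn_iff] at h ⊢
  obtain ⟨h1, h2, h3, h4⟩ := h
  simp only [specK_star, phase_star] at h1 h2 h3 h4
  simp only [conjVec, Matrix.cons_val_zero, Matrix.cons_val_one]
  refine ⟨fun x => ?_, fun x => ?_, ?_, ?_⟩
  · refine (h2 x).star.neg.congr_deriv ?_
    simp
  · refine (h1 x).star.congr_deriv ?_
    simp; ring
  · refine (h4.star.neg.congr fun x => ?_).trans_eq ?_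
    · simp [sigma3, ← Complex.exp_conj]
    · simp [bgMatrix]; ring
  · refine (h3.star.congr fun x => ?_).trans_eq ?_
    · simp [sigma3, ← Complex.exp_conj]
    · simp [bgMatrix]

lemma IsJostColumn.of_conj {b z : ℂ} {l : Filter ℝ} {φ : ℝ → Fin 2 → ℂ}
    (h : IsJostColumn q q0 b l 1 t z φ) :
    IsJostColumn q q0 b l 0 t (star z) fun x => -conjVec (φ x) := by
  rw [isJostColumn_iff] at h ⊢
  obtain ⟨h1, h2, h3, h4⟩ := h
  simp only [specK_star, phase_star]
  simp only [conjVec, Pi.neg_apply, Matrix.cons_val_zero, Matrix.cons_val_one, neg_neg]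
  refine ⟨fun x => ?_, fun x => ?_, ?_, ?_⟩
  · refine (h2 x).star.congr_deriv ?_
    simp; ring
  · refine (h1 x).star.neg.congr_deriv ?_
    simp
  · refine (h4.star.congr fun x => ?_).trans_eq ?_
    · simp [sigma3, ← Complex.exp_conj]
    · simp [bgMatrix]
  · refine (h3.star.neg.congr fun x => ?_).trans_eq ?_
    · simp [sigma3, ← Complex.exp_conj]
    · simp [bgMatrix]; ring

lemma specK_neg (q0 : ℝ) (z : ℂ) : specK q0 (-z) = -specK q0 z := by
  simp only [specK, div_neg]; ring

lemma specLam_neg (q0 : ℝ) (z : ℂ) : specLam q0 (-z) = -specLam q0 z := by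
  simp only [specLam, div_neg]; ring

lemma phase_neg (q0 x t : ℝ) (z : ℂ) : phase q0 x t (-z) = phase q0 x t z := by
  simp only [phase, specK_neg, specLam_neg]; ring

lemma IsJostColumn.neg {b z : ℂ} {l : Filter ℝ} {φ : ℝ → Fin 2 → ℂ}
    (h : IsJostColumn q q0 b l 0 t z φ) :
    IsJostColumn q q0 b l 0 t (-z) fun x => ![φ x 0, -φ x 1] := by
  rw [isJostColumn_iff] at h ⊢
  obtain ⟨h1, h2, h3, h4⟩ := h
  simp only [specK_neg, phase_neg, Matrix.cons_val_zero, Matrix.cons_val_one]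
  refine ⟨fun x => (h1 x).congr_deriv (by ring), fun x => (h2 x).neg.congr_deriv (by ring), ?_, ?_⟩
  · refine h3.trans_eq ?_
    simp [bgMatrix]
  · refine (h4.neg.congr fun x => by ring).trans_eq ?_
    simp [bgMatrix, div_neg]

/-- The inversion `z ↦ q₀² / z*` in the circle of radius `q₀`. -/
def circleInv (q0 : ℝ) (z : ℂ) : ℂ := (q0 : ℂ) ^ 2 / star z

/-- The inversion multiplies z by a positive number, so it preserves rays, quadrants and arguments.
-/
lemma circleInv_eq_mul (q0 : ℝ) {z : ℂ} (hz : z ≠ 0) :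
    circleInv q0 z = ((q0 ^ 2 / Complex.normSq z : ℝ) : ℂ) * z := by
  have h : (starRingEnd ℂ) z ≠ 0 := by simpa using hz
  simp only [circleInv, Complex.star_def]
  push_cast
  rw [← Complex.mul_conj z]
  field_simp

lemma specK_circleInv (hq0 : 0 < q0) {z : ℂ} (hz : z ≠ 0) :
    specK q0 (circleInv q0 z) = -star (specK q0 z) := by
  have h0 : (q0 : ℂ) ≠ 0 := by exact_mod_cast hq0.ne'
  have : (starRingEnd ℂ) z ≠ 0 := by simpa using hz
  simp [specK, circleInv]; field_simp; ring

lemma specLam_circleInv (hq0 : 0 < q0) {z : ℂ} (hz : z ≠ 0) :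
    specLam q0 (circleInv q0 z) = star (specLam q0 z) := by
  have h0 : (q0 : ℂ) ≠ 0 := by exact_mod_cast hq0.ne'
  have : (starRingEnd ℂ) z ≠ 0 := by simpa using hz
  simp [specLam, circleInv]; field_simp; ring

lemma phase_circleInv (hq0 : 0 < q0) (x t : ℝ) {z : ℂ} (hz : z ≠ 0) :
    phase q0 x t (circleInv q0 z) = -star (phase q0 x t z) := by
  simp only [phase, specK_circleInv hq0 hz, specLam_circleInv hq0 hz]; simp

/-- The inversion sends k to -k*, λ to λ* and hence θ to -θ*. Conjugating and swapping components
returns to a first column at z. The factor ib*/z restores the normalization, using |b| = q₀. -/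
lemma IsJostColumn.circleInv {b z : ℂ} {l : Filter ℝ} {φ : ℝ → Fin 2 → ℂ} (hq0 : 0 < q0)
    (hb : ‖b‖ = q0) (hz : z ≠ 0) (h : IsJostColumn q q0 b l 0 t (circleInv q0 z) φ) :
    IsJostColumn q q0 b l 0 t z
      fun x => ![Complex.I * star b / z * star (φ x 1), Complex.I * star b / z * star (φ x 0)] := by
  have h0 : (q0 : ℂ) ≠ 0 := by exact_mod_cast hq0.ne'
  have hbb : b * (starRingEnd ℂ) b = (q0 : ℂ) ^ 2 := by rw [← hb]; exact Complex.mul_conj' b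
  rw [isJostColumn_iff] at h ⊢
  obtain ⟨h1, h2, h3, h4⟩ := h
  simp only [specK_circleInv hq0 hz, phase_circleInv hq0 _ _ hz] at h1 h2 h3 h4
  simp only [Matrix.cons_val_zero, Matrix.cons_val_one]
  refine ⟨fun x => ?_, fun x => ?_, ?_, ?_⟩
  · refine ((h2 x).star.const_mul _).congr_deriv ?_
    simp; ring
  · refine ((h1 x).star.const_mul _).congr_deriv ?_
    simp; ring
  · refine ((h4.star.const_mul (Complex.I * star b / z)).congr fun x => ?_).trans_eq ?_
    · simp [sigma3, ← Complex.exp_conj]; ring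
    · simp [bgMatrix, DNLS.circleInv]
      field_simp
      linear_combination (-Complex.I ^ 2) * hbb - (q0 : ℂ) ^ 2 * Complex.I_sq
  · refine ((h3.star.const_mul (Complex.I * star b / z)).congr fun x => ?_).trans_eq ?_
    · simp [sigma3, ← Complex.exp_conj]; ring
    · simp [bgMatrix]

end

/-! ### The scattering coefficients: regularity, symmetries, asymptotics, determinant and the point
z = q₀. -/

noncomputable section

variable {q : ℝ → ℝ → ℂ} {q0 : ℝ} {qp qm : ℂ} {t : ℝ}

lemma jostColumn_eq {b z : ℂ} {l : Filter ℝ} {j : Fin 2} {φ : ℝ → Fin 2 → ℂ}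
    (hu : ∀ ψ, IsJostColumn q q0 b l j t z ψ → ψ = φ) (hφ : IsJostColumn q q0 b l j t z φ) :
    jostColumn q q0 b l j t z = φ :=
  hu _ (Classical.epsilon_spec (p := IsJostColumn q q0 b l j t z) ⟨φ, hφ⟩)

/-- `Φ₋₂` in terms of `Φ₊₁` of the reflected potential. -/
lemma NZBC.jostColumn_bot_one (h : NZBC q q0 qp qm t) {z : ℂ} (hz : z ∈ admissible q0) :
    (IsJostColumn q q0 qm atBot 1 t z (jostColumn q q0 qm atBot 1 t z)) ∧
    (∀ ψ, IsJostColumn q q0 qm atBot 1 t z ψ → ψ = jostColumn q q0 qm atBot 1 t z) ∧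
    jostColumn q q0 qm atBot 1 t z =
      fun x => swapVec (jostColumn (reflectPot q) q0 (star qm) atTop 0 (-t) z (-x)) := by
  have h1 := (h.reflect.isJostColumn hz).of_reflect
  have h2 : ∀ ψ, IsJostColumn q q0 qm atBot 1 t z ψ →
      ψ = fun x => swapVec (jostColumn (reflectPot q) q0 (star qm) atTop 0 (-t) z (-x)) := by
    intro ψ hψ
    have := h.reflect.jost_unique hz.1 hψ.reflect (h.reflect.isJostColumn hz)
    rw [← this]
    simp
  have h3 := jostColumn_eq h2 h1
  rw [h3]
  exact ⟨h1, h2, rfl⟩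

lemma jostColumn_one_of_zero {b z : ℂ} {l : Filter ℝ} {φ : ℝ → Fin 2 → ℂ}
    (hφ : IsJostColumn q q0 b l 0 t (star z) φ)
    (hu : ∀ ψ, IsJostColumn q q0 b l 0 t (star z) ψ → ψ = φ) :
    IsJostColumn q q0 b l 1 t z (jostColumn q q0 b l 1 t z) ∧
    jostColumn q q0 b l 1 t z = fun x => conjVec (φ x) := by
  have h3 := jostColumn_eq (fun ψ hψ => ?_) hφ.conj
  · rw [h3]
    exact ⟨hφ.conj, rfl⟩
  · rw [← hu _ hψ.of_conj]
    ext x i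
    fin_cases i <;> simp [conjVec]

lemma jostColumn_zero_of_one {b z : ℂ} {l : Filter ℝ} {φ : ℝ → Fin 2 → ℂ}
    (hφ : IsJostColumn q q0 b l 1 t (star z) φ)
    (hu : ∀ ψ, IsJostColumn q q0 b l 1 t (star z) ψ → ψ = φ) :
    IsJostColumn q q0 b l 0 t z (jostColumn q q0 b l 0 t z) ∧
    jostColumn q q0 b l 0 t z = fun x => -conjVec (φ x) := by
  have h0 := hφ.of_conj
  rw [star_star] at h0
  have h3 := jostColumn_eq (fun ψ hψ => ?_) h0
  · rw [h3]
    exact ⟨h0, rfl⟩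
  · have h4 : IsJostColumn q q0 b l 0 t (star (star z)) ψ := by rwa [star_star]
    rw [← hu _ h4.conj]
    ext x i
    fin_cases i <;> simp [conjVec]

lemma NZBC.jostColumn_top_one (h : NZBC q q0 qp qm t) {z : ℂ} (hz : star z ∈ admissible q0) :
    IsJostColumn q q0 qp atTop 1 t z (jostColumn q q0 qp atTop 1 t z) ∧
    jostColumn q q0 qp atTop 1 t z = fun x => conjVec (jostColumn q q0 qp atTop 0 t (star z) x) :=
  jostColumn_one_of_zero (h.isJostColumn hz) fun _ hψ => h.jost_unique hz.1 hψ (h.isJostColumn hz)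

lemma NZBC.jostColumn_bot_zero (h : NZBC q q0 qp qm t) {z : ℂ} (hz : star z ∈ admissible q0) :
    IsJostColumn q q0 qm atBot 0 t z (jostColumn q q0 qm atBot 0 t z) ∧
    jostColumn q q0 qm atBot 0 t z =
      fun x => -conjVec (jostColumn q q0 qm atBot 1 t (star z) x) :=
  jostColumn_zero_of_one (h.jostColumn_bot_one hz).1 (h.jostColumn_bot_one hz).2.1

lemma detE_star (q0 : ℝ) (z : ℂ) : detE q0 (star z) = star (detE q0 z) := by
  simp [detE]

lemma detE_neg (q0 : ℝ) (z : ℂ) : detE q0 (-z) = detE q0 z := by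
  simp [detE]

lemma detE_eq {q0 : ℝ} {z : ℂ} (hz : z ≠ 0) : detE q0 z = 2 * specLam q0 z / z := by
  simp only [detE, specLam]; field_simp

lemma detE_ne_zero {q0 : ℝ} {z : ℂ} (hz : z ∈ admissible q0) : detE q0 z ≠ 0 := by
  rw [detE_eq hz.2.1]
  exact div_ne_zero (mul_ne_zero two_ne_zero hz.2.2) hz.2.1

lemma NZBC.s22_eq (h : NZBC q q0 qp qm t) {z : ℂ} (hz : star z ∈ admissible q0) :
    s22 q q0 qp qm t z = star (s11 q q0 qp qm t (star z)) := by
  simp only [s22, s11, (h.jostColumn_top_one hz).2, (h.jostColumn_bot_zero hz).2, detE_star,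
    wronskian, conjVec]
  simp
  ring

/-- The numerator of `s₁₁` in terms of the normalized Jost values. -/
lemma NZBC.s11_eq (h : NZBC q q0 qp qm t) {z : ℂ} (hz : z ∈ admissible q0) :
    s11 q q0 qp qm t z =
      (jostValue q q0 qp t z 0 * jostValue (reflectPot q) q0 (star qm) (-t) z 0 -
        jostValue q q0 qp t z 1 * jostValue (reflectPot q) q0 (star qm) (-t) z 1) / detE q0 z := by
  -- At x = 0 the phases at times t and -t are opposite, so the two normalizing exponentials cancel.
  have h1 : Complex.exp (-(Complex.I * phase q0 0 t z)) *
      Complex.exp (-(Complex.I * phase q0 0 (-t) z)) = 1 := by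
    have := phase_neg_neg q0 0 t z
    rw [neg_zero] at this
    rw [← Complex.exp_add, this, ← Complex.exp_zero]
    congr 1; ring
  simp only [s11, (h.jostColumn_bot_one hz).2.2, wronskian, swapVec, jostValue, Pi.smul_apply,
    smul_eq_mul, neg_zero, Matrix.cons_val_zero, Matrix.cons_val_one]
  congr 1
  generalize jostColumn q q0 qp atTop 0 t z 0 = u
  generalize jostColumn (reflectPot q) q0 (star qm) atTop 0 (-t) z 0 = v
  linear_combination (-(u 0 * v 0 - u 1 * v 1)) * h1

lemma NZBC.differentiableOn_s11 (h : NZBC q q0 qp qm t) :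
    DifferentiableOn ℂ (s11 q q0 qp qm t) Dplus := by
  have h1 := fun i => differentiableOn_pi.1 h.differentiableOn_jostValue i
  have h2 := fun i => differentiableOn_pi.1 h.reflect.differentiableOn_jostValue i
  have h3 : DifferentiableOn ℂ (detE q0) Dplus := by
    have : ∀ z ∈ Dplus, z ^ 2 ≠ 0 := fun z hz => pow_ne_zero 2 (ne_zero_of_mem_Dplus hz)
    unfold detE
    fun_prop (disch := assumption)
  refine DifferentiableOn.congr ((((h1 0).mul (h2 0)).sub ((h1 1).mul (h2 1))).div h3 ?_)
    fun z hz => h.s11_eq (Dplus_subset_admissible hz)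
  exact fun z hz => detE_ne_zero (Dplus_subset_admissible hz)

lemma NZBC.continuousOn_s11 (h : NZBC q q0 qp qm t) :
    ContinuousOn (s11 q q0 qp qm t) (admissible q0) := by
  have h1 := fun i => continuousOn_pi.1 h.continuousOn_jostValue i
  have h2 := fun i => continuousOn_pi.1 h.reflect.continuousOn_jostValue i
  have h3 : ContinuousOn (detE q0) (admissible q0) := by
    have : ∀ z ∈ admissible q0, z ^ 2 ≠ 0 := fun z hz => pow_ne_zero 2 hz.2.1
    unfold detE
    fun_prop (disch := assumption)
  exact ContinuousOn.congr ((((h1 0).mul (h2 0)).sub ((h1 1).mul (h2 1))).div h3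
    fun z hz => detE_ne_zero hz) fun z hz => h.s11_eq hz

/-- Clearing the denominator leaves a Wronskian of Jost values that are bounded up to ±iq₀, so s₁₁
has at most the singularity of 1/(1 + q₀²/z²) there. -/
lemma NZBC.bounded_detE_mul_s11 (h : NZBC q q0 qp qm t) (κ : ℝ) :
    ∃ M, ∀ z ∈ admissible q0, ‖specK q0 z‖ < κ → ‖detE q0 z * s11 q q0 qp qm t z‖ ≤ M := by
  obtain ⟨-, -, M, hM⟩ := h.exists_jostValue κ
  obtain ⟨-, -, M', hM'⟩ := h.reflect.exists_jostValue κ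
  refine ⟨M * M' + M * M', fun z hz hk => ?_⟩
  rw [h.s11_eq hz, mul_div_cancel₀ _ (detE_ne_zero hz)]
  have h1 := hM z hz hk
  have h2 := hM' z hz hk
  have h0 : 0 ≤ M := (norm_nonneg _).trans h1
  generalize jostValue q q0 qp t z = u at h1 ⊢
  generalize jostValue (reflectPot q) q0 (star qm) (-t) z = v at h2 ⊢
  have h3 : ∀ i, ‖u i * v i‖ ≤ M * M' := fun i => by
    rw [norm_mul]
    exact mul_le_mul ((norm_le_pi_norm u i).trans h1) ((norm_le_pi_norm v i).trans h2)
      (norm_nonneg _) h0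
  exact (norm_sub_le _ _).trans (add_le_add (h3 0) (h3 1))

lemma neg_mem_admissible {z : ℂ} (hz : z ∈ admissible q0) : -z ∈ admissible q0 :=
  ⟨by simpa using hz.1, neg_ne_zero.2 hz.2.1, by rw [specLam_neg]; exact neg_ne_zero.2 hz.2.2⟩

lemma circleInv_mem_admissible (hq0 : 0 < q0) {z : ℂ} (hz : z ∈ admissible q0) :
    circleInv q0 z ∈ admissible q0 := by
  have h0 : (q0 : ℂ) ≠ 0 := by exact_mod_cast hq0.ne'
  refine ⟨?_, ?_, ?_⟩
  · rw [circleInv_eq_mul q0 hz.2.1, Complex.re_ofReal_mul, Complex.im_ofReal_mul]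
    have := hz.1
    have h5 : q0 ^ 2 / Complex.normSq z * z.re * (q0 ^ 2 / Complex.normSq z * z.im) =
      (q0 ^ 2 / Complex.normSq z) ^ 2 * (z.re * z.im) := by ring
    rw [h5]; positivity
  · exact div_ne_zero (pow_ne_zero 2 h0) (star_ne_zero.2 hz.2.1)
  · rw [specLam_circleInv hq0 hz.2.1]
    exact star_ne_zero.2 hz.2.2

lemma NZBC.jostValue_neg (h : NZBC q q0 qp qm t) {z : ℂ} (hz : z ∈ admissible q0) :
    jostValue q q0 qp t (-z) = ![jostValue q q0 qp t z 0, -jostValue q q0 qp t z 1] := by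
  have h1 := h.jost_unique (neg_mem_admissible hz).1 (h.isJostColumn (neg_mem_admissible hz))
    (h.isJostColumn hz).neg
  simp only [jostValue, h1, phase_neg]
  ext i; fin_cases i <;> simp

lemma NZBC.s11_neg (h : NZBC q q0 qp qm t) {z : ℂ} (hz : z ∈ admissible q0) :
    s11 q q0 qp qm t (-z) = s11 q q0 qp qm t z := by
  rw [h.s11_eq hz, h.s11_eq (neg_mem_admissible hz), h.jostValue_neg hz,
    h.reflect.jostValue_neg hz, detE_neg]
  simp

lemma NZBC.jostValue_circleInv (h : NZBC q q0 qp qm t) {z : ℂ} (hz : z ∈ admissible q0) :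
    jostValue q q0 qp t z =
      ![Complex.I * star qp / z * star (jostValue q q0 qp t (circleInv q0 z) 1),
        Complex.I * star qp / z * star (jostValue q q0 qp t (circleInv q0 z) 0)] := by
  have h1 := h.jost_unique hz.1 (h.isJostColumn hz)
    ((h.isJostColumn (circleInv_mem_admissible h.pos hz)).circleInv h.pos h.norm_qp hz.2.1)
  simp only [jostValue]
  rw [h1, phase_circleInv h.pos _ _ hz.2.1]
  ext i; fin_cases i <;> simp [← Complex.exp_conj] <;> ring

/-- The normalization factors of the inversion at the two ends, together with the change of det E,
combine to q₋/q₊. This identity carries the behaviour at infinity to the origin. -/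
lemma NZBC.s11_circleInv (h : NZBC q q0 qp qm t) {z : ℂ} (hz : z ∈ admissible q0) :
    s11 q q0 qp qm t z = qm / qp * star (s11 q q0 qp qm t (circleInv q0 z)) := by
  have h0 : (q0 : ℂ) ≠ 0 := by exact_mod_cast h.pos.ne'
  have hz0 := hz.2.1
  have hqp : qp ≠ 0 := norm_pos_iff.1 (by rw [h.norm_qp]; exact h.pos)
  have hbb : qp * (starRingEnd ℂ) qp = (q0 : ℂ) ^ 2 := by
    rw [← h.norm_qp]; exact Complex.mul_conj' qp
  have hz' : (starRingEnd ℂ) z ≠ 0 := by simpa using hz0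
  have hd : star (detE q0 (circleInv q0 z)) = z ^ 2 / q0 ^ 2 * detE q0 z := by
    simp [detE, circleInv]; field_simp; ring
  have hd0 := detE_ne_zero hz
  rw [h.s11_eq hz, h.s11_eq (circleInv_mem_admissible h.pos hz), h.jostValue_circleInv hz,
    h.reflect.jostValue_circleInv hz, star_div₀, hd]
  generalize jostValue q q0 qp t (circleInv q0 z) = u
  generalize jostValue (reflectPot q) q0 (star qm) (-t) (circleInv q0 z) = v
  simp
  field_simp
  ring_nf
  simp only [Complex.I_sq]
  linear_combination (qm * (starRingEnd ℂ) (u 0) * (starRingEnd ℂ) (v 0) -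
    qm * (starRingEnd ℂ) (u 1) * (starRingEnd ℂ) (v 1)) * hbb

lemma NZBC.integrable_normSq_sub (h : NZBC q q0 qp qm t) :
    Integrable fun x => ‖q x t‖ ^ 2 - q0 ^ 2 := by
  have h1 := h.integrableOn_normSq_sub
  have h2 := h.reflect.integrableOn_normSq_sub
  simp only [reflectPot_neg, norm_star] at h2
  have h3 := ((Measure.measurePreserving_neg volume).integrableOn_comp_preimage
      (Homeomorph.neg ℝ).measurableEmbedding (s := Set.Iio (0 : ℝ))
      (f := fun x => ‖q x t‖ ^ 2 - q0 ^ 2)).1 (by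
        have : Neg.neg ⁻¹' Set.Iio (0 : ℝ) = Set.Ioi 0 := by ext x; simp
        rw [this]; exact h2)
  rw [← integrableOn_univ, ← Set.Iic_union_Ioi (a := (0 : ℝ))]
  exact ((integrableOn_Iic_iff_integrableOn_Iio (by simp)).2 h3).union h1

lemma NZBC.v0_eq (h : NZBC q q0 qp qm t) :
    v0 q q0 t = (1 / 2) * ((∫ x in Set.Ioi 0, (‖q x t‖ ^ 2 - q0 ^ 2)) +
      ∫ x in Set.Ioi 0, (‖reflectPot q x (-t)‖ ^ 2 - q0 ^ 2)) := by
  simp only [v0, reflectPot_neg, norm_star]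
  rw [integral_comp_neg_Ioi 0 (fun x => ‖q x t‖ ^ 2 - q0 ^ 2), neg_zero, add_comm,
    intervalIntegral.integral_Iic_add_Ioi h.integrable_normSq_sub.integrableOn
      h.integrable_normSq_sub.integrableOn]

/-- Each half-line contributes half of its integral of |q|² - q₀² to the phase. The product of the
two factors is e^{-iv₀}, while the second components and det E - 1 only contribute O(1/|z|). -/
lemma NZBC.s11_asymptotics (h : NZBC q q0 qp qm t) :
    ∃ C R : ℝ, 0 ≤ C ∧ 1 ≤ R ∧ ∀ z ∈ admissible q0, R ≤ ‖z‖ →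
      ‖s11 q q0 qp qm t z - Complex.exp (-(Complex.I * (v0 q q0 t : ℂ)))‖ ≤ C / ‖z‖ := by
  obtain ⟨C, R, hC, hR, hu⟩ := h.jostValue_asymptotics
  obtain ⟨C', R', hC', hR', hv⟩ := h.reflect.jostValue_asymptotics
  have hq0 := h.pos
  set a := Complex.exp (-(Complex.I / 2 * ((∫ x in Set.Ioi 0, (‖q x t‖ ^ 2 - q0 ^ 2) : ℝ) : ℂ)))
    with ha
  set b := Complex.exp (-(Complex.I / 2 *
    ((∫ x in Set.Ioi 0, (‖reflectPot q x (-t)‖ ^ 2 - q0 ^ 2) : ℝ) : ℂ))) with hb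
  have hab : a * b = Complex.exp (-(Complex.I * (v0 q q0 t : ℂ))) := by
    rw [ha, hb, ← Complex.exp_add, h.v0_eq]
    congr 1; push_cast; ring
  have hna : ‖a‖ = 1 := by simp [ha, Complex.norm_exp]
  have hnb : ‖b‖ = 1 := by simp [hb, Complex.norm_exp]
  refine ⟨2 * (C * (1 + C') + C' + C * C' + q0 ^ 2), max R (max R' (2 * q0)), by positivity,
    hR.trans (le_max_left _ _), fun z hz hzR => ?_⟩
  have hzR1 : R ≤ ‖z‖ := (le_max_left _ _).trans hzR
  have hzR2 : R' ≤ ‖z‖ := ((le_max_left _ _).trans (le_max_right _ _)).trans hzR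
  have hzR3 : 2 * q0 ≤ ‖z‖ := ((le_max_right _ _).trans (le_max_right _ _)).trans hzR
  have hz1 : 1 ≤ ‖z‖ := hR.trans hzR1
  have hzpos : 0 < ‖z‖ := by linarith
  obtain ⟨hu0, hu1⟩ := hu z hz.1 hzR1
  obtain ⟨hv0, hv1⟩ := hv z hz.1 hzR2
  have hd1 : ‖detE q0 z - 1‖ ≤ q0 ^ 2 / ‖z‖ ^ 2 := by
    simp [detE]
  have hd2 : q0 ^ 2 / ‖z‖ ^ 2 ≤ 1 / 4 := by
    rw [div_le_div_iff₀ (by positivity) (by norm_num)]; nlinarith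
  have hd3 : q0 ^ 2 / ‖z‖ ^ 2 ≤ q0 ^ 2 / ‖z‖ := by
    gcongr
    nlinarith
  have hd4 : 1 / 2 ≤ ‖detE q0 z‖ := by
    have := norm_sub_norm_le (1 : ℂ) (1 - detE q0 z)
    rw [sub_sub_cancel, norm_one, norm_sub_rev] at this
    linarith
  have hd0 := detE_ne_zero hz
  rw [h.s11_eq hz, ← hab]
  set u := jostValue q q0 qp t z
  set v := jostValue (reflectPot q) q0 (star qm) (-t) z
  have e1 : (u 0 * v 0 - u 1 * v 1) / detE q0 z - a * b =
      ((u 0 - a) * b + a * (v 0 - b) + (u 0 - a) * (v 0 - b) - u 1 * v 1 -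
        a * b * (detE q0 z - 1)) / detE q0 z := by
    field_simp; ring
  have hCz : C / ‖z‖ ≤ C := div_le_self hC hz1
  have hC'z : C' / ‖z‖ ≤ C' := div_le_self hC' hz1
  have e2 : ‖(u 0 - a) * b + a * (v 0 - b) + (u 0 - a) * (v 0 - b) - u 1 * v 1 -
        a * b * (detE q0 z - 1)‖ ≤ (C * (1 + C') + C' + C * C' + q0 ^ 2) / ‖z‖ := by
    calc _ ≤ ‖u 0 - a‖ * ‖b‖ + ‖a‖ * ‖v 0 - b‖ + ‖u 0 - a‖ * ‖v 0 - b‖ + ‖u 1‖ * ‖v 1‖ +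
          ‖a‖ * ‖b‖ * ‖detE q0 z - 1‖ := by
          simp only [← norm_mul]
          refine (norm_sub_le _ _).trans (add_le_add ?_ le_rfl)
          refine (norm_sub_le _ _).trans (add_le_add ?_ le_rfl)
          exact norm_add₃_le
      _ ≤ C / ‖z‖ * 1 + 1 * (C' / ‖z‖) + C / ‖z‖ * C' + C / ‖z‖ * C' +
          1 * 1 * (q0 ^ 2 / ‖z‖) := by
          rw [hna, hnb]
          gcongr
          · exact hv0.trans hC'z
          · exact hv1.trans hC'z
          · exact hd1.trans hd3
      _ = _ := by ring
  rw [e1, norm_div, div_le_iff₀ (norm_pos_iff.2 hd0)]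
  refine e2.trans ?_
  have : 0 ≤ (C * (1 + C') + C' + C * C' + q0 ^ 2) / ‖z‖ := by positivity
  calc (C * (1 + C') + C' + C * C' + q0 ^ 2) / ‖z‖
      = 2 * ((C * (1 + C') + C' + C * C' + q0 ^ 2) / ‖z‖) * (1 / 2) := by ring
    _ ≤ 2 * ((C * (1 + C') + C' + C * C' + q0 ^ 2) / ‖z‖) * ‖detE q0 z‖ := by gcongr
    _ = _ := by ring

lemma wronskian_jost_zero_one {b z : ℂ} {l : Filter ℝ} [l.NeBot] {φ ψ : ℝ → Fin 2 → ℂ}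
    (hb : ‖b‖ = q0) (hz : z ≠ 0) (hφ : IsJostColumn q q0 b l 0 t z φ)
    (hψ : IsJostColumn q q0 b l 1 t z ψ) (x : ℝ) : wronskian (φ x) (ψ x) = detE q0 z := by
  have hbb : b * (starRingEnd ℂ) b = (q0 : ℂ) ^ 2 := by rw [← hb]; exact Complex.mul_conj' b
  have h1 := (continuous_wronskian.tendsto _).comp (hφ.2.prodMk_nhds hψ.2)
  have h2 : Tendsto (fun _ : ℝ => wronskian (φ x) (ψ x)) l (𝓝 (detE q0 z)) := by
    refine (h1.congr fun y => ?_).trans_eq ?_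
    · simp only [Function.comp, wronskian_smul_smul, ← Complex.exp_add]
      rw [wronskian_eq hφ.1 hψ.1 x y]
      simp [sigma3]
    · simp [wronskian, bgMatrix, detE]
      field_simp
      linear_combination (-Complex.I ^ 2) * hbb - (q0 : ℂ) ^ 2 * Complex.I_sq
  exact tendsto_nhds_unique tendsto_const_nhds h2

/-- By the Plücker relation for four vectors in the plane, the determinant reduces to Wr(Φ₊₁, Φ₊₂)
Wr(Φ₋₁, Φ₋₂)/(det E)², and both Wronskians equal det E. -/
lemma NZBC.det_scat (h : NZBC q q0 qp qm t) {z : ℂ} (hz : z ∈ admissible q0)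
    (hz' : star z ∈ admissible q0) :
    s11 q q0 qp qm t z * s22 q q0 qp qm t z - s12 q q0 qp qm t z * s21 q q0 qp qm t z = 1 := by
  have h1 := wronskian_jost_zero_one h.norm_qp hz.2.1 (h.isJostColumn hz)
    (h.jostColumn_top_one hz').1 0
  have h2 := wronskian_jost_zero_one h.norm_qm hz.2.1 (h.jostColumn_bot_zero hz').1
    (h.jostColumn_bot_one hz).1 0
  have hd := detE_ne_zero hz
  simp only [s11, s22, s12, s21]
  generalize jostColumn q q0 qp atTop 0 t z 0 = a at h1 ⊢
  generalize jostColumn q q0 qp atTop 1 t z 0 = b at h1 ⊢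
  generalize jostColumn q q0 qm atBot 0 t z 0 = c at h2 ⊢
  generalize jostColumn q q0 qm atBot 1 t z 0 = d at h2 ⊢
  have h3 : wronskian a d * wronskian c b - wronskian b d * wronskian c a =
      detE q0 z * detE q0 z := by
    calc _ = wronskian a b * wronskian c d := by simp only [wronskian]; ring
      _ = _ := by rw [h1, h2]
  have h4 : ∀ w₁ w₂ w₃ w₄ e : ℂ, e ≠ 0 → w₁ * w₂ - w₃ * w₄ = e * e →
      w₁ / e * (w₂ / e) - w₃ / e * (w₄ / e) = 1 := fun w₁ w₂ w₃ w₄ e he h => by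
    field_simp
    rw [h, pow_two]
  exact h4 _ _ _ _ _ hd h3

lemma mem_admissible_of_contour {z : ℂ} (hz : z ∈ contour) (hb : z ∉ branchPts q0) :
    z ∈ admissible q0 :=
  ⟨by rcases hz.1 with h | h <;> simp [h], hz.2, fun h => hb ((specLam_eq_zero_iff hz.2).1 h)⟩

lemma star_mem_admissible_of_contour {z : ℂ} (hz : z ∈ contour) (hb : z ∉ branchPts q0) :
    star z ∈ admissible q0 := by
  refine ⟨?_, star_ne_zero.2 hz.2, ?_⟩
  · rcases hz.1 with h | h <;> simp [h]
  · rw [specLam_star]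
    exact star_ne_zero.2 (mem_admissible_of_contour hz hb).2.2

/-- On the real axis z* = z, and on the imaginary axis z* = -z, where the evenness of s₁₁ removes
the sign. -/
lemma NZBC.s22_eq_star_s11 (h : NZBC q q0 qp qm t) {z : ℂ} (hz : z ∈ contour)
    (hb : z ∉ branchPts q0) : s22 q q0 qp qm t z = star (s11 q q0 qp qm t z) := by
  rw [h.s22_eq (star_mem_admissible_of_contour hz hb)]
  rcases hz.1 with h1 | h1
  · have : star z = z := by apply Complex.ext <;> simp [h1]
    rw [this]
  · have : star z = -z := by apply Complex.ext <;> simp [h1]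
    rw [this, h.s11_neg (mem_admissible_of_contour hz hb)]

lemma s11_branchPts {z : ℂ} (hz : z ≠ 0) (hb : z ∈ branchPts q0) : s11 q q0 qp qm t z = 0 := by
  rw [s11, detE_eq hz, (specLam_eq_zero_iff hz).2 hb]
  simp

/-- From det S = 1 follows 1 - ρρ̃ = 1/(s₁₁s₂₂) = |s₁₁|⁻². This is a positive real number, so the
principal logarithm is real. -/
theorem NZBC.logRefl_eq (h : NZBC q q0 qp qm t) (hns : NoSpectralSingularities q q0 qp qm t)
    {ζ : ℂ} (hζ : ζ ∈ contour) :
    logRefl q q0 qp qm t ζ = ((-2 * Real.log ‖s11 q q0 qp qm t ζ‖ : ℝ) : ℂ) := by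
  -- At ±iq₀ division by det E = 0 returns 0, so s₁₁ = ρ = 0. Both sides are then 0 with the
  -- convention log 0 = 0.
  by_cases hb : ζ ∈ branchPts q0
  · simp [logRefl, rho, s11_branchPts hζ.2 hb]
  have hadm := mem_admissible_of_contour hζ hb
  have hne := hns.ne_zero ζ ⟨hζ, hb⟩
  have h11 := left_ne_zero_of_mul hne
  have h22 := right_ne_zero_of_mul hne
  have hdet := h.det_scat hadm (star_mem_admissible_of_contour hζ hb)
  have h1 : 1 - rho q q0 qp qm t ζ * rhoTilde q q0 qp qm t ζ =
      ((‖s11 q q0 qp qm t ζ‖ ^ (-2 : ℤ) : ℝ) : ℂ) := by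
    have h2 : s11 q q0 qp qm t ζ * s22 q q0 qp qm t ζ = ((‖s11 q q0 qp qm t ζ‖ ^ 2 : ℝ) : ℂ) := by
      rw [h.s22_eq_star_s11 hζ hb]; push_cast; exact Complex.mul_conj' _
    have h3 : ((‖s11 q q0 qp qm t ζ‖ ^ (-2 : ℤ) : ℝ) : ℂ) =
        (s11 q q0 qp qm t ζ * s22 q q0 qp qm t ζ)⁻¹ := by
      rw [h2]; push_cast; rw [_root_.zpow_neg]; norm_cast
    rw [h3, rho, rhoTilde]
    field_simp
    linear_combination hdet
  rw [logRefl, h1, ← Complex.ofReal_log (by positivity), Real.log_zpow]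
  norm_num

/-- At z = q₀ one has k = 0, hence X = 0 and θ = 0, and the Jost columns are the constant columns of
E₊ and E₋. Then s₁₂(q₀) is a nonzero multiple of q₊ - q₋, and its vanishing gives q₊ = q₋ and S(q₀)
= I. -/
theorem NZBC.reflectionless (h : NZBC q q0 qp qm t) (hns : NoSpectralSingularities q q0 qp qm t)
    (hr : Reflectionless q q0 qp qm t) : scatMatrix q q0 qp qm t (q0 : ℂ) = 1 ∧ qp = qm := by
  have hq0 := h.pos
  have h0 : (q0 : ℂ) ≠ 0 := by exact_mod_cast hq0.ne'
  have hc : (q0 : ℂ) ∈ contour := ⟨Or.inl (by simp), h0⟩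
  have hb : (q0 : ℂ) ∉ branchPts q0 := by
    rintro (h1 | h1)
    · have := congrArg Complex.re h1
      simp at this; linarith
    · have := congrArg Complex.re (Set.mem_singleton_iff.1 h1)
      simp at this; linarith
  have hadm := mem_admissible_of_contour hc hb
  have hk : specK q0 q0 = 0 := by simp only [specK]; field_simp; ring
  have hph : ∀ x t, phase q0 x t q0 = 0 := fun x t => by simp [phase, hk]
  have hbp : qp * (starRingEnd ℂ) qp = (q0 : ℂ) ^ 2 := by
    rw [← h.norm_qp]; exact Complex.mul_conj' qp
  have hconst : ∀ {q : ℝ → ℝ → ℂ} {qp qm : ℂ} {t : ℝ}, NZBC q q0 qp qm t → 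
      jostColumn q q0 qp atTop 0 t q0 = fun _ i => bgMatrix qp q0 i 0 := by
    intro q qp qm t h
    refine h.jost_unique hadm.1 (h.isJostColumn hadm) ⟨fun x => ?_, ?_⟩
    · have : laxX q q0 x t q0 = 0 := by simp [laxX, hk]
      rw [this, Matrix.zero_mulVec]
      exact hasDerivAt_const _ _
    · simp [hph]
  have hstar : star (q0 : ℂ) = q0 := by simp
  have hstar' : star (q0 : ℂ) ∈ admissible q0 := by rwa [hstar]
  have hp1 := hconst h
  have hm1 := hconst h.reflect
  have hne := hns.ne_zero _ ⟨hc, hb⟩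
  obtain ⟨hr1, hr2⟩ := hr _ ⟨hc, hb⟩
  have h21 : s21 q q0 qp qm t q0 = 0 := by
    simpa [rho, left_ne_zero_of_mul hne] using hr1
  have h12 : s12 q q0 qp qm t q0 = 0 := by
    simpa [rhoTilde, right_ne_zero_of_mul hne] using hr2
  have hd := detE_ne_zero hadm
  have hd2 : detE q0 q0 = 2 := by simp only [detE]; field_simp; norm_num
  have heq : qp = qm := by
    have h1 := h12
    simp only [s12, (h.jostColumn_top_one hstar').2, (h.jostColumn_bot_one hadm).2.2, hstar, hp1,
      hm1, hd2] at h1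
    simp [wronskian, conjVec, swapVec, bgMatrix] at h1
    field_simp at h1
    rw [mul_zero, mul_eq_zero] at h1
    exact sub_eq_zero.1 (h1.resolve_left Complex.I_ne_zero)
  have h11 : s11 q q0 qp qm t q0 = 1 := by
    simp only [s11, (h.jostColumn_bot_one hadm).2.2, hp1, hm1, hd2]
    rw [← heq]
    simp [wronskian, swapVec, bgMatrix]
    field_simp
    linear_combination (-Complex.I ^ 2) * hbp - (q0 : ℂ) ^ 2 * Complex.I_sq
  have h22 : s22 q q0 qp qm t q0 = 1 := by
    rw [h.s22_eq_star_s11 hc hb, h11, star_one]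
  refine ⟨?_, heq⟩
  rw [scatMatrix, h11, h12, h21, h22, Matrix.one_fin_two]

end

/-! ### Cauchy's theorem and the Schwarz formula on the upper half plane. -/

noncomputable section

lemma integrable_of_continuous_of_norm_le {F : ℝ → ℂ} {C R : ℝ} (hF : Continuous F)
    (hb : ∀ s, R ≤ |s| → ‖F s‖ ≤ C * |s| ^ (-(3 / 2) : ℝ)) : Integrable F := by
  have hg : Integrable fun s : ℝ => (1 + ‖s‖) ^ (-(3 / 2) : ℝ) :=
    integrable_one_add_norm (by simp; norm_num)
  have hO : F =O[cocompact ℝ] fun s : ℝ => (1 + ‖s‖) ^ (-(3 / 2) : ℝ) := by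
    refine Asymptotics.IsBigO.of_bound (|C| * 2 ^ (3 / 2 : ℝ)) ?_
    have h1 : ∀ᶠ s : ℝ in cocompact ℝ, max R 1 ≤ ‖s‖ :=
      (tendsto_norm_cocompact_atTop (E := ℝ)).eventually_ge_atTop _
    filter_upwards [h1] with s hs
    have hs1 : 1 ≤ |s| := (le_max_right _ _).trans hs
    refine (hb s ((le_max_left _ _).trans hs)).trans ?_
    have h2 : |s| ^ (-(3 / 2) : ℝ) ≤ 2 ^ (3 / 2 : ℝ) * (1 + |s|) ^ (-(3 / 2) : ℝ) := by
      have h3 : (2 * |s|) ^ (-(3 / 2) : ℝ) ≤ (1 + |s|) ^ (-(3 / 2) : ℝ) :=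
        Real.rpow_le_rpow_of_nonpos (by positivity) (by linarith) (by norm_num)
      rw [Real.mul_rpow (by norm_num) (by positivity)] at h3
      calc |s| ^ (-(3 / 2) : ℝ) = 2 ^ (3 / 2 : ℝ) * (2 ^ (-(3 / 2) : ℝ) * |s| ^ (-(3 / 2) : ℝ)) := by
            rw [← mul_assoc, ← Real.rpow_add (by norm_num)]; norm_num
        _ ≤ _ := by gcongr
    rw [Real.norm_of_nonneg (by positivity), Real.norm_eq_abs, mul_assoc]
    refine (mul_le_mul_of_nonneg_right (le_abs_self C) (by positivity)).trans ?_
    gcongr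
  exact hF.locallyIntegrable.integrable_of_isBigO_cocompact hO (hg.integrableAtFilter _)

/-- Cauchy's theorem on the upper half plane. -/
lemma integral_real_eq_zero {F : ℂ → ℂ} {C R : ℝ} (hF : DifferentiableOn ℂ F {z | 0 ≤ z.im})
    (hb : ∀ z : ℂ, 0 ≤ z.im → R ≤ ‖z‖ → ‖F z‖ ≤ C * ‖z‖ ^ (-(3 / 2) : ℝ)) :
    Integrable (fun s : ℝ => F s) ∧ ∫ s : ℝ, F s = 0 := by
  have hc : Continuous fun s : ℝ => F s :=
    hF.continuousOn.comp_continuous Complex.continuous_ofReal fun s => by simp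
  have hi : Integrable fun s : ℝ => F s :=
    integrable_of_continuous_of_norm_le hc fun s hs => by
      simpa using hb s (by simp) (by simpa using hs)
  refine ⟨hi, ?_⟩
  have h1 : Tendsto (fun T : ℝ => ∫ s in (-T)..T, F s) atTop (𝓝 (∫ s : ℝ, F s)) :=
    intervalIntegral_tendsto_integral hi tendsto_neg_atTop_atBot tendsto_id
  -- On the rectangle [-T, T] × [0, T] the other three sides have total length 4T, and the integrand
  -- there is O(T^{-3/2}).
  have h2 : ∀ᶠ T : ℝ in atTop, ‖∫ s in (-T)..T, F s‖ ≤ 4 * |C| * T ^ (-(1 / 2) : ℝ) := by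
    filter_upwards [eventually_ge_atTop (max R 1)] with T hT
    have hT1 : 1 ≤ T := (le_max_right _ _).trans hT
    have hT0 : 0 < T := by linarith
    have hpt : ∀ z : ℂ, 0 ≤ z.im → T ≤ ‖z‖ → ‖F z‖ ≤ |C| * T ^ (-(3 / 2) : ℝ) := fun z hz hzT => by
      refine (hb z hz (((le_max_left _ _).trans hT).trans hzT)).trans ?_
      refine mul_le_mul (le_abs_self C) ?_ (by positivity) (abs_nonneg C)
      exact Real.rpow_le_rpow_of_nonpos hT0 hzT (by norm_num)
    have hrect := Complex.integral_boundary_rect_eq_zero_of_differentiableOn F (-T : ℂ)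
      (T + T * Complex.I) (hF.mono fun z hz => by
        simp [Complex.mem_reProdIm, Set.uIcc_of_le hT0.le] at hz
        exact hz.2.1)
    simp only [Complex.neg_re, Complex.ofReal_re, Complex.add_re, Complex.mul_re, Complex.I_re,
      mul_zero, Complex.ofReal_im, Complex.I_im, mul_one, sub_self, add_zero, Complex.neg_im,
      neg_zero, Complex.ofReal_zero, zero_mul, Complex.add_im, Complex.mul_im, zero_add] at hrect
    have e1 : ‖∫ s in (-T)..T, F (s + T * Complex.I)‖ ≤ |C| * T ^ (-(3 / 2) : ℝ) * |T - -T| :=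
      intervalIntegral.norm_integral_le_of_norm_le_const fun s _ => hpt _ (by simpa using hT0.le) (by
        have := Complex.abs_im_le_norm (s + T * Complex.I)
        simpa [abs_of_pos hT0] using this)
    have e2 : ‖∫ y in (0)..T, F (T + y * Complex.I)‖ ≤ |C| * T ^ (-(3 / 2) : ℝ) * |T - 0| :=
      intervalIntegral.norm_integral_le_of_norm_le_const fun y hy => hpt _ (by
        rw [Set.uIoc_of_le hT0.le] at hy
        simpa using hy.1.le) (by
        have := Complex.abs_re_le_norm (T + y * Complex.I)
        simpa [abs_of_pos hT0] using this)
    have e3 : ‖∫ y in (0)..T, F (((-T : ℝ) : ℂ) + y * Complex.I)‖ ≤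
        |C| * T ^ (-(3 / 2) : ℝ) * |T - 0| :=
      intervalIntegral.norm_integral_le_of_norm_le_const fun y hy => hpt _ (by
        rw [Set.uIoc_of_le hT0.le] at hy
        simpa using hy.1.le) (by
        have := Complex.abs_re_le_norm (((-T : ℝ) : ℂ) + y * Complex.I)
        simpa [abs_of_pos hT0] using this)
    have e4 : ∫ s in (-T)..T, F s = (∫ s in (-T)..T, F (s + T * Complex.I)) -
        Complex.I * (∫ y in (0)..T, F (T + y * Complex.I)) +
        Complex.I * ∫ y in (0)..T, F (((-T : ℝ) : ℂ) + y * Complex.I) := by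
      simp only [smul_eq_mul] at hrect
      linear_combination hrect
    have e5 : T ^ (-(3 / 2) : ℝ) * T = T ^ (-(1 / 2) : ℝ) := by
      rw [← Real.rpow_add_one hT0.ne']; norm_num
    rw [sub_neg_eq_add, abs_of_pos (by linarith : 0 < T + T)] at e1
    rw [sub_zero, abs_of_pos hT0] at e2 e3
    rw [e4]
    refine (norm_add_le _ _).trans ?_
    refine (add_le_add_left (norm_sub_le _ _) _).trans ?_
    simp only [norm_mul, Complex.norm_I, one_mul]
    have e6 : |C| * T ^ (-(3 / 2) : ℝ) * T = |C| * T ^ (-(1 / 2) : ℝ) := by rw [mul_assoc, e5]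
    linarith
  have h3 : Tendsto (fun T : ℝ => 4 * |C| * T ^ (-(1 / 2) : ℝ)) atTop (𝓝 0) := by
    simpa using (tendsto_rpow_neg_atTop (y := 1 / 2) (by norm_num)).const_mul (4 * |C|)
  exact tendsto_nhds_unique h1 (squeeze_zero_norm' h2 h3)

/-- The integrand is 2i times the unnormalized Poisson kernel Im u/|s - u|², so the integral reduces
to that of 1/(1 + s²). -/
lemma integral_cauchy_kernel {u : ℂ} (hu : 0 < u.im) :
    Integrable (fun s : ℝ => (u - star u) / ((s - u) * (s - star u))) ∧
    ∫ s : ℝ, (u - star u) / ((s - u) * (s - star u)) = 2 * Real.pi * Complex.I := by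
  have h1 : ∀ s : ℝ, (u - star u) / ((s - u) * (s - star u)) =
      (2 * Complex.I / u.im) * (((1 + ((s - u.re) / u.im) ^ 2)⁻¹ : ℝ) : ℂ) := by
    intro s
    have e1 : u - star u = 2 * u.im * Complex.I := by
      rw [Complex.star_def, Complex.sub_conj]; push_cast; ring
    have e2 : ((s : ℂ) - u) * (s - star u) = (((s - u.re) ^ 2 + u.im ^ 2 : ℝ) : ℂ) := by
      have e6 := Complex.mul_conj ((s : ℂ) - u)
      rw [Complex.normSq_apply] at e6
      simp only [map_sub, Complex.conj_ofReal, Complex.sub_re, Complex.sub_im, Complex.ofReal_re,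
        Complex.ofReal_im, zero_sub] at e6
      rw [Complex.star_def, e6]
      congr 1; ring
    have e3 : (((s - u.re) ^ 2 + u.im ^ 2 : ℝ) : ℂ) =
        (u.im : ℂ) ^ 2 * ((1 + ((s - u.re) / u.im) ^ 2 : ℝ) : ℂ) := by
      rw [← Complex.ofReal_pow, ← Complex.ofReal_mul]
      congr 1
      field_simp
      ring
    have e4 : ((1 + ((s - u.re) / u.im) ^ 2 : ℝ) : ℂ) ≠ 0 := by
      exact_mod_cast (by positivity : (0 : ℝ) < 1 + ((s - u.re) / u.im) ^ 2).ne'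
    have e5 : (u.im : ℂ) ≠ 0 := by exact_mod_cast hu.ne'
    rw [e1, e2, e3, Complex.ofReal_inv]
    field_simp
  have h2 : Integrable fun s : ℝ => (1 + ((s - u.re) / u.im) ^ 2)⁻¹ :=
    (integrable_inv_one_add_sq.comp_div hu.ne').comp_sub_right u.re
  have h3 : ∫ s : ℝ, (1 + ((s - u.re) / u.im) ^ 2)⁻¹ = u.im * Real.pi := by
    rw [integral_sub_right_eq_self (fun s => (1 + (s / u.im) ^ 2)⁻¹) u.re,
      Measure.integral_comp_div (fun s => (1 + s ^ 2)⁻¹), integral_univ_inv_one_add_sq,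
      abs_of_pos hu, smul_eq_mul]
  simp only [h1]
  refine ⟨h2.ofReal.const_mul _, ?_⟩
  rw [integral_const_mul, integral_complex_ofReal, h3]
  have e5 : (u.im : ℂ) ≠ 0 := by exact_mod_cast hu.ne'
  push_cast
  field_simp

lemma norm_sub_ge_half {z w : ℂ} (h : 2 * ‖w‖ ≤ ‖z‖) : ‖z‖ / 2 ≤ ‖z - w‖ := by
  have := norm_sub_norm_le z w
  linarith

/-- The Schwarz formula for functions holomorphic on the closed upper half plane. -/
lemma schwarz_of_differentiableOn {f : ℂ → ℂ} {C R : ℝ}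
    (hf : DifferentiableOn ℂ f {z | 0 ≤ z.im})
    (hb : ∀ z : ℂ, 0 ≤ z.im → R ≤ ‖z‖ → ‖f z‖ ≤ C * ‖z‖ ^ (-(1 / 2) : ℝ)) {u : ℂ} (hu : 0 < u.im) :
    ∫ s : ℝ, ((f s).re : ℂ) / (s - u) = Real.pi * Complex.I * f u := by
  have hsu : ∀ s : ℝ, (s : ℂ) - u ≠ 0 := fun s h => by
    have := congrArg Complex.im h
    simp at this; linarith
  have hsu' : ∀ z : ℂ, 0 ≤ z.im → z - star u ≠ 0 := fun s hs h => by
    have := congrArg Complex.im h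
    simp at this; linarith
  have hdec : ∀ g : ℂ → ℂ, ∀ w : ℂ, ∀ C R : ℝ,
      (∀ z : ℂ, 0 ≤ z.im → R ≤ ‖z‖ → ‖g z‖ ≤ C * ‖z‖ ^ (-(1 / 2) : ℝ)) →
      ∀ z : ℂ, 0 ≤ z.im → max (max R 1) (2 * ‖w‖) ≤ ‖z‖ →
        ‖g z / (z - w)‖ ≤ 2 * C * ‖z‖ ^ (-(3 / 2) : ℝ) := by
    intro g w C R hg z hz hzR
    have h1 : 1 ≤ ‖z‖ := ((le_max_right _ _).trans (le_max_left _ _)).trans hzR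
    have h2 := norm_sub_ge_half ((le_max_right _ _).trans hzR)
    have h3 := hg z hz (((le_max_left _ _).trans (le_max_left _ _)).trans hzR)
    have h4 : ‖z‖ ^ (-(1 / 2) : ℝ) = ‖z‖ ^ (-(3 / 2) : ℝ) * ‖z‖ := by
      rw [← Real.rpow_add_one (by positivity)]; norm_num
    rw [norm_div, div_le_iff₀ (by linarith)]
    have h5 : 0 ≤ C * ‖z‖ ^ (-(1 / 2) : ℝ) := (norm_nonneg _).trans h3
    rw [h4] at h3 h5
    have h6 : 0 ≤ C * ‖z‖ ^ (-(3 / 2) : ℝ) := by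
      rw [← mul_assoc] at h5
      exact nonneg_of_mul_nonneg_left h5 (by linarith)
    calc ‖g z‖ ≤ C * ‖z‖ ^ (-(3 / 2) : ℝ) * ‖z‖ := by linarith
      _ = 2 * (C * ‖z‖ ^ (-(3 / 2) : ℝ)) * (‖z‖ / 2) := by ring
      _ ≤ 2 * (C * ‖z‖ ^ (-(3 / 2) : ℝ)) * ‖z - w‖ := by gcongr
      _ = _ := by ring
  -- the conjugate point
  obtain ⟨hi1, hz1⟩ := integral_real_eq_zero (F := fun z => f z / (z - star u))
    (hf.div (by fun_prop) fun z hz => hsu' z hz)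
    (hdec f (star u) C R hb)
  -- the point itself
  set N : ℂ → ℂ := fun z => f z - f u * (u - star u) / (z - star u) with hN
  have hNu : N u = 0 := by
    have := hsu' u hu.le
    simp only [hN]
    field_simp
    ring
  have hNd : DifferentiableOn ℂ N {z | 0 ≤ z.im} :=
    hf.sub ((differentiableOn_const _).div (by fun_prop) fun z hz => hsu' z hz)
  have hNb : ∀ z : ℂ, 0 ≤ z.im → max (max R 1) (2 * ‖u‖) ≤ ‖z‖ →
      ‖N z‖ ≤ (C + 2 * ‖f u * (u - star u)‖) * ‖z‖ ^ (-(1 / 2) : ℝ) := by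
    intro z hz hzR
    have h1 : 1 ≤ ‖z‖ := ((le_max_right _ _).trans (le_max_left _ _)).trans hzR
    have h2 := norm_sub_ge_half (z := z) (w := star u)
      (by rw [norm_star]; exact (le_max_right _ _).trans hzR)
    have h3 := hb z hz (((le_max_left _ _).trans (le_max_left _ _)).trans hzR)
    have h4 : ‖z‖⁻¹ ≤ ‖z‖ ^ (-(1 / 2) : ℝ) := by
      rw [← Real.rpow_neg_one]
      exact Real.rpow_le_rpow_of_exponent_le h1 (by norm_num)
    refine (norm_sub_le _ _).trans ?_
    rw [add_mul, norm_div]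
    refine add_le_add h3 ?_
    calc ‖f u * (u - star u)‖ / ‖z - star u‖ ≤ ‖f u * (u - star u)‖ / (‖z‖ / 2) := by gcongr
      _ = 2 * ‖f u * (u - star u)‖ * ‖z‖⁻¹ := by field_simp
      _ ≤ _ := by gcongr
  have hnhds : {z : ℂ | 0 ≤ z.im} ∈ 𝓝 u :=
    mem_of_superset ((isOpen_lt continuous_const Complex.continuous_im).mem_nhds hu)
      fun z (hz : 0 < z.im) => hz.le
  -- The term subtracted in N makes N(u) = 0, so N/(z - u) extends holomorphically across u, decays,
  -- and has vanishing integral. What remains of f/(s - u) is f(u) times the Poisson type kernel.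
  have hslope : ∀ z : ℂ, z ≠ u → dslope N u z = N z / (z - u) := fun z hz => by
    rw [dslope_of_ne _ hz, slope_def_field, hNu, sub_zero]
  obtain ⟨hi2, hz2⟩ := integral_real_eq_zero ((Complex.differentiableOn_dslope hnhds).2 hNd)
    (R := max (max (max (max R 1) (2 * ‖u‖)) 1) (2 * ‖u‖))
    (C := 2 * (C + 2 * ‖f u * (u - star u)‖)) (fun z hz hzR => by
      have h1 : 2 * ‖u‖ ≤ ‖z‖ := (le_max_right _ _).trans hzR
      have h2 : 1 ≤ ‖z‖ := ((le_max_right _ _).trans (le_max_left _ _)).trans hzR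
      rw [hslope z (by rintro rfl; linarith)]
      exact hdec N u _ _ hNb z hz hzR)
  obtain ⟨hi3, hz3⟩ := integral_cauchy_kernel hu
  have hi4 : Integrable fun s : ℝ => star (f s / (s - star u)) :=
    (Complex.conjCLE : ℂ →L[ℝ] ℂ).integrable_comp hi1
  have hz4 : ∫ s : ℝ, star (f s / (s - star u)) = 0 := by
    have := integral_conj (f := fun s : ℝ => f s / (s - star u)) (μ := volume)
    rw [hz1, map_zero] at this
    exact this
  -- Write Re f = ½(f + f*). On the real line f*/(s - u) is the conjugate of f/(s - u*), whose
  -- integral vanishes because u* lies below the line.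
  have key : ∀ s : ℝ, ((f s).re : ℂ) / (s - u) = (1 / 2) * (dslope N u s +
      f u * ((u - star u) / ((s - u) * (s - star u))) + star (f s / (s - star u))) := by
    intro s
    have h1 := hsu s
    have h2 := hsu' s (by simp)
    have h3 : ((f s).re : ℂ) = (f s + (starRingEnd ℂ) (f s)) / 2 := Complex.re_eq_add_conj _
    rw [hslope _ (sub_ne_zero.1 h1), h3]
    simp [hN]
    simp at h2
    field_simp
    ring
  simp only [key]
  rw [integral_const_mul, integral_add (f := fun s : ℝ => dslope N u s +
      f u * ((u - star u) / ((s - u) * (s - star u)))) (hi2.add (hi3.const_mul (f u))) hi4,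
    integral_add hi2 (hi3.const_mul (f u)), hz2, integral_const_mul, hz3, hz4]
  ring

/-- The Schwarz formula for functions holomorphic on the open upper half plane whose real part has
boundary values `L`. -/
theorem schwarz_half_plane {f : ℂ → ℂ} {C R : ℝ} {g L : ℝ → ℝ}
    (hf : DifferentiableOn ℂ f {z | 0 < z.im})
    (hb : ∀ z : ℂ, 0 < z.im → R ≤ ‖z‖ → ‖f z‖ ≤ C * ‖z‖ ^ (-(1 / 2) : ℝ))
    (hdom : ∀ᵐ s : ℝ, ∀ ε ∈ Set.Ioo (0 : ℝ) 1, |(f (s + ε * Complex.I)).re| ≤ g s * (1 + |s|))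
    (hg : Integrable g)
    (hL : ∀ᵐ s : ℝ, Tendsto (fun ε : ℝ => (f (s + ε * Complex.I)).re) (𝓝[>] 0) (𝓝 (L s)))
    {u : ℂ} (hu : 0 < u.im) :
    Integrable (fun s : ℝ => (L s : ℂ) / (s - u)) ∧
      ∫ s : ℝ, (L s : ℂ) / (s - u) = Real.pi * Complex.I * f u := by
  have hsu : ∀ s : ℝ, (s : ℂ) - u ≠ 0 := fun s h => by
    have := congrArg Complex.im h
    simp at this; linarith
  obtain ⟨K, hK0, hK⟩ : ∃ K : ℝ, 0 ≤ K ∧ ∀ s : ℝ, (1 + |s|) ≤ K * ‖(s : ℂ) - u‖ := by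
    refine ⟨(1 + ‖u‖) / u.im + 1, by positivity, fun s => ?_⟩
    have h1 : u.im ≤ ‖(s : ℂ) - u‖ := by
      have := Complex.abs_im_le_norm ((s : ℂ) - u)
      simpa [abs_of_pos hu] using this
    have h2 : |s| ≤ ‖u‖ + ‖(s : ℂ) - u‖ := by
      have := norm_le_norm_add_norm_sub u (s : ℂ)
      simpa [norm_sub_rev] using this
    have h3 : 1 + ‖u‖ ≤ (1 + ‖u‖) / u.im * ‖(s : ℂ) - u‖ := by
      rw [div_mul_eq_mul_div, le_div_iff₀ hu]
      gcongr
    linarith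
  have hbd : ∀ᵐ s : ℝ, ∀ ε ∈ Set.Ioo (0 : ℝ) 1,
      ‖((f (s + ε * Complex.I)).re : ℂ) / (s - u)‖ ≤ K * g s := by
    filter_upwards [hdom] with s hs ε hε
    have h1 := hs ε hε
    have h3 : 0 < 1 + |s| := by positivity
    have h2 : 0 ≤ g s := nonneg_of_mul_nonneg_left ((abs_nonneg _).trans h1) h3
    rw [norm_div, Complex.norm_real, Real.norm_eq_abs, div_le_iff₀ (norm_pos_iff.2 (hsu s))]
    refine h1.trans ?_
    calc g s * (1 + |s|) ≤ g s * (K * ‖(s : ℂ) - u‖) := by gcongr; exact hK s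
      _ = _ := by ring
  have hcont : ∀ ε : ℝ, 0 < ε → Continuous fun s : ℝ => ((f (s + ε * Complex.I)).re : ℂ) / (s - u) := by
    intro ε hε
    have : Continuous fun s : ℝ => f (s + ε * Complex.I) :=
      hf.continuousOn.comp_continuous (by fun_prop) fun s => by simpa using hε
    exact (Complex.continuous_ofReal.comp (Complex.continuous_re.comp this)).div
      (by fun_prop) hsu
  have hev : ∀ᶠ ε : ℝ in 𝓝[>] 0, ε ∈ Set.Ioo (0 : ℝ) 1 := Ioo_mem_nhdsGT one_pos
  have hlim : ∀ᵐ s : ℝ, Tendsto (fun ε : ℝ => ((f (s + ε * Complex.I)).re : ℂ) / (s - u)) (𝓝[>] 0)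
      (𝓝 ((L s : ℂ) / (s - u))) := by
    filter_upwards [hL] with s hs
    exact ((Complex.continuous_ofReal.tendsto _).comp hs).div_const _
  have hmeas : AEStronglyMeasurable (fun s : ℝ => (L s : ℂ) / (s - u)) volume := by
    have hseq : Tendsto (fun n : ℕ => 1 / ((n : ℝ) + 1)) atTop (𝓝[>] 0) :=
      tendsto_nhdsWithin_iff.2 ⟨tendsto_one_div_add_atTop_nhds_zero_nat,
        Eventually.of_forall fun n => Set.mem_Ioi.2 Nat.one_div_pos_of_nat⟩
    refine aestronglyMeasurable_of_tendsto_ae atTop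
      (f := fun (n : ℕ) (s : ℝ) => ((f (s + (1 / ((n : ℝ) + 1) : ℝ) * Complex.I)).re : ℂ) / (s - u))
      (fun n => (hcont _ Nat.one_div_pos_of_nat).aestronglyMeasurable) ?_
    filter_upwards [hlim] with s hs
    exact hs.comp hseq
  have hint : Integrable fun s : ℝ => (L s : ℂ) / (s - u) := by
    refine (hg.const_mul K).mono' hmeas ?_
    filter_upwards [hbd, hlim] with s h1 h2
    exact le_of_tendsto h2.norm (hev.mono h1)
  refine ⟨hint, ?_⟩
  have hDCT : Tendsto (fun ε : ℝ => ∫ s : ℝ, ((f (s + ε * Complex.I)).re : ℂ) / (s - u)) (𝓝[>] 0)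
      (𝓝 (∫ s : ℝ, (L s : ℂ) / (s - u))) := by
    refine tendsto_integral_filter_of_dominated_convergence (fun s => K * g s) ?_ ?_
      (hg.const_mul K) hlim
    · filter_upwards [hev] with ε hε
      exact (hcont ε hε.1).aestronglyMeasurable
    · filter_upwards [hev] with ε hε
      filter_upwards [hbd] with s hs
      exact hs ε hε
  -- For ε > 0 the translate f(· + iε) is holomorphic on the closed half plane, so the previous
  -- formula applies. Dominated convergence then lets ε tend to 0.
  have hval : ∀ᶠ ε : ℝ in 𝓝[>] 0, ∫ s : ℝ, ((f (s + ε * Complex.I)).re : ℂ) / (s - u) =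
      Real.pi * Complex.I * f (u + ε * Complex.I) := by
    filter_upwards [hev] with ε hε
    refine schwarz_of_differentiableOn (f := fun z => f (z + ε * Complex.I)) (R := max R 1)
      (C := |C|) ?_ ?_ hu
    · refine hf.comp (by fun_prop) fun z (hz : 0 ≤ z.im) => ?_
      simpa using add_pos_of_nonneg_of_pos hz hε.1
    · intro z hz hzR
      have h1 : ‖z‖ ≤ ‖z + ε * Complex.I‖ := by
        rw [← abs_of_nonneg (norm_nonneg z), ← abs_of_nonneg (norm_nonneg (z + ε * Complex.I)),
          ← sq_le_sq, ← Complex.normSq_eq_norm_sq, ← Complex.normSq_eq_norm_sq,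
          Complex.normSq_apply, Complex.normSq_apply]
        simp
        nlinarith [hε.1]
      have h2 : 0 < ‖z‖ := by linarith [(le_max_right R 1).trans hzR]
      refine (hb _ (by simpa using add_pos_of_nonneg_of_pos hz hε.1)
        (((le_max_left _ _).trans hzR).trans h1)).trans ?_
      exact mul_le_mul (le_abs_self C) (Real.rpow_le_rpow_of_nonpos h2 h1 (by norm_num))
        (by positivity) (abs_nonneg C)
  have hfu : Tendsto (fun ε : ℝ => Real.pi * Complex.I * f (u + ε * Complex.I)) (𝓝[>] 0)
      (𝓝 (Real.pi * Complex.I * f u)) := by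
    have h1 : ContinuousAt f u := (hf.differentiableAt
      ((isOpen_lt continuous_const Complex.continuous_im).mem_nhds hu)).continuousAt
    have h2 : Tendsto (fun ε : ℝ => u + ε * Complex.I) (𝓝[>] 0) (𝓝 u) := by
      have : Continuous fun ε : ℝ => u + ε * Complex.I := by fun_prop
      exact ((this.tendsto 0).mono_left nhdsWithin_le_nhds).trans_eq (by simp)
    exact (h1.tendsto.comp h2).const_mul _
  exact tendsto_nhds_unique hDCT (hfu.congr' (hval.mono fun ε h => h.symm))

end

/-! ### A nonvanishing function on the upper half plane recovered from its boundary modulus. -/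

noncomputable section

/-- The open upper half plane. -/
def upperHalf : Set ℂ := {z | 0 < z.im}

lemma isOpen_upperHalf : IsOpen upperHalf := isOpen_lt continuous_const Complex.continuous_im

lemma convex_upperHalf : Convex ℝ upperHalf := convex_halfSpace_im_gt 0

lemma tendsto_add_mul_I (s : ℂ) (hs : s.im = 0) :
    Tendsto (fun ε : ℝ => s + ε * Complex.I) (𝓝[>] 0) (𝓝[upperHalf] s) := by
  refine tendsto_nhdsWithin_iff.2 ⟨?_, ?_⟩
  · have : Continuous fun ε : ℝ => s + ε * Complex.I := by fun_prop
    exact ((this.tendsto 0).mono_left nhdsWithin_le_nhds).trans_eq (by simp)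
  · filter_upwards [self_mem_nhdsWithin] with ε hε
    simpa [upperHalf, hs] using hε

/-- A primitive g of β'/β exists because the half plane is convex, β e^{-g} is constant, and the
constant is absorbed into g. -/
lemma exists_exp_eq_of_ne_zero {β : ℂ → ℂ} (hβ : DifferentiableOn ℂ β upperHalf)
    (h0 : ∀ u ∈ upperHalf, β u ≠ 0) :
    ∃ g : ℂ → ℂ, DifferentiableOn ℂ g upperHalf ∧ ∀ u ∈ upperHalf, Complex.exp (g u) = β u := by
  obtain ⟨g, hg⟩ := convex_upperHalf.exists_forall_hasDerivWithinAt
    ((hβ.deriv isOpen_upperHalf).div hβ h0)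
  have hg' : ∀ u ∈ upperHalf, HasDerivAt g (deriv β u / β u) u := fun u hu =>
    (hg u hu).hasDerivAt (isOpen_upperHalf.mem_nhds hu)
  have hβ' : ∀ u ∈ upperHalf, HasDerivAt β (deriv β u) u := fun u hu =>
    (hβ.differentiableAt (isOpen_upperHalf.mem_nhds hu)).hasDerivAt
  have hd : ∀ u ∈ upperHalf, HasDerivAt (fun u => β u * Complex.exp (-g u)) 0 u := fun u hu => by
    refine ((hβ' u hu).mul (hg' u hu).neg.cexp).congr_deriv ?_
    have := h0 u hu
    field_simp
    ring
  have hI : Complex.I ∈ upperHalf := by simp [upperHalf]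
  have hconst : ∀ u ∈ upperHalf, β u * Complex.exp (-g u) = β Complex.I * Complex.exp (-g Complex.I) :=
    fun u hu => isOpen_upperHalf.is_const_of_deriv_eq_zero convex_upperHalf.isPreconnected
      (fun v hv => (hd v hv).differentiableAt.differentiableWithinAt) (fun v hv => (hd v hv).deriv) hu hI
  refine ⟨fun u => g u + Complex.log (β Complex.I * Complex.exp (-g Complex.I)),
    (fun u hu => (hg' u hu).differentiableAt.differentiableWithinAt.add_const _), fun u hu => ?_⟩
  rw [Complex.exp_add, Complex.exp_log (mul_ne_zero (h0 _ hI) (Complex.exp_ne_zero _)),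
    ← hconst u hu, mul_comm, mul_assoc, ← Complex.exp_add]
  simp

/-- An arbitrary logarithm may tend to a multiple of 2πi at infinity. Comparison with the principal
logarithm where β is close to 1 fixes that constant, and subtracting it yields the decay. -/
lemma exists_exp_eq_of_tendsto_one {β : ℂ → ℂ} {C R : ℝ} (hβ : DifferentiableOn ℂ β upperHalf)
    (h0 : ∀ u ∈ upperHalf, β u ≠ 0)
    (hinf : ∀ u ∈ upperHalf, R ≤ ‖u‖ → ‖β u - 1‖ ≤ C * ‖u‖ ^ (-(1 / 2) : ℝ)) :
    ∃ f : ℂ → ℂ, ∃ C R : ℝ, DifferentiableOn ℂ f upperHalf ∧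
      (∀ u ∈ upperHalf, Complex.exp (f u) = β u) ∧
      ∀ u ∈ upperHalf, R ≤ ‖u‖ → ‖f u‖ ≤ C * ‖u‖ ^ (-(1 / 2) : ℝ) := by
  obtain ⟨g, hgd, hg⟩ := exists_exp_eq_of_ne_zero hβ h0
  obtain ⟨T, hT1, hT⟩ : ∃ T : ℝ, 1 ≤ T ∧ ∀ u ∈ upperHalf, T ≤ ‖u‖ →
      ‖β u - 1‖ ≤ C * ‖u‖ ^ (-(1 / 2) : ℝ) ∧ ‖β u - 1‖ ≤ 1 / 2 := by
    have h1 : Tendsto (fun r : ℝ => C * r ^ (-(1 / 2) : ℝ)) atTop (𝓝 0) := by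
      simpa using (tendsto_rpow_neg_atTop (y := 1 / 2) (by norm_num)).const_mul C
    obtain ⟨T, hT⟩ := eventually_atTop.1 (h1.eventually_lt_const (by norm_num : (0 : ℝ) < 1 / 2))
    refine ⟨max (max T R) 1, le_max_right _ _, fun u hu huT => ?_⟩
    have h2 := hinf u hu (((le_max_right _ _).trans (le_max_left _ _)).trans huT)
    exact ⟨h2, h2.trans (hT _ (((le_max_left _ _).trans (le_max_left _ _)).trans huT)).le⟩
  have hslit : ∀ u ∈ upperHalf, T ≤ ‖u‖ → β u ∈ Complex.slitPlane := fun u hu huT => by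
    left
    have h1 := (Complex.abs_re_le_norm (β u - 1)).trans (hT u hu huT).2
    have := (abs_le.1 h1).1
    simp at this
    linarith
  -- A neighbourhood of infinity in the half plane written as three convex overlapping pieces, which
  -- makes its connectedness immediate. It contains every point of modulus at least 3T.
  set U : Set ℂ := ({u | T < u.re} ∩ upperHalf) ∪ {u | T < u.im} ∪ ({u | u.re < -T} ∩ upperHalf)
    with hU
  have hUo : IsOpen U :=
    (((isOpen_lt continuous_const Complex.continuous_re).inter isOpen_upperHalf).union
      (isOpen_lt continuous_const Complex.continuous_im)).union
      ((isOpen_lt Complex.continuous_re continuous_const).inter isOpen_upperHalf)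
  have hUc : IsPreconnected U := by
    refine IsPreconnected.union' ?_ (IsPreconnected.union' ?_ ?_ ?_) ?_
    · refine ⟨⟨-(T + 1), T + 1⟩, Or.inr ?_, ?_, ?_⟩
      · show T < T + 1; linarith
      · show -(T + 1) < -T; linarith
      · show 0 < T + 1; linarith
    · refine ⟨⟨T + 1, T + 1⟩, ⟨?_, ?_⟩, ?_⟩
      · show T < T + 1; linarith
      · show 0 < T + 1; linarith
      · show T < T + 1; linarith
    · exact ((convex_halfSpace_re_gt T).inter convex_upperHalf).isPreconnected
    · exact (convex_halfSpace_im_gt T).isPreconnected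
    · exact ((convex_halfSpace_re_lt (-T)).inter convex_upperHalf).isPreconnected
  have hUsub : ∀ u ∈ U, u ∈ upperHalf ∧ T ≤ ‖u‖ := by
    rintro u ((⟨h1, h2⟩ | h1) | ⟨h1, h2⟩)
    · exact ⟨h2, (le_of_lt h1).trans ((le_abs_self _).trans (Complex.abs_re_le_norm u))⟩
    · refine ⟨?_, (le_of_lt h1).trans ((le_abs_self _).trans (Complex.abs_im_le_norm u))⟩
      have : T < u.im := h1
      show 0 < u.im
      linarith
    · refine ⟨h2, ?_⟩
      have h1 : u.re < -T := h1
      have := (neg_le_abs u.re).trans (Complex.abs_re_le_norm u)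
      linarith
  have hUsup : ∀ u ∈ upperHalf, 3 * T ≤ ‖u‖ → u ∈ U := by
    intro u hu huT
    have h1 := Complex.norm_le_abs_re_add_abs_im u
    by_contra hcon
    simp only [hU, Set.mem_union, Set.mem_inter_iff, Set.mem_ofPred_eq, not_or, not_and_or, not_lt]
      at hcon
    have h2 : u.re ≤ T := hcon.1.1.resolve_right (not_not.2 hu)
    have h3 : -T ≤ u.re := hcon.2.resolve_right (not_not.2 hu)
    have h4 : |u.re| ≤ T := abs_le.2 ⟨h3, h2⟩
    have h5 : |u.im| ≤ T := by
      rw [abs_of_pos hu]; exact hcon.1.2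
    linarith
  have hder : ∀ u ∈ U, HasDerivAt (fun u => g u - Complex.log (β u)) 0 u := by
    intro u huU
    obtain ⟨hu, huT⟩ := hUsub u huU
    have hβ' := (hβ.differentiableAt (isOpen_upperHalf.mem_nhds hu)).hasDerivAt
    have hg' := (hgd.differentiableAt (isOpen_upperHalf.mem_nhds hu)).hasDerivAt
    have h1 : deriv g u = deriv β u / β u := by
      have h2 : HasDerivAt β (Complex.exp (g u) * deriv g u) u :=
        hg'.cexp.congr_of_eventuallyEq (by
          filter_upwards [isOpen_upperHalf.mem_nhds hu] with v hv using (hg v hv).symm)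
      rw [h2.deriv, ← hg u hu]
      field_simp
    refine (hg'.sub (hβ'.clog (hslit u hu huT))).congr_deriv ?_
    rw [h1, sub_self]
  obtain ⟨c, hc⟩ : ∃ c : ℂ, ∀ u ∈ U, g u - Complex.log (β u) = c := by
    have h1 : (⟨0, T + 1⟩ : ℂ) ∈ U := Or.inl (Or.inr (by show T < T + 1; linarith))
    exact ⟨_, fun u hu => hUo.is_const_of_deriv_eq_zero hUc
      (fun v hv => (hder v hv).differentiableAt.differentiableWithinAt)
      (fun v hv => (hder v hv).deriv) hu h1⟩
  have hexp : Complex.exp c = 1 := by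
    have h1 : (⟨0, T + 1⟩ : ℂ) ∈ U := Or.inl (Or.inr (by show T < T + 1; linarith))
    have h2 := (hUsub _ h1).1
    rw [← hc _ h1, Complex.exp_sub, hg _ h2, Complex.exp_log (h0 _ h2), div_self (h0 _ h2)]
  refine ⟨fun u => g u - c, 3 / 2 * C, 3 * T, hgd.sub_const c, fun u hu => ?_, fun u hu huT => ?_⟩
  · rw [Complex.exp_sub, hexp, div_one, hg u hu]
  · have huU := hUsup u hu huT
    have h1 : g u - c = Complex.log (1 + (β u - 1)) := by
      rw [← hc u huU]; ring_nf
    have h2 := hT u hu (hUsub u huU).2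
    simp only [h1]
    refine (Complex.norm_log_one_add_half_le_self h2.2).trans ?_
    linarith [h2.1]

lemma IsCompact.exists_forall_le_of_eventually {X : Type*} [TopologicalSpace X] {K S : Set X}
    (hK : IsCompact K) {F : X → ℝ} (h : ∀ x ∈ K, ∃ M, ∀ᶠ y in 𝓝[S] x, F y ≤ M) :
    ∃ M, ∀ y ∈ K ∩ S, F y ≤ M := by
  refine hK.induction_on (p := fun t => ∃ M, ∀ y ∈ t ∩ S, F y ≤ M) ⟨0, by simp⟩
    (fun s t hst ⟨M, hM⟩ => ⟨M, fun y hy => hM y ⟨hst hy.1, hy.2⟩⟩)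
    (fun s t ⟨M, hM⟩ ⟨M', hM'⟩ => ⟨max M M', ?_⟩) fun x hx => ?_
  · rintro y ⟨hy | hy, hyS⟩
    · exact (hM y ⟨hy, hyS⟩).trans (le_max_left _ _)
    · exact (hM' y ⟨hy, hyS⟩).trans (le_max_right _ _)
  · obtain ⟨M, hM⟩ := h x hx
    obtain ⟨t, ht, htS⟩ := mem_nhdsWithin_iff_exists_mem_nhds_inter.1 hM
    exact ⟨t, mem_nhdsWithin_of_mem_nhds ht, M, fun y hy => htS hy⟩

lemma integrable_indicator_abs_log (R p A : ℝ) (hR : 0 ≤ R) :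
    Integrable ((Set.Icc (-R) R).indicator fun s => A + |Real.log (s - p)|) := by
  rw [integrable_indicator_iff measurableSet_Icc]
  have h1 : IntervalIntegrable (fun s => Real.log (s - p)) volume (-R) R := by
    have := (intervalIntegral.intervalIntegrable_log' (a := -R - p) (b := R - p)).comp_sub_right p
    simpa using this
  have h2 : IntervalIntegrable (fun s => A + |Real.log (s - p)|) volume (-R) R :=
    intervalIntegrable_const.add h1.norm
  rwa [intervalIntegrable_iff_integrableOn_Icc_of_le (by linarith)] at h2

/-- A holomorphic nonvanishing function on the upper half plane that tends to `1` is recovered from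
its modulus on the real line. -/
theorem eq_exp_integral_log {β : ℂ → ℂ} {C R p : ℝ} {N : ℝ → ℝ}
    (hβ : DifferentiableOn ℂ β upperHalf) (h0 : ∀ u ∈ upperHalf, β u ≠ 0)
    (hinf : ∀ u ∈ upperHalf, R ≤ ‖u‖ → ‖β u - 1‖ ≤ C * ‖u‖ ^ (-(1 / 2) : ℝ))
    (hlow : ∀ x : ℝ, ∃ M : ℝ, ∀ᶠ u in 𝓝[upperHalf] (x : ℂ), ‖β u‖⁻¹ ≤ M)
    (hupp : ∀ x : ℝ, ∃ M : ℝ, ∀ᶠ u in 𝓝[upperHalf] (x : ℂ), ‖β u‖ * ‖u - p‖ ≤ M)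
    (hN : ∀ᵐ s : ℝ, N s ≠ 0 ∧
      Tendsto (fun ε : ℝ => ‖β (s + ε * Complex.I)‖) (𝓝[>] 0) (𝓝 (N s)))
    {u : ℂ} (hu : u ∈ upperHalf) :
    Integrable (fun s : ℝ => (Real.log (N s) : ℂ) / (s - u)) ∧
      β u = Complex.exp (1 / (Real.pi * Complex.I) * ∫ s : ℝ, (Real.log (N s) : ℂ) / (s - u)) := by
  obtain ⟨f, C, R, hfd, hf, hfb⟩ := exists_exp_eq_of_tendsto_one hβ h0 hinf
  have hre : ∀ u ∈ upperHalf, (f u).re = Real.log ‖β u‖ := fun u hu => by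
    rw [← hf u hu, Complex.norm_exp, Real.log_exp]
  set T := max R 1 with hT
  have hT1 : 1 ≤ T := le_max_right _ _
  have hcont : ContinuousOn β upperHalf := hβ.continuousOn
  -- bounds on a half disc
  have hloc : ∀ F : ℂ → ℝ, ContinuousOn F upperHalf →
      (∀ x : ℝ, ∃ M : ℝ, ∀ᶠ u in 𝓝[upperHalf] (x : ℂ), F u ≤ M) →
      ∃ M, ∀ u ∈ upperHalf, ‖u‖ ≤ T + 1 → F u ≤ M := by
    intro F hF hFr
    obtain ⟨M, hM⟩ := IsCompact.exists_forall_le_of_eventually (S := upperHalf) (F := F)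
      ((isCompact_closedBall (0 : ℂ) (T + 1)).inter_right
        (isClosed_le continuous_const Complex.continuous_im : IsClosed {z : ℂ | 0 ≤ z.im}))
      (fun x hx => by
        have hx2 : 0 ≤ x.im := hx.2
        rcases hx2.eq_or_lt with h | h
        · have : ((x.re : ℝ) : ℂ) = x := by apply Complex.ext <;> simp [← h]
          rw [← this]
          exact hFr x.re
        · exact ⟨F x + 1, ((hF x h).eventually_lt_const (lt_add_one _)).mono fun _ => le_of_lt⟩)
    exact ⟨M, fun u hu huT => hM u ⟨⟨by simpa using huT, (show 0 < u.im from hu).le⟩, hu⟩⟩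
  obtain ⟨M₁, hM₁⟩ := hloc (fun u => ‖β u‖⁻¹)
    (hcont.norm.inv₀ fun u hu => norm_ne_zero_iff.2 (h0 u hu)) hlow
  obtain ⟨M₂, hM₂⟩ := hloc (fun u => ‖β u‖ * ‖u - p‖) (hcont.norm.mul (by fun_prop)) hupp
  set A := |Real.log M₁| + |Real.log M₂| with hA
  -- The bound on 1/|β| controls log |β| from below. The bound on |β||u - p| controls it from above
  -- up to -log |s - p|, uniformly in ε since |s - p| ≤ |s + iε - p|.
  have hbd : ∀ s ε : ℝ, s ≠ p → ε ∈ Set.Ioo (0 : ℝ) 1 → |s| ≤ T →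
      |(f (s + ε * Complex.I)).re| ≤ A + |Real.log (s - p)| := by
    intro s ε hsp hε hs
    set v : ℂ := s + ε * Complex.I with hv
    have hvu : v ∈ upperHalf := by simpa [upperHalf, hv] using hε.1
    have hvT : ‖v‖ ≤ T + 1 := by
      refine (norm_add_le _ _).trans (add_le_add (by simpa using hs) ?_)
      simpa [abs_of_pos hε.1] using hε.2.le
    have hpos : 0 < ‖β v‖ := norm_pos_iff.2 (h0 v hvu)
    have h1 : -Real.log ‖β v‖ ≤ |Real.log M₁| := by
      rw [← Real.log_inv]
      exact (Real.log_le_log (inv_pos.2 hpos) (hM₁ v hvu hvT)).trans (le_abs_self _)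
    have h2 : |s - p| ≤ ‖v - p‖ := by
      have := Complex.abs_re_le_norm (v - p)
      simpa [hv] using this
    have h3 : 0 < |s - p| := abs_pos.2 (sub_ne_zero.2 hsp)
    have h4 : Real.log ‖β v‖ + Real.log (s - p) ≤ |Real.log M₂| := by
      rw [← Real.log_abs (s - p), ← Real.log_mul hpos.ne' h3.ne']
      refine (Real.log_le_log (by positivity) ?_).trans (le_abs_self _)
      exact (mul_le_mul_of_nonneg_left h2 hpos.le).trans (hM₂ v hvu hvT)
    rw [hre v hvu, abs_le]
    have := neg_abs_le (Real.log (s - p))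
    have := le_abs_self (Real.log (s - p))
    have := abs_nonneg (Real.log M₁)
    have := abs_nonneg (Real.log M₂)
    constructor <;> linarith
  -- On the compact part the majorant has a logarithmic singularity at p. Outside it, the decay
  -- |s|^{-1/2} of f is written as (1 + |s|)^{-3/2} times the factor 1 + |s| allowed by the Schwarz
  -- formula.
  set G : ℝ → ℝ := fun s => (Set.Icc (-T) T).indicator (fun s => A + |Real.log (s - p)|) s +
    |C| * 2 ^ (1 / 2 : ℝ) * (1 + ‖s‖) ^ (-(3 / 2) : ℝ) with hG
  have hGi : Integrable G := (integrable_indicator_abs_log T p A (by linarith)).add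
    ((integrable_one_add_norm (by simp; norm_num)).const_mul _)
  have hdom : ∀ᵐ s : ℝ, ∀ ε ∈ Set.Ioo (0 : ℝ) 1, |(f (s + ε * Complex.I)).re| ≤ G s * (1 + |s|) := by
    filter_upwards [(Set.finite_singleton p).countable.ae_notMem volume] with s hsp ε hε
    have h1 : 0 ≤ (Set.Icc (-T) T).indicator (fun s => A + |Real.log (s - p)|) s :=
      Set.indicator_nonneg (fun _ _ => by positivity) _
    have h2 : 0 ≤ |C| * 2 ^ (1 / 2 : ℝ) * (1 + ‖s‖) ^ (-(3 / 2) : ℝ) := by positivity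
    have habs := abs_nonneg s
    by_cases hs : |s| ≤ T
    · refine (hbd s ε hsp hε hs).trans ?_
      have h3 : A + |Real.log (s - p)| ≤ G s := by
        simp only [hG]
        rw [Set.indicator_of_mem (Set.mem_Icc.2 (abs_le.1 hs))]
        linarith
      exact h3.trans (le_mul_of_one_le_right (by simp only [hG]; positivity) (by linarith))
    · push Not at hs
      set v : ℂ := s + ε * Complex.I with hv
      have hvu : v ∈ upperHalf := by simpa [upperHalf, hv] using hε.1
      have hsv : |s| ≤ ‖v‖ := by
        have := Complex.abs_re_le_norm v
        simpa [hv] using this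
      have h3 := (Complex.abs_re_le_norm _).trans
        (hfb v hvu ((le_max_left R 1).trans (hs.le.trans hsv)))
      have h4 : ‖v‖ ^ (-(1 / 2) : ℝ) ≤ |s| ^ (-(1 / 2) : ℝ) :=
        Real.rpow_le_rpow_of_nonpos (by linarith) hsv (by norm_num)
      have h5 : (2 * |s|) ^ (-(1 / 2) : ℝ) ≤ (1 + |s|) ^ (-(1 / 2) : ℝ) :=
        Real.rpow_le_rpow_of_nonpos (by positivity) (by linarith) (by norm_num)
      rw [Real.mul_rpow (by norm_num) (by positivity)] at h5
      have h6 : |s| ^ (-(1 / 2) : ℝ) ≤ 2 ^ (1 / 2 : ℝ) * (1 + |s|) ^ (-(1 / 2) : ℝ) := by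
        calc |s| ^ (-(1 / 2) : ℝ)
            = 2 ^ (1 / 2 : ℝ) * (2 ^ (-(1 / 2) : ℝ) * |s| ^ (-(1 / 2) : ℝ)) := by
              rw [← mul_assoc, ← Real.rpow_add (by norm_num)]; norm_num
          _ ≤ _ := by gcongr
      calc |(f v).re| ≤ C * ‖v‖ ^ (-(1 / 2) : ℝ) := h3
        _ ≤ |C| * (2 ^ (1 / 2 : ℝ) * (1 + |s|) ^ (-(1 / 2) : ℝ)) :=
          mul_le_mul (le_abs_self C) (h4.trans h6) (by positivity) (abs_nonneg C)
        _ = |C| * 2 ^ (1 / 2 : ℝ) * (1 + ‖s‖) ^ (-(3 / 2) : ℝ) * (1 + |s|) := by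
          have : (1 + |s|) ^ (-(1 / 2) : ℝ) = (1 + |s|) ^ (-(3 / 2) : ℝ) * (1 + |s|) := by
            rw [← Real.rpow_add_one (by positivity)]; norm_num
          rw [this, Real.norm_eq_abs]; ring
        _ ≤ _ := by
          simp only [hG]
          gcongr
          linarith
  have hL : ∀ᵐ s : ℝ, Tendsto (fun ε : ℝ => (f (s + ε * Complex.I)).re) (𝓝[>] 0)
      (𝓝 (Real.log (N s))) := by
    filter_upwards [hN] with s hs
    refine ((Real.continuousAt_log hs.1).tendsto.comp hs.2).congr' ?_
    filter_upwards [self_mem_nhdsWithin] with ε hε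
    exact (hre _ (by simpa [upperHalf] using hε)).symm
  obtain ⟨h1, h2⟩ := schwarz_half_plane (L := fun s => Real.log (N s)) hfd hfb hdom hGi hL hu
  refine ⟨h1, ?_⟩
  rw [h2, ← hf u hu]
  congr 1
  have := Complex.I_ne_zero
  have : (Real.pi : ℂ) ≠ 0 := by exact_mod_cast Real.pi_ne_zero
  field_simp

end

/-! ### Removal of double zeros by a Blaschke product. -/

noncomputable section

lemma isBigO_mul_sub_one {l : Filter ℂ} {φ : ℂ → ℝ} {F G : ℂ → ℂ} (hφ : φ =O[l] fun _ => (1 : ℝ))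
    (hF : (fun u => F u - 1) =O[l] φ) (hG : (fun u => G u - 1) =O[l] φ) :
    (fun u => F u * G u - 1) =O[l] φ := by
  have h1 : G =O[l] fun _ => (1 : ℝ) := by
    have := (hG.trans hφ).add (Asymptotics.isBigO_const_const (1 : ℂ) one_ne_zero l)
    simpa using this
  have h2 := (hF.mul h1).add (by simpa using hG : (fun u => G u - 1) =O[l] fun u => φ u * 1)
  simp only [mul_one] at h2
  refine h2.congr_left fun u => ?_
  ring

lemma isBigO_prod_sub_one {ι : Type*} {l : Filter ℂ} {φ : ℂ → ℝ} {F : ι → ℂ → ℂ} (s : Finset ι)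
    (hφ : φ =O[l] fun _ => (1 : ℝ)) (hF : ∀ i, (fun u => F i u - 1) =O[l] φ) :
    (fun u => ∏ i ∈ s, F i u - 1) =O[l] φ := by
  classical
  induction s using Finset.induction_on with
  | empty => simpa using Asymptotics.isBigO_zero _ _
  | insert i s hi ih =>
    simp only [Finset.prod_insert hi]
    exact isBigO_mul_sub_one hφ (hF i) ih

/-- Recovery of a function on the upper half plane from its double zeros and its modulus on the
real line. -/
theorem eq_prod_mul_exp_integral_log {ι : Type*} [Fintype ι] {σ : ℂ → ℂ} {a : ι → ℂ} {C R p : ℝ}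
    {N : ℝ → ℝ} (hσ : DifferentiableOn ℂ σ upperHalf) (ha : ∀ i, a i ∈ upperHalf)
    (hinj : Function.Injective a) (hzero : ∀ u ∈ upperHalf, σ u = 0 ↔ ∃ i, a i = u)
    (hdouble : ∀ i, ∃ c, c ≠ 0 ∧ Tendsto (fun u => σ u / (u - a i) ^ 2) (𝓝[≠] (a i)) (𝓝 c))
    (hinf : ∀ u ∈ upperHalf, R ≤ ‖u‖ → ‖σ u - 1‖ ≤ C * ‖u‖ ^ (-(1 / 2) : ℝ))
    (hlow : ∀ x : ℝ, ∃ M : ℝ, ∀ᶠ u in 𝓝[upperHalf] (x : ℂ), ‖σ u‖⁻¹ ≤ M)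
    (hupp : ∀ x : ℝ, ∃ M : ℝ, ∀ᶠ u in 𝓝[upperHalf] (x : ℂ), ‖σ u‖ * ‖u - p‖ ≤ M)
    (hN : ∀ᵐ s : ℝ, N s ≠ 0 ∧
      Tendsto (fun ε : ℝ => ‖σ (s + ε * Complex.I)‖) (𝓝[>] 0) (𝓝 (N s)))
    {u : ℂ} (hu : u ∈ upperHalf) :
    Integrable (fun s : ℝ => (Real.log (N s) : ℂ) / (s - u)) ∧
      σ u = (∏ i, ((u - a i) / (u - star (a i))) ^ 2) *
        Complex.exp (1 / (Real.pi * Complex.I) * ∫ s : ℝ, (Real.log (N s) : ℂ) / (s - u)) := by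
  classical
  have ha' : ∀ (z : ℂ), 0 ≤ z.im → ∀ i, z - star (a i) ≠ 0 := fun z hz i h => by
    have := congrArg Complex.im h
    have h2 : 0 < (a i).im := ha i
    simp at this; linarith
  have has : ∀ (x : ℝ) i, (x : ℂ) ≠ a i := fun x i h => by
    have := congrArg Complex.im h
    have h2 : 0 < (a i).im := ha i
    simp at this; linarith
  -- The inverse Blaschke product: unimodular on the real line, tending to 1 at infinity, with
  -- double poles at the zeros of σ.
  set B : ℂ → ℂ := fun u => ∏ i, ((u - star (a i)) / (u - a i)) ^ 2 with hB
  have hne : ∀ (s : Finset ι) (v : ℂ), (∀ i ∈ s, v ≠ a i) → ∀ᶠ w in 𝓝 v, ∀ i ∈ s, w ≠ a i :=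
    fun s v hv => (s.eventually_all).2 fun i hi => eventually_ne_nhds (hv i hi)
  have hfd : ∀ (s : Finset ι) (v : ℂ), (∀ i ∈ s, v ≠ a i) →
      DifferentiableAt ℂ (fun u => ∏ i ∈ s, ((u - star (a i)) / (u - a i)) ^ 2) v := fun s v hv => by
    refine DifferentiableAt.fun_finsetProd fun i hi => ?_
    have := sub_ne_zero.2 (hv i hi)
    fun_prop (disch := assumption)
  have hfne : ∀ (s : Finset ι) (v : ℂ), 0 ≤ v.im → (∀ i ∈ s, v ≠ a i) →
      ∏ i ∈ s, ((v - star (a i)) / (v - a i)) ^ 2 ≠ 0 := fun s v hv0 hv =>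
    Finset.prod_ne_zero_iff.2 fun i hi =>
      pow_ne_zero 2 (div_ne_zero (ha' v hv0 i) (sub_ne_zero.2 (hv i hi)))
  have hlim : ∀ v ∈ upperHalf, ∃ c, c ≠ 0 ∧ Tendsto (fun w => σ w * B w) (𝓝[≠] v) (𝓝 c) ∧
      ((∀ i, v ≠ a i) → c = σ v * B v) := by
    intro v hv
    by_cases hva : ∃ i, a i = v
    · obtain ⟨i, rfl⟩ := hva
      obtain ⟨c, hc, hct⟩ := hdouble i
      set D : ℂ → ℂ := fun w => (w - star (a i)) ^ 2 *
        ∏ j ∈ Finset.univ.erase i, ((w - star (a j)) / (w - a j)) ^ 2 with hD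
      have hav : ∀ j ∈ Finset.univ.erase i, a i ≠ a j := fun j hj h =>
        (Finset.ne_of_mem_erase hj) (hinj h).symm
      have hDc : ContinuousAt D (a i) :=
        ContinuousAt.mul (by fun_prop) (hfd _ _ hav).continuousAt
      refine ⟨c * D (a i), mul_ne_zero hc (mul_ne_zero (pow_ne_zero 2 (ha' _ (le_of_lt hv) i))
        (hfne _ _ (le_of_lt hv) hav)), ?_, fun h => absurd rfl (h i)⟩
      refine (hct.mul (hDc.tendsto.mono_left nhdsWithin_le_nhds)).congr' ?_
      filter_upwards [self_mem_nhdsWithin] with w hw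
      have hw' : w - a i ≠ 0 := sub_ne_zero.2 hw
      simp only [hB, hD]
      rw [← Finset.mul_prod_erase Finset.univ _ (Finset.mem_univ i), div_pow]
      field_simp
    · push Not at hva
      have h1 : ∀ i, v ≠ a i := fun i => (hva i).symm
      refine ⟨σ v * B v, mul_ne_zero (fun h => ?_) (hfne _ _ (le_of_lt hv) fun i _ => h1 i), ?_,
        fun _ => rfl⟩
      · obtain ⟨i, hi⟩ := (hzero v hv).1 h
        exact hva i hi
      · have h2 : ContinuousAt (fun w => σ w * B w) v :=
          (hσ.differentiableAt (isOpen_upperHalf.mem_nhds hv)).continuousAt.mul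
            (hfd _ _ fun i _ => h1 i).continuousAt
        exact h2.tendsto.mono_left nhdsWithin_le_nhds
  -- The singularities of σB at the points a_i are removable. The punctured limit defines the
  -- extension at every point by one formula.
  set β : ℂ → ℂ := fun v => limUnder (𝓝[≠] v) fun w => σ w * B w with hβ
  have hβlim : ∀ v ∈ upperHalf, Tendsto (fun w => σ w * B w) (𝓝[≠] v) (𝓝 (β v)) ∧ β v ≠ 0 := by
    intro v hv
    obtain ⟨c, hc, hct, -⟩ := hlim v hv
    simp only [hβ]
    rw [hct.limUnder_eq]
    exact ⟨hct, hc⟩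
  have hβeq : ∀ v ∈ upperHalf, (∀ i, v ≠ a i) → β v = σ v * B v := by
    intro v hv hva
    obtain ⟨c, hc, hct, h⟩ := hlim v hv
    simp only [hβ]
    rw [hct.limUnder_eq, h hva]
  have hβd : DifferentiableOn ℂ β upperHalf := by
    intro v hv
    have h1 : ∀ᶠ w in 𝓝[≠] v, w ∈ upperHalf ∧ ∀ i, w ≠ a i := by
      refine Filter.Eventually.and (nhdsWithin_le_nhds (isOpen_upperHalf.mem_nhds hv)) ?_
      rw [eventually_all]
      intro i
      by_cases h : v = a i
      · rw [← h]; exact self_mem_nhdsWithin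
      · exact nhdsWithin_le_nhds (eventually_ne_nhds h)
    have h2 : ∀ᶠ w in 𝓝[≠] v, β w = σ w * B w := h1.mono fun w hw => hβeq w hw.1 hw.2
    have h3 : ContinuousAt β v := by
      rw [continuousAt_iff_punctured_nhds]
      exact (hβlim v hv).1.congr' (h2.mono fun w hw => hw.symm)
    refine (Complex.analyticAt_of_differentiable_on_punctured_nhds_of_continuousAt ?_
      h3).differentiableAt.differentiableWithinAt
    filter_upwards [h1] with w hw
    have h4 : DifferentiableAt ℂ (fun w => σ w * B w) w :=
      (hσ.differentiableAt (isOpen_upperHalf.mem_nhds hw.1)).mul (hfd _ _ fun i _ => hw.2 i)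
    refine h4.congr_of_eventuallyEq ?_
    filter_upwards [isOpen_upperHalf.mem_nhds hw.1,
      hne Finset.univ w fun i _ => hw.2 i] with y hy hya
    exact hβeq y hy fun i => hya i (Finset.mem_univ i)
  -- behaviour at infinity
  obtain ⟨C', R', hβinf⟩ : ∃ C' R' : ℝ, ∀ v ∈ upperHalf, R' ≤ ‖v‖ →
      ‖β v - 1‖ ≤ C' * ‖v‖ ^ (-(1 / 2) : ℝ) := by
    set l : Filter ℂ := comap norm atTop ⊓ 𝓟 upperHalf with hl
    have hge : ∀ r : ℝ, ∀ᶠ v in l, r ≤ ‖v‖ := fun r =>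
      mem_inf_of_left (tendsto_comap.eventually_ge_atTop r)
    have hup : ∀ᶠ v in l, v ∈ upperHalf := mem_inf_of_right (mem_principal_self _)
    have hφ : (fun v : ℂ => ‖v‖ ^ (-(1 / 2) : ℝ)) =O[l] fun _ => (1 : ℝ) := by
      refine Asymptotics.IsBigO.of_bound 1 ?_
      filter_upwards [hge 1] with v hv
      rw [Real.norm_of_nonneg (by positivity), norm_one, mul_one]
      exact Real.rpow_le_one_of_one_le_of_nonpos hv (by norm_num)
    have h1 : (fun v => σ v - 1) =O[l] fun v : ℂ => ‖v‖ ^ (-(1 / 2) : ℝ) := by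
      refine Asymptotics.IsBigO.of_bound C ?_
      filter_upwards [hge R, hup] with v hv hvu
      rw [Real.norm_of_nonneg (by positivity)]
      exact hinf v hvu hv
    have h2 : ∀ i, (fun v => (v - star (a i)) / (v - a i) - 1) =O[l]
        fun v : ℂ => ‖v‖ ^ (-(1 / 2) : ℝ) := by
      intro i
      refine Asymptotics.IsBigO.of_bound (2 * ‖a i - star (a i)‖) ?_
      filter_upwards [hge (max 1 (2 * ‖a i‖))] with v hv
      have h3 : 1 ≤ ‖v‖ := (le_max_left _ _).trans hv
      have h4 := norm_sub_ge_half ((le_max_right _ _).trans hv)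
      have h5 : v - a i ≠ 0 := norm_pos_iff.1 (by linarith)
      have h6 : (v - star (a i)) / (v - a i) - 1 = (a i - star (a i)) / (v - a i) := by
        field_simp; ring
      have h7 : ‖v‖⁻¹ ≤ ‖v‖ ^ (-(1 / 2) : ℝ) := by
        rw [← Real.rpow_neg_one]
        exact Real.rpow_le_rpow_of_exponent_le h3 (by norm_num)
      rw [Real.norm_of_nonneg (by positivity), h6, norm_div]
      calc ‖a i - star (a i)‖ / ‖v - a i‖ ≤ ‖a i - star (a i)‖ / (‖v‖ / 2) := by gcongr
        _ = 2 * ‖a i - star (a i)‖ * ‖v‖⁻¹ := by field_simp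
        _ ≤ _ := by gcongr
    have h3 : (fun v => B v - 1) =O[l] fun v : ℂ => ‖v‖ ^ (-(1 / 2) : ℝ) := by
      refine isBigO_prod_sub_one Finset.univ hφ fun i => ?_
      simp only [pow_two]
      exact isBigO_mul_sub_one hφ (h2 i) (h2 i)
    have h4 := isBigO_mul_sub_one hφ h1 h3
    have h5 : (fun v => β v - 1) =O[l] fun v : ℂ => ‖v‖ ^ (-(1 / 2) : ℝ) := by
      refine h4.congr' ?_ EventuallyEq.rfl
      have h6 : ∀ᶠ v in l, ∀ i, ‖a i‖ + 1 ≤ ‖v‖ := eventually_all.2 fun i => hge _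
      filter_upwards [hup, h6] with v hv hva
      rw [hβeq v hv fun i h => ?_]
      have := hva i
      rw [h] at this
      linarith
    obtain ⟨C', hC'⟩ := h5.bound
    rw [hl, eventually_inf_principal, eventually_comap, eventually_atTop] at hC'
    obtain ⟨R', hR'⟩ := hC'
    refine ⟨C', R', fun v hv hvR => ?_⟩
    have := hR' _ hvR v rfl hv
    rwa [Real.norm_of_nonneg (by positivity)] at this
  -- behaviour at the real line
  have hBs : ∀ x : ℝ, ‖B x‖ = 1 := fun x => by
    simp only [hB, norm_prod, norm_pow, norm_div]
    refine Finset.prod_eq_one fun i _ => ?_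
    have h1 : (x : ℂ) - star (a i) = star ((x : ℂ) - a i) := by simp
    rw [h1, norm_star, div_self (norm_ne_zero_iff.2 (sub_ne_zero.2 (has x i))), one_pow]
  have hBc : ∀ x : ℝ, Tendsto (fun v => ‖B v‖) (𝓝 (x : ℂ)) (𝓝 1) := fun x => by
    rw [← hBs x]
    exact (hfd _ _ fun i _ => has x i).continuousAt.norm
  have hβx : ∀ x : ℝ, ∀ᶠ v in 𝓝[upperHalf] (x : ℂ), ‖β v‖ = ‖σ v‖ * ‖B v‖ := fun x => by
    filter_upwards [self_mem_nhdsWithin,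
      nhdsWithin_le_nhds (hne Finset.univ x fun i _ => has x i)] with v hv hva
    rw [hβeq v hv fun i => hva i (Finset.mem_univ i), norm_mul]
  obtain ⟨h1, h2⟩ := eq_exp_integral_log (p := p) (N := N) hβd (fun v hv => (hβlim v hv).2) hβinf
    (fun x => by
      obtain ⟨M, hM⟩ := hlow x
      refine ⟨M * 2, ?_⟩
      filter_upwards [hM, hβx x, nhdsWithin_le_nhds
        ((hBc x).eventually_const_lt (by norm_num : (1 / 2 : ℝ) < 1))] with v h1 h2 h3
      rw [h2, mul_inv]
      refine mul_le_mul h1 ?_ (by positivity) ((by positivity : 0 ≤ ‖σ v‖⁻¹).trans h1)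
      rw [inv_le_comm₀ (by linarith) (by norm_num)]
      linarith)
    (fun x => by
      obtain ⟨M, hM⟩ := hupp x
      refine ⟨M * 2, ?_⟩
      filter_upwards [hM, hβx x, nhdsWithin_le_nhds
        ((hBc x).eventually_lt_const (by norm_num : (1 : ℝ) < 2))] with v h1 h2 h3
      rw [h2, mul_right_comm]
      exact mul_le_mul h1 h3.le (by positivity) ((by positivity : 0 ≤ ‖σ v‖ * ‖v - p‖).trans h1))
    (by
      filter_upwards [hN] with s hs
      refine ⟨hs.1, ?_⟩
      have h3 := tendsto_add_mul_I (s : ℂ) (Complex.ofReal_im s)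
      have h4 := hs.2.mul (((hBc s).mono_left nhdsWithin_le_nhds).comp h3)
      rw [mul_one] at h4
      exact h4.congr' ((h3.eventually (hβx s)).mono fun ε h => h.symm)) hu
  refine ⟨h1, ?_⟩
  rw [← h2]
  by_cases hua : ∃ i, a i = u
  · rw [(hzero u hu).2 hua]
    obtain ⟨i, rfl⟩ := hua
    rw [Finset.prod_eq_zero (Finset.mem_univ i) (by simp), zero_mul]
  · push Not at hua
    rw [hβeq u hu fun i => (hua i).symm, mul_comm, mul_assoc, hB, ← Finset.prod_mul_distrib,
      Finset.prod_eq_one fun i _ => ?_, mul_one]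
    have h3 := ha' u (le_of_lt hu) i
    have h4 := sub_ne_zero.2 (hua i).symm
    field_simp

end

/-! ### The square root on the upper half plane and the zeros of s₁₁ in the first quadrant. -/

noncomputable section

variable {q : ℝ → ℝ → ℂ} {q0 : ℝ} {qp qm : ℂ} {t : ℝ}

/-- The open first quadrant. -/
def quadrant : Set ℂ := {z | 0 < z.re ∧ 0 < z.im}

lemma quadrant_subset_Dplus : quadrant ⊆ Dplus := fun _ hz => mul_pos hz.1 hz.2

lemma isOpen_quadrant : IsOpen quadrant :=
  (isOpen_lt continuous_const Complex.continuous_re).inter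
    (isOpen_lt continuous_const Complex.continuous_im)

lemma quadrant_subset_admissible : quadrant ⊆ admissible q0 :=
  quadrant_subset_Dplus.trans Dplus_subset_admissible

lemma sq_mem_upperHalf {z : ℂ} (hz : z ∈ quadrant) : z ^ 2 ∈ upperHalf := by
  have := mul_pos hz.1 hz.2
  simp only [upperHalf, Set.mem_ofPred_eq, pow_two, Complex.mul_im]
  linarith

/-- The branch `exp (log u / 2)` of the square root. -/
def csqrt (u : ℂ) : ℂ := Complex.exp (Complex.log u / 2)

lemma csqrt_sq {u : ℂ} (hu : u ≠ 0) : csqrt u ^ 2 = u := by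
  rw [csqrt, ← Complex.exp_nat_mul]
  push_cast
  rw [mul_div_cancel₀ _ two_ne_zero, Complex.exp_log hu]

lemma norm_csqrt {u : ℂ} (hu : u ≠ 0) : ‖csqrt u‖ = ‖u‖ ^ (1 / 2 : ℝ) := by
  have h1 : ‖csqrt u‖ ^ 2 = ‖u‖ := by rw [← norm_pow, csqrt_sq hu]
  rw [← h1, ← Real.sqrt_eq_rpow, Real.sqrt_sq (norm_nonneg _)]

lemma ne_zero_of_mem_upperHalf {u : ℂ} (hu : u ∈ upperHalf) : u ≠ 0 := by
  rintro rfl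
  simp [upperHalf] at hu

lemma csqrt_mem_quadrant {u : ℂ} (hu : u ∈ upperHalf) : csqrt u ∈ quadrant := by
  have h1 : 0 < u.im := hu
  have h2 : 0 ≤ u.arg := Complex.arg_nonneg_iff.2 h1.le
  have h3 : u.arg ≠ 0 := fun h => h1.ne' (Complex.arg_eq_zero_iff.1 h).2
  have h4 : 0 < u.arg := lt_of_le_of_ne h2 h3.symm
  have h5 := Complex.arg_le_pi u
  have h6 : u.arg ≠ Real.pi := fun h => h1.ne' (Complex.arg_eq_pi_iff.1 h).2
  have h7 : u.arg < Real.pi := lt_of_le_of_ne h5 h6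
  have e1 : (Complex.log u / 2).im = u.arg / 2 := by
    rw [Complex.div_ofNat_im, Complex.log_im]
  refine ⟨?_, ?_⟩
  · rw [csqrt, Complex.exp_re, e1]
    exact mul_pos (Real.exp_pos _) (Real.cos_pos_of_mem_Ioo ⟨by linarith, by linarith⟩)
  · rw [csqrt, Complex.exp_im, e1]
    exact mul_pos (Real.exp_pos _) (Real.sin_pos_of_pos_of_lt_pi (by linarith) (by linarith))

lemma csqrt_of_sq {z : ℂ} (hz : z ∈ quadrant) : csqrt (z ^ 2) = z := by
  have h1 := csqrt_mem_quadrant (sq_mem_upperHalf hz)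
  have h2 := csqrt_sq (ne_zero_of_mem_upperHalf (sq_mem_upperHalf hz))
  rcases sq_eq_sq_iff_eq_or_eq_neg.1 h2 with h | h
  · exact h
  · exfalso
    have h3 := h1.1
    rw [h, Complex.neg_re] at h3
    have := hz.1
    linarith

lemma csqrt_ofReal_sq {r : ℝ} (hr : 0 < r) : csqrt ((r : ℂ) ^ 2) = r := by
  have h1 : Complex.log ((r : ℂ) ^ 2) = 2 * (Real.log r : ℂ) := by
    rw [← Complex.ofReal_pow, ← Complex.ofReal_log (by positivity), Real.log_pow]
    push_cast; ring
  rw [csqrt, h1, mul_div_cancel_left₀ _ two_ne_zero, ← Complex.ofReal_exp, Real.exp_log hr]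

/-- The principal argument of a negative number is π, so the negative half-line is sent to the
positive imaginary axis. -/
lemma csqrt_neg_ofReal_sq {r : ℝ} (hr : 0 < r) : csqrt (-(r : ℂ) ^ 2) = Complex.I * r := by
  have h1 : Complex.log (-(r : ℂ) ^ 2) = 2 * (Real.log r : ℂ) + Real.pi * Complex.I := by
    have h2 : -(r : ℂ) ^ 2 = ((-(r ^ 2) : ℝ) : ℂ) := by push_cast; ring
    have h3 : 0 < r ^ 2 := by positivity
    rw [Complex.log, h2, Complex.arg_ofReal_of_neg (by linarith), Complex.norm_real, norm_neg,
      Real.norm_of_nonneg h3.le, Real.log_pow]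
    push_cast; ring
  rw [csqrt, h1, add_div, mul_div_cancel_left₀ _ two_ne_zero, Complex.exp_add,
    ← Complex.ofReal_exp, Real.exp_log hr, mul_comm]
  congr 1
  rw [mul_div_right_comm, Complex.exp_pi_div_two_mul_I]

lemma csqrt_mem_contour {s : ℝ} (hs : s ≠ 0) : csqrt s ∈ contour := by
  refine ⟨?_, Complex.exp_ne_zero _⟩
  rcases hs.lt_or_gt with h | h
  · right
    have : (s : ℂ) = -((√(-s) : ℝ) : ℂ) ^ 2 := by
      rw [← Complex.ofReal_pow, Real.sq_sqrt (by linarith)]; push_cast; ring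
    rw [this, csqrt_neg_ofReal_sq (Real.sqrt_pos.2 (by linarith))]
    simp
  · left
    have : (s : ℂ) = ((√s : ℝ) : ℂ) ^ 2 := by
      rw [← Complex.ofReal_pow, Real.sq_sqrt h.le]
    rw [this, csqrt_ofReal_sq (Real.sqrt_pos.2 h)]
    simp

lemma csqrt_notMem_branchPts {s : ℝ} (hs : s ≠ 0) (hs' : s ≠ -q0 ^ 2) :
    csqrt s ∉ branchPts q0 := by
  intro h
  apply hs'
  have h1 := csqrt_sq (u := (s : ℂ)) (by exact_mod_cast hs)
  have h2 : csqrt s ^ 2 = ((-q0 ^ 2 : ℝ) : ℂ) := by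
    rcases h with h | h
    · rw [h, mul_pow, Complex.I_sq]; push_cast; ring
    · rw [Set.mem_singleton_iff.1 h, neg_sq, mul_pow, Complex.I_sq]; push_cast; ring
  rw [h1] at h2
  exact_mod_cast h2

lemma differentiableOn_csqrt : DifferentiableOn ℂ csqrt upperHalf := fun u hu => by
  have h1 : u ∈ Complex.slitPlane := Or.inr (show 0 < u.im from hu).ne'
  exact ((Complex.differentiableAt_log h1).div_const 2).cexp.differentiableWithinAt

/-- On the cut the value with argument π is the limit from above, so the principal branch gives the
boundary values needed here also at negative s. -/
lemma tendsto_csqrt {s : ℝ} (hs : s ≠ 0) :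
    Tendsto csqrt (𝓝[upperHalf] (s : ℂ)) (𝓝[quadrant] (csqrt s)) := by
  refine tendsto_nhdsWithin_iff.2 ⟨?_, ?_⟩
  · have h1 : Tendsto Complex.log (𝓝[upperHalf] (s : ℂ)) (𝓝 (Complex.log s)) := by
      rcases hs.lt_or_gt with h | h
      · have h2 : ContinuousWithinAt Complex.log {z : ℂ | 0 ≤ z.im} (s : ℂ) :=
          Complex.continuousWithinAt_log_of_re_neg_of_im_zero (by simpa using h) (by simp)
        exact h2.mono fun z hz => (show 0 < z.im from hz).le
      · exact (continuousAt_clog (Or.inl (by simpa using h))).tendsto.mono_left nhdsWithin_le_nhds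
    exact (Complex.continuous_exp.tendsto _).comp (h1.div_const 2)
  · filter_upwards [self_mem_nhdsWithin] with u hu using csqrt_mem_quadrant hu

lemma circleInv_mem_quadrant (hq0 : 0 < q0) {z : ℂ} (hz : z ∈ quadrant) :
    circleInv q0 z ∈ quadrant := by
  have h1 : 0 < Complex.normSq z := Complex.normSq_pos.2 (by rintro rfl; simpa using hz.1)
  rw [circleInv_eq_mul q0 (by rintro rfl; simpa using hz.1)]
  refine ⟨?_, ?_⟩
  · rw [Complex.re_ofReal_mul]; have := hz.1; positivity
  · rw [Complex.im_ofReal_mul]; have := hz.2; positivity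

lemma norm_circleInv (q0 : ℝ) (z : ℂ) : ‖circleInv q0 z‖ = q0 ^ 2 / ‖z‖ := by
  simp [circleInv]

lemma circleInv_circleInv (hq0 : 0 < q0) {z : ℂ} (hz : z ≠ 0) :
    circleInv q0 (circleInv q0 z) = z := by
  have h0 : (q0 : ℂ) ≠ 0 := by exact_mod_cast hq0.ne'
  have : (starRingEnd ℂ) z ≠ 0 := by simpa using hz
  simp [circleInv]
  field_simp

/-- All zeros of `s₁₁` in the first quadrant. -/
def quadrantZeros (q0 : ℝ) {N₁ N₂ : ℕ} (z : Fin N₁ → ℂ) (w : Fin N₂ → ℂ) :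
    (Fin N₁ ⊕ Fin N₁) ⊕ Fin N₂ → ℂ :=
  Sum.elim (Sum.elim z fun n => circleInv q0 (z n)) w

section Zeros

variable {N₁ N₂ : ℕ} {z : Fin N₁ → ℂ} {w : Fin N₂ → ℂ}

lemma DoubleZerosIn.mem {f : ℂ → ℂ} {U : Set ℂ} {N : ℕ} {z : Fin N → ℂ} (h : DoubleZerosIn f U z)
    (n : Fin N) : z n ∈ U ∧ f (z n) = 0 :=
  (h.2.1 _).2 ⟨n, rfl⟩

lemma NZBC.quadrantZeros_mem (h : NZBC q q0 qp qm t)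
    (hz : DoubleZerosIn (s11 q q0 qp qm t) (outerQuadrant q0) z)
    (hw : DoubleZerosIn (s11 q q0 qp qm t) (quarterArc q0) w) (i) :
    quadrantZeros q0 z w i ∈ quadrant := by
  rcases i with (n | n) | m
  · exact ⟨(hz.mem n).1.1, (hz.mem n).1.2.1⟩
  · exact circleInv_mem_quadrant h.pos ⟨(hz.mem n).1.1, (hz.mem n).1.2.1⟩
  · exact ⟨(hw.mem m).1.1, (hw.mem m).1.2.1⟩

/-- The three families have moduli greater than, less than and equal to q₀, hence are disjoint. -/
lemma NZBC.quadrantZeros_injective (h : NZBC q q0 qp qm t)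
    (hz : DoubleZerosIn (s11 q q0 qp qm t) (outerQuadrant q0) z)
    (hw : DoubleZerosIn (s11 q q0 qp qm t) (quarterArc q0) w) :
    Function.Injective (quadrantZeros q0 z w) := by
  have hq0 := h.pos
  have h1 : ∀ n, q0 < ‖z n‖ := fun n => (hz.mem n).1.2.2
  have h2 : ∀ n, ‖circleInv q0 (z n)‖ < q0 := fun n => by
    have := h1 n
    rw [norm_circleInv, div_lt_iff₀ (by linarith)]
    nlinarith
  have h3 : ∀ m, ‖w m‖ = q0 := fun m => (hw.mem m).1.2.2
  have h4 : ∀ n, z n ≠ 0 := fun n h0 => by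
    have := h1 n
    rw [h0, norm_zero] at this
    linarith
  refine Function.Injective.sumElim (Function.Injective.sumElim hz.1 ?_ ?_) hw.1 ?_
  · intro n m hnm
    have := congrArg (circleInv q0) hnm
    simp only [circleInv_circleInv hq0 (h4 _)] at this
    exact hz.1 this
  · intro n m hnm
    have := h1 n
    rw [hnm] at this
    linarith [h2 m]
  · rintro (n | n) m hnm <;> simp only [Sum.elim_inl, Sum.elim_inr] at hnm
    · have := h1 n
      rw [hnm, h3 m] at this
      linarith
    · have := h2 n
      rw [hnm, h3 m] at this
      linarith

lemma NZBC.s11_circleInv_eq_zero_iff (h : NZBC q q0 qp qm t) {ζ : ℂ} (hζ : ζ ∈ admissible q0) :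
    s11 q q0 qp qm t (circleInv q0 ζ) = 0 ↔ s11 q q0 qp qm t ζ = 0 := by
  have hqp : qp ≠ 0 := norm_pos_iff.1 (by rw [h.norm_qp]; exact h.pos)
  have hqm : qm ≠ 0 := norm_pos_iff.1 (by rw [h.norm_qm]; exact h.pos)
  rw [h.s11_circleInv hζ, mul_eq_zero, star_eq_zero]
  simp [hqp, hqm]

/-- A zero outside the circle or on it is among the given ones. A zero inside the circle is the
inversion of a zero outside, by the symmetry of s₁₁. -/
lemma NZBC.s11_eq_zero_iff (h : NZBC q q0 qp qm t)
    (hz : DoubleZerosIn (s11 q q0 qp qm t) (outerQuadrant q0) z)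
    (hw : DoubleZerosIn (s11 q q0 qp qm t) (quarterArc q0) w) {ζ : ℂ} (hζ : ζ ∈ quadrant) :
    s11 q q0 qp qm t ζ = 0 ↔ ∃ i, quadrantZeros q0 z w i = ζ := by
  have hq0 := h.pos
  have hζ0 : ζ ≠ 0 := by rintro rfl; simpa using hζ.1
  have hpos : 0 < ‖ζ‖ := norm_pos_iff.2 hζ0
  constructor
  · intro h0
    rcases lt_trichotomy ‖ζ‖ q0 with h1 | h1 | h1
    · have h2 := circleInv_mem_quadrant hq0 hζ
      obtain ⟨n, hn⟩ := (hz.2.1 (circleInv q0 ζ)).1 ⟨⟨h2.1, h2.2, by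
        rw [norm_circleInv, lt_div_iff₀ hpos]; nlinarith⟩,
        (h.s11_circleInv_eq_zero_iff (quadrant_subset_admissible hζ)).2 h0⟩
      exact ⟨Sum.inl (Sum.inr n), by simp [quadrantZeros, hn, circleInv_circleInv hq0 hζ0]⟩
    · obtain ⟨m, hm⟩ := (hw.2.1 ζ).1 ⟨⟨hζ.1, hζ.2, h1⟩, h0⟩
      exact ⟨Sum.inr m, by simp [quadrantZeros, hm]⟩
    · obtain ⟨n, hn⟩ := (hz.2.1 ζ).1 ⟨⟨hζ.1, hζ.2, h1⟩, h0⟩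
      exact ⟨Sum.inl (Sum.inl n), by simp [quadrantZeros, hn]⟩
  · rintro ⟨(n | n) | m, rfl⟩
    · exact (hz.mem n).2
    · have h1 : z n ∈ quadrant := ⟨(hz.mem n).1.1, (hz.mem n).1.2.1⟩
      exact (h.s11_circleInv_eq_zero_iff (quadrant_subset_admissible h1)).2 (hz.mem n).2
    · exact (hw.mem m).2

lemma tendsto_div_sq_of_double_zero {f : ℂ → ℂ} {ζ : ℂ} (hf : AnalyticAt ℂ f ζ) (h0 : f ζ = 0)
    (h1 : deriv f ζ = 0) (h2 : iteratedDeriv 2 f ζ ≠ 0) :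
    ∃ c, c ≠ 0 ∧ Tendsto (fun z => f z / (z - ζ) ^ 2) (𝓝[≠] ζ) (𝓝 c) := by
  have h3 : ((2 : ℕ) : ℕ∞) ≤ analyticOrderAt f ζ := by
    rw [natCast_le_analyticOrderAt_iff_iteratedDeriv_eq_zero hf]
    intro i hi
    interval_cases i
    · simpa using h0
    · simpa using h1
  have h4 : ¬ ((3 : ℕ) : ℕ∞) ≤ analyticOrderAt f ζ := by
    rw [natCast_le_analyticOrderAt_iff_iteratedDeriv_eq_zero hf]
    intro h
    exact h2 (h 2 (by norm_num))
  have h5 : analyticOrderAt f ζ = ((2 : ℕ) : ℕ∞) := by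
    cases hk : analyticOrderAt f ζ with
    | top => exact absurd (hk ▸ le_top) h4
    | coe n =>
      rw [hk] at h3 h4
      norm_cast at h3 h4 ⊢
      omega
  obtain ⟨g, hg, hg0, hfg⟩ := (hf.analyticOrderAt_eq_natCast).1 h5
  refine ⟨g ζ, hg0, (hg.continuousAt.tendsto.mono_left nhdsWithin_le_nhds).congr' ?_⟩
  filter_upwards [self_mem_nhdsWithin, nhdsWithin_le_nhds hfg] with y hy hfy
  have : y - ζ ≠ 0 := sub_ne_zero.2 hy
  rw [hfy, smul_eq_mul]
  field_simp

/-- For the inverted points the order of the zero is transported by s₁₁(y) = (q₋/q₊) s₁₁(q₀²/y*)*,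
since the inversion is conjugate holomorphic with nonvanishing derivative. -/
lemma NZBC.tendsto_s11_div_sq (h : NZBC q q0 qp qm t)
    (hz : DoubleZerosIn (s11 q q0 qp qm t) (outerQuadrant q0) z)
    (hw : DoubleZerosIn (s11 q q0 qp qm t) (quarterArc q0) w) (i) :
    ∃ c, c ≠ 0 ∧ Tendsto (fun ζ => s11 q q0 qp qm t ζ / (ζ - quadrantZeros q0 z w i) ^ 2)
      (𝓝[≠] (quadrantZeros q0 z w i)) (𝓝 c) := by
  have hq0 := h.pos
  have han : ∀ ζ ∈ quadrant, AnalyticAt ℂ (s11 q q0 qp qm t) ζ := fun ζ hζ =>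
    h.differentiableOn_s11.analyticAt (isOpen_Dplus.mem_nhds (quadrant_subset_Dplus hζ))
  have hzq : ∀ n, z n ∈ quadrant := fun n => ⟨(hz.mem n).1.1, (hz.mem n).1.2.1⟩
  have hzt : ∀ n, ∃ c, c ≠ 0 ∧ Tendsto (fun ζ => s11 q q0 qp qm t ζ / (ζ - z n) ^ 2)
      (𝓝[≠] (z n)) (𝓝 c) := fun n =>
    tendsto_div_sq_of_double_zero (han _ (hzq n)) (hz.mem n).2 (hz.2.2 n).1 (hz.2.2 n).2
  rcases i with (n | n) | m
  · exact hzt n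
  · obtain ⟨c, hc, hct⟩ := hzt n
    have hqp : qp ≠ 0 := norm_pos_iff.1 (by rw [h.norm_qp]; exact h.pos)
    have hqm : qm ≠ 0 := norm_pos_iff.1 (by rw [h.norm_qm]; exact h.pos)
    have h0 : (q0 : ℂ) ≠ 0 := by exact_mod_cast hq0.ne'
    have hn0 : z n ≠ 0 := by intro h0; simpa [h0] using (hzq n).1
    set ζ := circleInv q0 (z n) with hζ
    have hζq : ζ ∈ quadrant := circleInv_mem_quadrant hq0 (hzq n)
    have hζ0 : ζ ≠ 0 := by intro h0; simpa [h0] using hζq.1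
    have hinv : circleInv q0 ζ = z n := circleInv_circleInv hq0 hn0
    have hcont : ContinuousAt (circleInv q0) ζ := by
      unfold circleInv
      exact continuousAt_const.div continuous_star.continuousAt (star_ne_zero.2 hζ0)
    have htend : Tendsto (circleInv q0) (𝓝[≠] ζ) (𝓝[≠] (z n)) := by
      refine tendsto_nhdsWithin_iff.2 ⟨?_, ?_⟩
      · rw [← hinv]
        exact hcont.tendsto.mono_left nhdsWithin_le_nhds
      · filter_upwards [self_mem_nhdsWithin,
          nhdsWithin_le_nhds (isOpen_quadrant.mem_nhds hζq)] with y hy hyq hyz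
        apply hy
        have hy0 : y ≠ 0 := by rintro rfl; simpa using hyq.1
        have := congrArg (circleInv q0) (Set.mem_singleton_iff.1 hyz)
        rwa [circleInv_circleInv hq0 hy0] at this
    have hlim := ((hct.comp htend).star.const_mul (qm / qp)).mul
      (((continuous_star.tendsto _).comp (hcont.tendsto.mono_left
        (nhdsWithin_le_nhds (s := {ζ}ᶜ)))).mul_const (star (z n)) |>.pow 2 |>.div_const
          ((q0 : ℂ) ^ 4))
    refine ⟨_, ?_, hlim.congr' ?_⟩
    · rw [hinv]
      refine mul_ne_zero (mul_ne_zero (div_ne_zero hqm hqp) (star_ne_zero.2 hc))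
        (div_ne_zero (pow_ne_zero 2 (mul_ne_zero (star_ne_zero.2 hn0) (star_ne_zero.2 hn0)))
          (pow_ne_zero 4 h0))
    · filter_upwards [self_mem_nhdsWithin,
        nhdsWithin_le_nhds (isOpen_quadrant.mem_nhds hζq)] with y hy hyq
      have hy0 : y ≠ 0 := by rintro rfl; simpa using hyq.1
      have e1 : quadrantZeros q0 z w (Sum.inl (Sum.inr n)) = ζ := rfl
      have hyζ : y - ζ ≠ 0 := sub_ne_zero.2 hy
      have e2 : star (z n) = (q0 : ℂ) ^ 2 / ζ := by
        rw [← hinv]; simp [circleInv]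
      have e3 : star (circleInv q0 y) = (q0 : ℂ) ^ 2 / y := by simp [circleInv]
      simp only [Function.comp]
      rw [e1, h.s11_circleInv (quadrant_subset_admissible hyq), star_div₀, star_pow, star_sub, e2, e3]
      generalize star (s11 q q0 qp qm t (circleInv q0 y)) = S
      have e4 : (q0 : ℂ) ^ 2 / y - (q0 : ℂ) ^ 2 / ζ = -((q0 : ℂ) ^ 2 * (y - ζ) / (y * ζ)) := by
        field_simp; ring
      rw [e4]
      field_simp
  · exact tendsto_div_sq_of_double_zero (han _ ⟨(hw.mem m).1.1, (hw.mem m).1.2.1⟩) (hw.mem m).2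
      (hw.2.2 m).1 (hw.2.2 m).2

end Zeros

end

/-! ### Representation of s₁₁ in the variable u = z², and log |s₁₁| near the origin. -/

noncomputable section

variable {q : ℝ → ℝ → ℂ} {q0 : ℝ} {qp qm : ℂ} {t : ℝ}

/-- `log |s₁₁|` on the contour, in terms of `s = z²`. -/
def logModulus (q : ℝ → ℝ → ℂ) (q0 : ℝ) (qp qm : ℂ) (t : ℝ) (s : ℝ) : ℝ :=
  Real.log ‖s11 q q0 qp qm t (csqrt s)‖

lemma NZBC.qp_ne_zero (h : NZBC q q0 qp qm t) : qp ≠ 0 :=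
  norm_pos_iff.1 (by rw [h.norm_qp]; exact h.pos)

lemma NZBC.norm_qm_div_qp (h : NZBC q q0 qp qm t) : ‖qm / qp‖ = 1 := by
  rw [norm_div, h.norm_qp, h.norm_qm, div_self h.pos.ne']

/-- Behaviour of `s₁₁` at the origin. -/
lemma NZBC.s11_origin (h : NZBC q q0 qp qm t) :
    ∃ C r : ℝ, 0 ≤ C ∧ 0 < r ∧ ∀ z ∈ admissible q0, ‖z‖ ≤ r →
      ‖s11 q q0 qp qm t z - qm / qp * Complex.exp (Complex.I * (v0 q q0 t : ℂ))‖ ≤ C * ‖z‖ := by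
  obtain ⟨C, R, hC, hR, hs⟩ := h.s11_asymptotics
  have hq0 := h.pos
  refine ⟨C / q0 ^ 2, q0 ^ 2 / R, by positivity, by positivity, fun z hz hzr => ?_⟩
  have hz0 : 0 < ‖z‖ := norm_pos_iff.2 hz.2.1
  have h1 := hs _ (circleInv_mem_admissible hq0 hz) (by
    rw [norm_circleInv, le_div_iff₀ hz0]
    rwa [le_div_iff₀ (by linarith), mul_comm] at hzr)
  -- The inversion exchanges the origin and infinity, so the expansion at infinity is conjugated and
  -- multiplied by q₋/q₊.
  have h2 : s11 q q0 qp qm t z - qm / qp * Complex.exp (Complex.I * (v0 q q0 t : ℂ)) =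
      qm / qp * star (s11 q q0 qp qm t (circleInv q0 z) -
        Complex.exp (-(Complex.I * (v0 q q0 t : ℂ)))) := by
    rw [h.s11_circleInv hz, star_sub, mul_sub]
    congr 2
    simp [← Complex.exp_conj]
  rw [h2, norm_mul, h.norm_qm_div_qp, one_mul, norm_star]
  refine h1.trans (le_of_eq ?_)
  rw [norm_circleInv]
  field_simp

lemma NZBC.s11_ne_zero_of_contour (hns : NoSpectralSingularities q q0 qp qm t) {s : ℝ} (hs : s ≠ 0)
    (hs' : s ≠ -q0 ^ 2) : s11 q q0 qp qm t (csqrt s) ≠ 0 :=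
  left_ne_zero_of_mul (hns.ne_zero _ ⟨csqrt_mem_contour hs, csqrt_notMem_branchPts hs hs'⟩)

lemma NZBC.tendsto_s11_csqrt (h : NZBC q q0 qp qm t) {s : ℝ} (hs : s ≠ 0) (hs' : s ≠ -q0 ^ 2) :
    Tendsto (fun u => s11 q q0 qp qm t (csqrt u)) (𝓝[upperHalf] (s : ℂ))
      (𝓝 (s11 q q0 qp qm t (csqrt s))) := by
  have h1 := h.continuousOn_s11 _
    (mem_admissible_of_contour (csqrt_mem_contour hs) (csqrt_notMem_branchPts hs hs'))
  exact (h1.mono quadrant_subset_admissible).tendsto.comp (tendsto_csqrt hs)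

lemma NZBC.tendsto_s11_csqrt_zero (h : NZBC q q0 qp qm t) :
    Tendsto (fun u => s11 q q0 qp qm t (csqrt u)) (𝓝[upperHalf] 0)
      (𝓝 (qm / qp * Complex.exp (Complex.I * (v0 q q0 t : ℂ)))) := by
  obtain ⟨C, r, hC, hr, hs⟩ := h.s11_origin
  have h1 : Tendsto (fun u : ℂ => ‖u‖ ^ (1 / 2 : ℝ)) (𝓝[upperHalf] 0) (𝓝 0) := by
    have : Continuous fun u : ℂ => ‖u‖ ^ (1 / 2 : ℝ) :=
      continuous_norm.rpow_const fun _ => Or.inr (by norm_num)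
    exact ((this.tendsto 0).mono_left nhdsWithin_le_nhds).trans_eq (by simp)
  rw [tendsto_iff_norm_sub_tendsto_zero]
  refine squeeze_zero_norm' ?_ ((h1.const_mul C).trans_eq (by rw [mul_zero]))
  filter_upwards [self_mem_nhdsWithin, h1.eventually_le_const hr] with u hu hur
  have h2 := norm_csqrt (ne_zero_of_mem_upperHalf hu)
  rw [norm_norm, ← h2]
  exact hs _ (quadrant_subset_admissible (csqrt_mem_quadrant hu)) (h2 ▸ hur)

lemma exists_eventually_le_of_tendsto {α : Type*} {l : Filter α} {f : α → ℝ} {c : ℝ}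
    (h : Tendsto f l (𝓝 c)) : ∃ M, ∀ᶠ x in l, f x ≤ M :=
  ⟨c + 1, (h.eventually_lt_const (lt_add_one c)).mono fun _ => le_of_lt⟩

/-- The recovery theorem is applied to σ(u) = s₁₁(√u) e^{iv₀}, normalized to tend to 1. The
exceptional boundary point p = -q₀² is the image of the branch point iq₀, and the error O(1/|z|)
becomes O(|u|^{-1/2}). -/
theorem NZBC.s11_formula (h : NZBC q q0 qp qm t) (hns : NoSpectralSingularities q q0 qp qm t)
    {N₁ N₂ : ℕ} {z : Fin N₁ → ℂ} {w : Fin N₂ → ℂ}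
    (hz : DoubleZerosIn (s11 q q0 qp qm t) (outerQuadrant q0) z)
    (hw : DoubleZerosIn (s11 q q0 qp qm t) (quarterArc q0) w) {u : ℂ} (hu : u ∈ upperHalf) :
    Integrable (fun s : ℝ => (logModulus q q0 qp qm t s : ℂ) / (s - u)) ∧
      s11 q q0 qp qm t (csqrt u) * Complex.exp (Complex.I * (v0 q q0 t : ℂ)) =
        (∏ i, ((u - quadrantZeros q0 z w i ^ 2) / (u - star (quadrantZeros q0 z w i ^ 2))) ^ 2) *
        Complex.exp (1 / (Real.pi * Complex.I) *
          ∫ s : ℝ, (logModulus q q0 qp qm t s : ℂ) / (s - u)) := by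
  have hq0 := h.pos
  set e : ℂ := Complex.exp (Complex.I * (v0 q q0 t : ℂ)) with he
  have hen : ‖e‖ = 1 := by simp [he, Complex.norm_exp]
  have hsn : ∀ u, ‖s11 q q0 qp qm t (csqrt u) * e‖ = ‖s11 q q0 qp qm t (csqrt u)‖ := fun u => by
    rw [norm_mul, hen, mul_one]
  have hqz := h.quadrantZeros_mem hz hw
  obtain ⟨C, R, hC, hR, hasy⟩ := h.s11_asymptotics
  -- the behaviour at the real points different from the branch point
  have hreg : ∀ x : ℝ, x ≠ -q0 ^ 2 → ∃ c : ℂ, c ≠ 0 ∧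
      Tendsto (fun u => s11 q q0 qp qm t (csqrt u)) (𝓝[upperHalf] (x : ℂ)) (𝓝 c) := by
    intro x hx
    rcases eq_or_ne x 0 with rfl | hx0
    · refine ⟨_, ?_, by simpa using h.tendsto_s11_csqrt_zero⟩
      refine mul_ne_zero (norm_ne_zero_iff.1 ?_) (Complex.exp_ne_zero _)
      rw [h.norm_qm_div_qp]
      exact one_ne_zero
    · exact ⟨_, NZBC.s11_ne_zero_of_contour hns hx0 hx, h.tendsto_s11_csqrt hx0 hx⟩
  have hq0' : -q0 ^ 2 ≠ 0 := by
    have : 0 < q0 ^ 2 := by positivity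
    linarith
  have hbr : csqrt ((-q0 ^ 2 : ℝ) : ℂ) = Complex.I * q0 := by
    rw [← csqrt_neg_ofReal_sq hq0]; push_cast; rfl
  refine eq_prod_mul_exp_integral_log (σ := fun u => s11 q q0 qp qm t (csqrt u) * e)
    (a := fun i => quadrantZeros q0 z w i ^ 2) (C := C) (R := R ^ 2) (p := -q0 ^ 2)
    (N := fun s => ‖s11 q q0 qp qm t (csqrt s)‖) ?_ ?_ ?_ ?_ ?_ ?_ ?_ ?_ ?_ hu
  · exact (h.differentiableOn_s11.comp differentiableOn_csqrt fun u hu =>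
      quadrant_subset_Dplus (csqrt_mem_quadrant hu)).mul_const e
  · exact fun i => sq_mem_upperHalf (hqz i)
  · intro i j hij
    have := congrArg csqrt hij
    simp only [csqrt_of_sq (hqz _)] at this
    exact h.quadrantZeros_injective hz hw this
  · intro u hu
    have he0 : e ≠ 0 := Complex.exp_ne_zero _
    rw [mul_eq_zero, or_iff_left he0, h.s11_eq_zero_iff hz hw (csqrt_mem_quadrant hu)]
    refine exists_congr fun i => ⟨fun hi => ?_, fun hi => ?_⟩
    · rw [hi, csqrt_sq (ne_zero_of_mem_upperHalf hu)]
    · rw [← hi, csqrt_of_sq (hqz i)]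
  · intro i
    set ζ := quadrantZeros q0 z w i with hζ
    obtain ⟨c, hc, hct⟩ := h.tendsto_s11_div_sq hz hw i
    have hζ0 : ζ ≠ 0 := by intro h0; simpa [← hζ, h0] using (hqz i).1
    have hd := (differentiableOn_csqrt.differentiableAt
      (isOpen_upperHalf.mem_nhds (sq_mem_upperHalf (hqz i)))).continuousAt
    have h1 : Tendsto csqrt (𝓝[≠] (ζ ^ 2)) (𝓝[≠] ζ) := by
      refine tendsto_nhdsWithin_iff.2 ⟨?_, ?_⟩
      · have := hd.tendsto.mono_left (nhdsWithin_le_nhds (s := {ζ ^ 2}ᶜ))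
        rwa [csqrt_of_sq (hqz i)] at this
      · filter_upwards [self_mem_nhdsWithin, nhdsWithin_le_nhds
          (isOpen_upperHalf.mem_nhds (sq_mem_upperHalf (hqz i)))] with u hu huU hcon
        apply hu
        rw [Set.mem_singleton_iff, ← csqrt_sq (ne_zero_of_mem_upperHalf huU),
          Set.mem_singleton_iff.1 hcon]
    have h2 := ((hct.comp h1).mul_const e).div
      (((tendsto_nhds_of_tendsto_nhdsWithin h1).add_const ζ).pow 2)
      (pow_ne_zero 2 (by rw [← two_mul]; exact mul_ne_zero two_ne_zero hζ0))
    refine ⟨_, ?_, h2.congr' ?_⟩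
    · exact div_ne_zero (mul_ne_zero hc (Complex.exp_ne_zero _))
        (pow_ne_zero 2 (by rw [← two_mul]; exact mul_ne_zero two_ne_zero hζ0))
    · filter_upwards [nhdsWithin_le_nhds
          (isOpen_upperHalf.mem_nhds (sq_mem_upperHalf (hqz i)))] with u huU
      have h3 : u - ζ ^ 2 = (csqrt u - ζ) * (csqrt u + ζ) := by
        conv_lhs => rw [← csqrt_sq (ne_zero_of_mem_upperHalf huU)]
        ring
      simp only [Pi.div_apply, Function.comp, ← hζ, h3, mul_pow]
      rw [div_mul_eq_mul_div, div_div]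
  · intro u hu huR
    have hu0 := ne_zero_of_mem_upperHalf hu
    have h1 : R ≤ ‖csqrt u‖ := by
      rw [norm_csqrt hu0, ← Real.sqrt_eq_rpow]
      exact Real.le_sqrt_of_sq_le huR
    have h2 := hasy _ (quadrant_subset_admissible (csqrt_mem_quadrant hu)) h1
    have h3 : s11 q q0 qp qm t (csqrt u) * e - 1 = (s11 q q0 qp qm t (csqrt u) -
        Complex.exp (-(Complex.I * (v0 q q0 t : ℂ)))) * e := by
      rw [sub_mul, he, ← Complex.exp_add]; simp
    rw [h3, norm_mul, hen, mul_one]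
    refine h2.trans (le_of_eq ?_)
    rw [norm_csqrt hu0, div_eq_mul_inv, ← Real.rpow_neg (norm_nonneg u)]
  · intro x
    simp only [hsn]
    rcases eq_or_ne x (-q0 ^ 2) with rfl | hx
    -- At the branch point the lower bound on |s₁₁| is the absence of a spectral singularity: 1/s₁₁
    -- has a limit there.
    · obtain ⟨c, hc⟩ := hns.inv_s11 (Complex.I * q0) (Or.inl rfl)
      have h1 := tendsto_csqrt hq0'
      rw [hbr] at h1
      have hsub : quadrant ⊆ (Dplus ∪ contour) \ branchPts q0 := fun y hy =>
        ⟨Or.inl (quadrant_subset_Dplus hy), fun hb =>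
          (quadrant_subset_admissible hy).2.2 ((specLam_eq_zero_iff
            (quadrant_subset_admissible (q0 := q0) hy).2.1).2 hb)⟩
      have h2 := (hc.mono_left (nhdsWithin_mono _ hsub)).comp h1
      exact exists_eventually_le_of_tendsto (h2.norm.congr fun u => by simp)
    · obtain ⟨c, hc, hct⟩ := hreg x hx
      exact exists_eventually_le_of_tendsto (hct.norm.inv₀ (norm_ne_zero_iff.2 hc))
  · intro x
    simp only [hsn]
    rcases eq_or_ne x (-q0 ^ 2) with rfl | hx
    · have h1 := tendsto_csqrt hq0'
      rw [hbr] at h1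
      have h0 : Complex.I * (q0 : ℂ) ≠ 0 := mul_ne_zero Complex.I_ne_zero (by exact_mod_cast hq0.ne')
      obtain ⟨M, hM⟩ := h.bounded_detE_mul_s11 (‖specK q0 (Complex.I * q0)‖ + 1)
      have h2 : Tendsto (fun u => ‖specK q0 (csqrt u)‖) (𝓝[upperHalf] ((-q0 ^ 2 : ℝ) : ℂ))
          (𝓝 ‖specK q0 (Complex.I * q0)‖) :=
        (((continuousOn_specK q0).continuousAt
          (isOpen_ne.mem_nhds h0)).tendsto.comp (tendsto_nhds_of_tendsto_nhdsWithin h1)).norm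
      have h3 : Tendsto (fun u : ℂ => ‖u‖) (𝓝[upperHalf] ((-q0 ^ 2 : ℝ) : ℂ))
          (𝓝 ‖((-q0 ^ 2 : ℝ) : ℂ)‖) := (continuous_norm.tendsto _).mono_left nhdsWithin_le_nhds
      refine ⟨M * (‖((-q0 ^ 2 : ℝ) : ℂ)‖ + 1), ?_⟩
      filter_upwards [self_mem_nhdsWithin, h2.eventually_lt_const (lt_add_one _),
        h3.eventually_lt_const (lt_add_one _)] with u hu hk hnu
      have hu0 := ne_zero_of_mem_upperHalf hu
      have h4 := hM _ (quadrant_subset_admissible (csqrt_mem_quadrant hu)) hk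
      -- In the variable u the factor det E has a simple zero at -q₀², so boundedness of det E · s₁₁
      -- is exactly the pole bound required.
      have h5 : detE q0 (csqrt u) = (u - ((-q0 ^ 2 : ℝ) : ℂ)) / u := by
        rw [detE, csqrt_sq hu0]; push_cast; field_simp; ring
      rw [h5, norm_mul, norm_div] at h4
      have h6 : 0 < ‖u‖ := norm_pos_iff.2 hu0
      calc ‖s11 q q0 qp qm t (csqrt u)‖ * ‖u - ((-q0 ^ 2 : ℝ) : ℂ)‖
          = ‖u - ((-q0 ^ 2 : ℝ) : ℂ)‖ / ‖u‖ * ‖s11 q q0 qp qm t (csqrt u)‖ * ‖u‖ := by field_simp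
        _ ≤ M * (‖((-q0 ^ 2 : ℝ) : ℂ)‖ + 1) :=
          mul_le_mul h4 hnu.le (norm_nonneg _) ((by positivity :
            0 ≤ ‖u - ((-q0 ^ 2 : ℝ) : ℂ)‖ / ‖u‖ * ‖s11 q q0 qp qm t (csqrt u)‖).trans h4)
    · obtain ⟨c, hc, hct⟩ := hreg x hx
      have h1 : Tendsto (fun u : ℂ => ‖u - ((-q0 ^ 2 : ℝ) : ℂ)‖) (𝓝[upperHalf] (x : ℂ))
          (𝓝 ‖(x : ℂ) - ((-q0 ^ 2 : ℝ) : ℂ)‖) :=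
        ((by fun_prop : Continuous fun u : ℂ => ‖u - ((-q0 ^ 2 : ℝ) : ℂ)‖).tendsto _).mono_left
          nhdsWithin_le_nhds
      exact exists_eventually_le_of_tendsto (hct.norm.mul h1)
  · filter_upwards [(Set.finite_singleton (0 : ℝ)).countable.ae_notMem volume,
      (Set.finite_singleton (-q0 ^ 2)).countable.ae_notMem volume] with s hs hs'
    refine ⟨norm_ne_zero_iff.2 (NZBC.s11_ne_zero_of_contour hns hs hs'), ?_⟩
    simp only [hsn]
    exact ((h.tendsto_s11_csqrt hs hs').comp
      (tendsto_add_mul_I (s : ℂ) (Complex.ofReal_im s))).norm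

/-- `log |s₁₁|` vanishes at the origin like `√|s|`. -/
lemma NZBC.logModulus_origin (h : NZBC q q0 qp qm t) :
    ∃ C r : ℝ, 0 < r ∧ ∀ s : ℝ, s ≠ 0 → |s| ≤ r →
      |logModulus q q0 qp qm t s| ≤ C * |s| ^ (1 / 2 : ℝ) := by
  obtain ⟨C, r, hC, hr, hs⟩ := h.s11_origin
  have hq0 := h.pos
  have h1 : Tendsto (fun s : ℝ => |s| ^ (1 / 2 : ℝ)) (𝓝 0) (𝓝 0) := by
    have : Continuous fun s : ℝ => |s| ^ (1 / 2 : ℝ) :=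
      continuous_abs.rpow_const fun _ => Or.inr (by norm_num)
    exact (this.tendsto 0).trans_eq (by simp)
  -- The second condition keeps |s₁₁| ≥ 1/2, where |log x| ≤ 2|x - 1|, whence the constant 2C. The
  -- third keeps s away from the branch value -q₀².
  have h2 : ∀ᶠ s : ℝ in 𝓝 0, |s| ^ (1 / 2 : ℝ) ≤ r ∧ C * |s| ^ (1 / 2 : ℝ) ≤ 1 / 2 ∧
      |s| < q0 ^ 2 := by
    refine (h1.eventually_le_const hr).and (((by simpa using h1.const_mul C :
      Tendsto (fun s : ℝ => C * |s| ^ (1 / 2 : ℝ)) (𝓝 0) (𝓝 0)).eventually_le_const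
        (by norm_num)).and ?_)
    exact (continuous_abs.tendsto' (0 : ℝ) 0 abs_zero).eventually_lt_const (by positivity)
  obtain ⟨δ, hδ, hδs⟩ := Metric.eventually_nhds_iff.1 h2
  refine ⟨2 * C, δ / 2, by positivity, fun s hs0 hsδ => ?_⟩
  obtain ⟨h3, h4, h5⟩ := hδs (y := s) (by rw [Real.dist_eq, sub_zero]; linarith)
  have hadm := mem_admissible_of_contour (q0 := q0) (csqrt_mem_contour hs0)
    (csqrt_notMem_branchPts hs0 (by rintro rfl; rw [abs_neg, abs_of_nonneg (by positivity)] at h5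
                                    exact lt_irrefl _ h5))
  have hn : ‖csqrt (s : ℂ)‖ = |s| ^ (1 / 2 : ℝ) := by
    rw [norm_csqrt (by exact_mod_cast hs0), Complex.norm_real, Real.norm_eq_abs]
  have h6 := hs _ hadm (hn ▸ h3)
  rw [hn] at h6
  have h7 : ‖qm / qp * Complex.exp (Complex.I * (v0 q q0 t : ℂ))‖ = 1 := by
    rw [norm_mul, h.norm_qm_div_qp, one_mul]; simp [Complex.norm_exp]
  have h8 := (abs_norm_sub_norm_le _ _).trans h6
  rw [h7] at h8
  set x := ‖s11 q q0 qp qm t (csqrt s)‖ with hx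
  have h9 : 1 / 2 ≤ x := by
    have := (abs_le.1 (h8.trans h4)).1
    linarith
  have hxpos : 0 < x := by linarith
  have e1 : Real.log x ≤ x - 1 := Real.log_le_sub_one_of_pos hxpos
  have e2 : -Real.log x ≤ x⁻¹ - 1 := by
    rw [← Real.log_inv]; exact Real.log_le_sub_one_of_pos (inv_pos.2 hxpos)
  have e3 : x⁻¹ - 1 ≤ 2 * |x - 1| := by
    have : x⁻¹ - 1 = (1 - x) * x⁻¹ := by field_simp
    rw [this]
    have h10 : x⁻¹ ≤ 2 := by rw [inv_le_comm₀ hxpos (by norm_num)]; linarith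
    calc (1 - x) * x⁻¹ ≤ |x - 1| * x⁻¹ := by
          gcongr
          rw [abs_sub_comm]; exact le_abs_self _
      _ ≤ |x - 1| * 2 := by gcongr
      _ = _ := by ring
  have e4 := le_abs_self (x - 1)
  have e5 := abs_nonneg (x - 1)
  rw [logModulus, ← hx, abs_le]
  constructor <;> linarith

/-- Near 0 the quotient is O(|s|^{-1/2}), because |s₁₁| → 1 there at the rate |z| = |s|^{1/2}. Away
from 0 the kernels 1/s and 1/(s - i) are comparable. -/
lemma NZBC.integrable_logModulus_div (h : NZBC q q0 qp qm t)
    (hint : Integrable fun s : ℝ => (logModulus q q0 qp qm t s : ℂ) / (s - Complex.I)) :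
    Integrable fun s : ℝ => (logModulus q q0 qp qm t s : ℂ) / s := by
  obtain ⟨C, r, hr, hb⟩ := h.logModulus_origin
  have hsI : ∀ s : ℝ, (s : ℂ) - Complex.I ≠ 0 := fun s hs => by
    have := congrArg Complex.im hs
    simp at this
  have hmeas : AEStronglyMeasurable (fun s : ℝ => (logModulus q q0 qp qm t s : ℂ) / s) volume := by
    have h1 : Measurable fun s : ℝ => ((s : ℂ) - Complex.I) / s := by fun_prop
    refine (hint.aestronglyMeasurable.mul h1.aestronglyMeasurable).congr ?_
    filter_upwards with s
    have := hsI s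
    simp only [Pi.mul_apply]
    field_simp
  have hnorm : ∀ s : ℝ, ‖(s : ℂ) - Complex.I‖ ≤ |s| + 1 := fun s => by
    refine (norm_sub_le _ _).trans ?_
    simp
  set g : ℝ → ℝ := fun s => (Set.Icc (-r) r).indicator (fun s => C * |s| ^ (-(1 / 2) : ℝ)) s
    with hg
  have hgi : Integrable g := by
    rw [hg, integrable_indicator_iff measurableSet_Icc]
    have h1 : IntervalIntegrable (fun s : ℝ => s ^ (-(1 / 2) : ℝ)) volume 0 r :=
      intervalIntegral.intervalIntegrable_rpow' (by norm_num)
    have h2 : IntegrableOn (fun s : ℝ => |s| ^ (-(1 / 2) : ℝ)) (Set.Ioc 0 r) := by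
      rw [intervalIntegrable_iff_integrableOn_Ioc_of_le hr.le] at h1
      exact h1.congr_fun (fun s hs => by simp only [abs_of_pos hs.1]) measurableSet_Ioc
    have h3 : IntegrableOn (fun s : ℝ => |s| ^ (-(1 / 2) : ℝ)) (Set.Ico (-r) 0) := by
      have := ((Measure.measurePreserving_neg volume).integrableOn_comp_preimage
        (Homeomorph.neg ℝ).measurableEmbedding).2 h2
      have h4 : Neg.neg ⁻¹' Set.Ioc (0 : ℝ) r = Set.Ico (-r) 0 := by
        ext x; simp
      rw [h4] at this
      exact this.congr_fun (fun s _ => by simp) measurableSet_Ico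
    have h6 : IntegrableOn (fun s : ℝ => |s| ^ (-(1 / 2) : ℝ)) {(0 : ℝ)} :=
      integrableOn_singleton (hx := by simp)
    have h5 : IntegrableOn (fun s : ℝ => |s| ^ (-(1 / 2) : ℝ)) (Set.Icc (-r) r) := by
      refine ((h3.union h6).union h2).mono_set
        fun x hx => ?_
      rcases lt_trichotomy x 0 with h | h | h
      · exact Or.inl (Or.inl ⟨hx.1, h⟩)
      · exact Or.inl (Or.inr h)
      · exact Or.inr ⟨h, hx.2⟩
    exact h5.const_mul C
  have hg0 : ∀ s, s ≠ 0 → 0 ≤ g s := fun s hs => by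
    by_cases hsr : s ∈ Set.Icc (-r) r
    · simp only [hg, Set.indicator_of_mem hsr]
      have h1 := (abs_nonneg _).trans (hb s hs (abs_le.2 hsr))
      have h2 : 0 < |s| ^ (1 / 2 : ℝ) := Real.rpow_pos_of_pos (abs_pos.2 hs) _
      have h3 : 0 ≤ C := nonneg_of_mul_nonneg_left h1 h2
      positivity
    · simp only [hg, Set.indicator_of_notMem hsr]; exact le_rfl
  refine (hgi.add (hint.norm.const_mul (1 + 1 / r))).mono' hmeas ?_
  filter_upwards [(Set.finite_singleton (0 : ℝ)).countable.ae_notMem volume] with s hs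
  have hs0 : s ≠ 0 := hs
  have hspos : 0 < |s| := abs_pos.2 hs0
  simp only [Pi.add_apply]
  rw [norm_div, Complex.norm_real, Complex.norm_real, Real.norm_eq_abs, Real.norm_eq_abs]
  by_cases hsr : |s| ≤ r
  · have h1 := hb s hs0 hsr
    have h2 : g s = C * |s| ^ (-(1 / 2) : ℝ) := by
      simp only [hg, Set.indicator_of_mem (Set.mem_Icc.2 (abs_le.1 hsr))]
    have h3 : |logModulus q q0 qp qm t s| / |s| ≤ g s := by
      rw [h2, div_le_iff₀ hspos, mul_assoc, ← Real.rpow_add_one hspos.ne']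
      norm_num
      simpa using h1
    have h4 : 0 ≤ (1 + 1 / r) * ‖(logModulus q q0 qp qm t s : ℂ) / (s - Complex.I)‖ := by positivity
    linarith
  · push Not at hsr
    have h1 := hg0 s hs0
    have h2 : |logModulus q q0 qp qm t s| / |s| ≤
        (1 + 1 / r) * ‖(logModulus q q0 qp qm t s : ℂ) / (s - Complex.I)‖ := by
      have h3 := norm_pos_iff.2 (hsI s)
      rw [norm_div, Complex.norm_real, Real.norm_eq_abs, ← mul_div_assoc,
        div_le_div_iff₀ hspos h3, mul_comm (1 + 1 / r), mul_assoc]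
      gcongr
      refine (hnorm s).trans ?_
      have : 1 ≤ 1 / r * |s| := by rw [one_div, inv_mul_eq_div, le_div_iff₀ hr]; linarith
      linarith
    linarith

end

/-! ### Folding the contour Σ onto the real line. -/

noncomputable section

lemma integral_Ioi_sq (g : ℝ → ℂ) :
    ∫ r in Set.Ioi (0 : ℝ), (2 * r : ℝ) • g (r ^ 2) = ∫ s in Set.Ioi 0, g s := by
  rw [← integral_comp_rpow_Ioi_of_pos (g := g) (p := 2) (by norm_num)]
  refine setIntegral_congr_fun measurableSet_Ioi fun r hr => ?_
  norm_num [Real.rpow_two]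

lemma integrableOn_Ioi_sq {g : ℝ → ℂ} (hg : IntegrableOn g (Set.Ioi 0)) :
    IntegrableOn (fun r : ℝ => (2 * r : ℝ) • g (r ^ 2)) (Set.Ioi 0) := by
  have h1 := (integrableOn_Ioi_comp_rpow_iff g (p := 2) (by norm_num)).2 hg
  refine h1.congr_fun (fun r hr => ?_) measurableSet_Ioi
  norm_num [Real.rpow_two]

lemma integrable_div_sub {l : ℝ → ℂ} (hl : Integrable fun s : ℝ => l s / s) {u : ℂ} {K : ℝ}
    (hK : ∀ s : ℝ, |s| ≤ K * ‖(s : ℂ) - u‖) : Integrable fun s : ℝ => l s / (s - u) := by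
  have h1 : Measurable fun s : ℝ => (s : ℂ) / (s - u) := by fun_prop
  refine (hl.bdd_mul h1.aestronglyMeasurable (c := |K|) (Eventually.of_forall fun s => ?_)).congr ?_
  · rw [norm_div, Complex.norm_real, Real.norm_eq_abs]
    refine div_le_of_le_mul₀ (norm_nonneg _) (abs_nonneg _) ((hK s).trans ?_)
    gcongr
    exact le_abs_self K
  · filter_upwards [(Set.finite_singleton (0 : ℝ)).countable.ae_notMem volume] with s hs
    have : (s : ℂ) ≠ 0 := by exact_mod_cast hs
    field_simp

/-- The integral along `Σ` of a function of `z²` against the Cauchy kernel. -/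
theorem contourIntegral_eq {l : ℝ → ℂ} {F : ℂ → ℂ} (hl : Integrable fun s : ℝ => l s / s)
    (h1 : ∀ r : ℝ, 0 < r → F r = l (r ^ 2)) (h2 : ∀ r : ℝ, 0 < r → F (-r) = l (r ^ 2))
    (h3 : ∀ r : ℝ, 0 < r → F (r * Complex.I) = l (-r ^ 2))
    (h4 : ∀ r : ℝ, 0 < r → F (-(r * Complex.I)) = l (-r ^ 2)) {ξ : ℂ} {K : ℝ}
    (hK : ∀ r : ℝ, 0 < r → ∀ d ∈ ({1, -1, Complex.I, -Complex.I} : Set ℂ),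
      r ≤ K * ‖(r : ℂ) * d - ξ‖) :
    ContourIntegrable (fun ζ => F ζ / (ζ - ξ)) ∧
      contourIntegral (fun ζ => F ζ / (ζ - ξ)) = ∫ s : ℝ, l s / (s - ξ ^ 2) := by
  have hl' : Integrable fun s : ℝ => l (-s) / s := by
    refine hl.comp_neg.neg.congr (Eventually.of_forall fun s => ?_)
    simp only [Pi.neg_apply, Complex.ofReal_neg, div_neg, neg_neg]
  -- integrability on the rays
  have hray : ∀ (g : ℝ → ℂ) (d : ℂ), d ∈ ({1, -1, Complex.I, -Complex.I} : Set ℂ) →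
      Integrable (fun s : ℝ => g s / s) → (∀ r : ℝ, 0 < r → F (r * d) = g (r ^ 2)) →
      IntegrableOn (fun r : ℝ => F (r * d) / (r * d - ξ) * d) (Set.Ioi 0) := by
    intro g d hd hg hF
    have e1 := integrableOn_Ioi_sq (hg.integrableOn (s := Set.Ioi 0))
    have e2 : Measurable fun r : ℝ => (r : ℂ) / (r * d - ξ) * (d / 2) := by fun_prop
    refine (Integrable.bdd_mul e1 e2.aestronglyMeasurable (c := |K| * (‖d‖ / 2)) ?_).congr ?_
    · refine (ae_restrict_iff' measurableSet_Ioi).2 (Eventually.of_forall fun r hr => ?_)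
      have hr0 : 0 < r := hr
      rw [norm_mul, norm_div d, Complex.norm_ofNat]
      refine mul_le_mul_of_nonneg_right ?_ (by positivity)
      rw [norm_div, Complex.norm_real, Real.norm_of_nonneg hr0.le]
      refine div_le_of_le_mul₀ (norm_nonneg _) (abs_nonneg _) ((hK r hr0 d hd).trans ?_)
      gcongr
      exact le_abs_self K
    · refine (ae_restrict_iff' measurableSet_Ioi).2 (Eventually.of_forall fun r hr => ?_)
      have hr0 : (r : ℂ) ≠ 0 := by exact_mod_cast (show 0 < r from hr).ne'
      simp only [hF r hr, Complex.real_smul]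
      push_cast
      field_simp
  have i1 := hray l 1 (by simp) hl fun r hr => by rw [mul_one, h1 r hr]
  have i2 := hray l (-1) (by simp) hl fun r hr => by rw [mul_neg_one, h2 r hr]
  have i3 := hray (fun s => l (-s)) Complex.I (by simp) hl' fun r hr => by rw [h3 r hr]
  have i4 := hray (fun s => l (-s)) (-Complex.I) (by simp) hl' fun r hr => by
    rw [mul_neg, h4 r hr]
  refine ⟨?_, ?_⟩
  · rintro d (rfl | rfl | rfl | rfl)
    exacts [i1, i2, i3, i4]
  have hne : ∀ r : ℝ, 0 < r → (r : ℂ) - ξ ≠ 0 ∧ (r : ℂ) + ξ ≠ 0 ∧ (r : ℂ) * Complex.I - ξ ≠ 0 ∧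
      (r : ℂ) * Complex.I + ξ ≠ 0 := by
    intro r hr
    have hd : ∀ d ∈ ({1, -1, Complex.I, -Complex.I} : Set ℂ), (r : ℂ) * d - ξ ≠ 0 :=
      fun d hd h0 => by
        have := hK r hr d hd
        rw [h0, norm_zero, mul_zero] at this
        linarith
    refine ⟨by simpa using hd 1 (by simp), fun h => hd (-1) (by simp) ?_, hd _ (by simp),
      fun h => hd (-Complex.I) (by simp) ?_⟩
    · linear_combination -h
    · linear_combination -h
  have hK0 : 0 ≤ K := by
    have := hK 1 one_pos 1 (by simp)
    by_contra hK
    push Not at hK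
    nlinarith [norm_nonneg (((1 : ℝ) : ℂ) * 1 - ξ)]
  -- Up to sign, s - ξ² is the product of the distances' arguments for the two opposite square roots
  -- of s, so multiplying the two ray estimates yields K².
  have hKu : ∀ s : ℝ, |s| ≤ K ^ 2 * ‖(s : ℂ) - ξ ^ 2‖ := by
    intro s
    rcases lt_trichotomy s 0 with hs | rfl | hs
    · have e1 := hK √(-s) (Real.sqrt_pos.2 (by linarith)) Complex.I (by simp)
      have e2 := hK √(-s) (Real.sqrt_pos.2 (by linarith)) (-Complex.I) (by simp)
      have e3 := mul_le_mul e1 e2 (Real.sqrt_nonneg _) (by positivity)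
      rw [Real.mul_self_sqrt (by linarith)] at e3
      have e4 : (s : ℂ) - ξ ^ 2 = -((√(-s) * Complex.I - ξ) * (√(-s) * -Complex.I - ξ)) := by
        have : ((√(-s) : ℝ) : ℂ) ^ 2 = -s := by
          rw [← Complex.ofReal_pow, Real.sq_sqrt (by linarith)]; push_cast; rfl
        linear_combination this - (√(-s) : ℂ) ^ 2 * Complex.I_sq
      rw [e4, norm_neg, norm_mul, abs_of_neg hs]
      linarith
    · rw [abs_zero]; positivity
    · have e1 := hK √s (Real.sqrt_pos.2 hs) 1 (by simp)
      have e2 := hK √s (Real.sqrt_pos.2 hs) (-1) (by simp)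
      have e3 := mul_le_mul e1 e2 (Real.sqrt_nonneg _) (by positivity)
      rw [Real.mul_self_sqrt hs.le] at e3
      have e4 : (s : ℂ) - ξ ^ 2 = -((√s * 1 - ξ) * (√s * -1 - ξ)) := by
        have : ((√s : ℝ) : ℂ) ^ 2 = s := by
          rw [← Complex.ofReal_pow, Real.sq_sqrt hs.le]
        linear_combination -this
      rw [e4, norm_neg, norm_mul, abs_of_pos hs]
      linarith
  have hint := integrable_div_sub hl hKu
  have hsplit : ∫ s : ℝ, l s / (s - ξ ^ 2) =
      (∫ s in Set.Ioi (0 : ℝ), l (-s) / (((-s : ℝ) : ℂ) - ξ ^ 2)) +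
        ∫ s in Set.Ioi (0 : ℝ), l s / (s - ξ ^ 2) := by
    have := integral_comp_neg_Ioi (0 : ℝ) (fun s : ℝ => l s / ((s : ℂ) - ξ ^ 2))
    rw [neg_zero] at this
    rw [this, intervalIntegral.integral_Iic_add_Ioi hint.integrableOn hint.integrableOn]
  -- Opposite rays combine through 1/(r - ξ) + 1/(r + ξ) = 2r/(r² - ξ²), and 2r dr = ds for s = r².
  have hpos : (∫ r in Set.Ioi (0 : ℝ), F (r * 1) / (r * 1 - ξ) * 1) +
      (∫ r in Set.Ioi (0 : ℝ), F (r * -1) / (r * -1 - ξ) * -1) =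
      ∫ s in Set.Ioi (0 : ℝ), l s / (s - ξ ^ 2) := by
    rw [← integral_add i1 i2, ← integral_Ioi_sq fun s : ℝ => l s / (s - ξ ^ 2)]
    refine setIntegral_congr_fun measurableSet_Ioi fun r hr => ?_
    obtain ⟨n1, n2, -, -⟩ := hne r hr
    have e1 : (r : ℂ) * -1 - ξ = -(r + ξ) := by ring
    have e2 : ((r ^ 2 : ℝ) : ℂ) - ξ ^ 2 = (r - ξ) * (r + ξ) := by push_cast; ring
    have e3 : F (r * -1) = l (r ^ 2) := by rw [mul_neg_one, h2 r hr]
    simp only [mul_one, e1, e2, e3, h1 r hr, Complex.real_smul]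
    push_cast
    field_simp
    ring
  -- On the imaginary rays i² = -1 produces a minus sign, which cancels against their orientation
  -- from infinity to 0.
  have hneg : (∫ r in Set.Ioi (0 : ℝ), F (r * Complex.I) / (r * Complex.I - ξ) * Complex.I) +
      (∫ r in Set.Ioi (0 : ℝ), F (r * -Complex.I) / (r * -Complex.I - ξ) * -Complex.I) =
      -∫ s in Set.Ioi (0 : ℝ), l (-s) / (((-s : ℝ) : ℂ) - ξ ^ 2) := by
    rw [← integral_add i3 i4,
      ← integral_Ioi_sq fun s : ℝ => l (-s) / (((-s : ℝ) : ℂ) - ξ ^ 2), ← integral_neg]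
    refine setIntegral_congr_fun measurableSet_Ioi fun r hr => ?_
    obtain ⟨-, -, n1, n2⟩ := hne r hr
    have e1 : (r : ℂ) * -Complex.I - ξ = -(r * Complex.I + ξ) := by ring
    have e2 : ((-r ^ 2 : ℝ) : ℂ) - ξ ^ 2 = (r * Complex.I - ξ) * (r * Complex.I + ξ) := by
      push_cast; linear_combination (-(r : ℂ) ^ 2) * Complex.I_sq
    have e3 : F (r * -Complex.I) = l (-r ^ 2) := by rw [mul_neg, h4 r hr]
    simp only [e1, e2, e3, h3 r hr, Complex.real_smul]
    push_cast
    field_simp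
    linear_combination (2 * (r : ℂ) * l (-r ^ 2)) * Complex.I_sq
  simp only [contourIntegral, rayIntegral]
  rw [hsplit]
  linear_combination hpos - hneg

/-- A point off the axes keeps the distance min(|Re ξ|, |Im ξ|) from every ray. For large r the
triangle inequality takes over. -/
lemma exists_le_mul_norm_ray_sub {ξ : ℂ} (hξ : ξ.re * ξ.im ≠ 0) :
    ∃ K : ℝ, ∀ r : ℝ, 0 < r → ∀ d ∈ ({1, -1, Complex.I, -Complex.I} : Set ℂ),
      r ≤ K * ‖(r : ℂ) * d - ξ‖ := by
  have h1 : 0 < |ξ.re| := abs_pos.2 (left_ne_zero_of_mul hξ)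
  have h2 : 0 < |ξ.im| := abs_pos.2 (right_ne_zero_of_mul hξ)
  set δ := min |ξ.re| |ξ.im| with hδ
  have hδ0 : 0 < δ := lt_min h1 h2
  refine ⟨1 + ‖ξ‖ / δ, fun r hr d hd => ?_⟩
  have hdn : ‖d‖ = 1 := by
    rcases hd with rfl | rfl | rfl | rfl <;> simp
  have h3 : δ ≤ ‖(r : ℂ) * d - ξ‖ := by
    have e1 := Complex.abs_re_le_norm ((r : ℂ) * d - ξ)
    have e2 := Complex.abs_im_le_norm ((r : ℂ) * d - ξ)
    rcases hd with rfl | rfl | rfl | rfl <;> simp at e1 e2 ⊢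
    · exact (min_le_right _ _).trans e2
    · exact (min_le_right _ _).trans e2
    · exact (min_le_left _ _).trans e1
    · exact (min_le_left _ _).trans e1
  have h4 : r ≤ ‖ξ‖ + ‖(r : ℂ) * d - ξ‖ := by
    have := norm_le_norm_add_norm_sub ξ ((r : ℂ) * d)
    rw [norm_mul, hdn, Complex.norm_real, Real.norm_of_nonneg hr.le, norm_sub_rev] at this
    linarith
  have h5 : ‖ξ‖ ≤ ‖ξ‖ / δ * ‖(r : ℂ) * d - ξ‖ := by
    calc ‖ξ‖ = ‖ξ‖ / δ * δ := by field_simp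
      _ ≤ _ := by gcongr
  linarith

end

/-! ### The trace formulae, the theta condition and the reflectionless value of v₀. -/

noncomputable section

variable {q : ℝ → ℝ → ℂ} {q0 : ℝ} {qp qm : ℂ} {t : ℝ}

/-- The integral of `log (1 - ρ ρ̃)` along `Σ` as an integral over the line. -/
lemma NZBC.contourIntegral_logRefl (h : NZBC q q0 qp qm t)
    (hns : NoSpectralSingularities q q0 qp qm t)
    (hl : Integrable fun s : ℝ => (logModulus q q0 qp qm t s : ℂ) / s) {ξ : ℂ}
    (hξ : ∃ K : ℝ, ∀ r : ℝ, 0 < r → ∀ d ∈ ({1, -1, Complex.I, -Complex.I} : Set ℂ),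
      r ≤ K * ‖(r : ℂ) * d - ξ‖) :
    ContourIntegrable (fun ζ => logRefl q q0 qp qm t ζ / (ζ - ξ)) ∧
      contourIntegral (fun ζ => logRefl q q0 qp qm t ζ / (ζ - ξ)) =
        -2 * ∫ s : ℝ, (logModulus q q0 qp qm t s : ℂ) / (s - ξ ^ 2) := by
  obtain ⟨K, hK⟩ := hξ
  have hneg : ∀ ζ ∈ contour, logRefl q q0 qp qm t (-ζ) = logRefl q q0 qp qm t ζ := by
    intro ζ hζ
    have hζ' : -ζ ∈ contour := ⟨by simpa using hζ.1, neg_ne_zero.2 hζ.2⟩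
    rw [h.logRefl_eq hns hζ, h.logRefl_eq hns hζ']
    by_cases hb : ζ ∈ branchPts q0
    · have hb' : -ζ ∈ branchPts q0 := by
        rcases hb with hb | hb
        · right; simp [hb]
        · left; simp [Set.mem_singleton_iff.1 hb]
      rw [s11_branchPts hζ.2 hb, s11_branchPts hζ'.2 hb']
    · rw [h.s11_neg (mem_admissible_of_contour hζ hb)]
  have hc1 : ∀ r : ℝ, 0 < r → (r : ℂ) ∈ contour := fun r hr =>
    ⟨Or.inl (by simp), by exact_mod_cast hr.ne'⟩
  have hc2 : ∀ r : ℝ, 0 < r → (r : ℂ) * Complex.I ∈ contour := fun r hr =>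
    ⟨Or.inr (by simp), mul_ne_zero (by exact_mod_cast hr.ne') Complex.I_ne_zero⟩
  have e1 : ∀ r : ℝ, 0 < r → logRefl q q0 qp qm t r =
      -2 * (logModulus q q0 qp qm t (r ^ 2) : ℂ) := fun r hr => by
    rw [h.logRefl_eq hns (hc1 r hr), logModulus, Complex.ofReal_pow, csqrt_ofReal_sq hr]
    push_cast; rfl
  have e2 : ∀ r : ℝ, 0 < r → logRefl q q0 qp qm t (r * Complex.I) =
      -2 * (logModulus q q0 qp qm t (-r ^ 2) : ℂ) := fun r hr => by
    rw [h.logRefl_eq hns (hc2 r hr), logModulus, Complex.ofReal_neg, Complex.ofReal_pow,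
      csqrt_neg_ofReal_sq hr, mul_comm Complex.I]
    push_cast; rfl
  obtain ⟨h1, h2⟩ := contourIntegral_eq (l := fun s => -2 * (logModulus q q0 qp qm t s : ℂ))
    (F := logRefl q q0 qp qm t) (by simpa only [mul_div_assoc] using hl.const_mul (-2)) e1
    (fun r hr => by rw [hneg _ (hc1 r hr), e1 r hr]) e2
    (fun r hr => by rw [hneg _ (hc2 r hr), e2 r hr]) hK
  refine ⟨h1, ?_⟩
  rw [h2, ← integral_const_mul]
  simp only [mul_div_assoc]

lemma star_sq (z : ℂ) : star (z ^ 2) = star z ^ 2 := star_pow z 2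

/-- The Blaschke product over the points `η` in terms of `u = ξ²`. -/
lemma prod_eta_eq (hq0 : 0 < q0) {N₁ N₂ : ℕ} {z : Fin N₁ → ℂ} {w : Fin N₂ → ℂ}
    (hz : ∀ n, z n ≠ 0) (hw : ∀ m, ‖w m‖ = q0) (ξ : ℂ) :
    ∏ n, ((ξ - eta q0 z w n) / (ξ - etaHat q0 z w n)) ^ 2 =
      ∏ i, ((ξ ^ 2 - quadrantZeros q0 z w i ^ 2) /
        (ξ ^ 2 - star (quadrantZeros q0 z w i ^ 2))) ^ 2 := by
  have h0 : (q0 : ℂ) ≠ 0 := by exact_mod_cast hq0.ne'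
  simp only [Fintype.prod_sum_type, eta, etaHat, quadrantZeros, Sum.elim_inl, Sum.elim_inr,
    ← Finset.prod_mul_distrib, star_sq]
  -- The points η come in pairs ±a, so the product depends only on ξ².
  have hpair : ∀ a b : ℂ, ((ξ - a) / (ξ - b)) ^ 2 * ((ξ - -a) / (ξ - -b)) ^ 2 =
      ((ξ ^ 2 - a ^ 2) / (ξ ^ 2 - b ^ 2)) ^ 2 := fun a b => by
    rw [← mul_pow, div_mul_div_comm]
    congr 2 <;> ring
  rw [← mul_assoc, ← Finset.prod_mul_distrib]
  simp only [div_neg, hpair, neg_sq]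
  congr 1
  · refine Finset.prod_congr rfl fun n _ => ?_
    have h1 : star (z n) ≠ 0 := star_ne_zero.2 (hz n)
    have h2 : (q0 : ℂ) ^ 2 / ((q0 : ℂ) ^ 2 / star (z n)) = star (z n) := by field_simp
    have h3 : star (circleInv q0 (z n)) = (q0 : ℂ) ^ 2 / z n := by simp [circleInv]
    -- Up to sign, η̂ for z_n is the conjugate of the inverted point and η̂ for the inverted point
    -- is z_n*. The denominators of these two factors are therefore exchanged.
    rw [h2, h3, ← mul_pow, ← mul_pow, div_mul_div_comm, div_mul_div_comm,
      mul_comm (ξ ^ 2 - ((q0 : ℂ) ^ 2 / z n) ^ 2)]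
    rfl
  · refine Finset.prod_congr rfl fun m _ => ?_
    have h1 : w m ≠ 0 := norm_pos_iff.1 (by rw [hw m]; exact hq0)
    have h2 : (q0 : ℂ) ^ 2 / w m = star (w m) := by
      rw [div_eq_iff h1, ← hw m, mul_comm]
      exact (Complex.mul_conj' (w m)).symm
    rw [h2]

section Trace

variable {N₁ N₂ : ℕ} {z : Fin N₁ → ℂ} {w : Fin N₂ → ℂ}

lemma NZBC.integrable_logModulus (h : NZBC q q0 qp qm t)
    (hns : NoSpectralSingularities q q0 qp qm t)
    (hz : DoubleZerosIn (s11 q q0 qp qm t) (outerQuadrant q0) z)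
    (hw : DoubleZerosIn (s11 q q0 qp qm t) (quarterArc q0) w) :
    Integrable fun s : ℝ => (logModulus q q0 qp qm t s : ℂ) / s :=
  h.integrable_logModulus_div (h.s11_formula hns hz hw (u := Complex.I) (by simp [upperHalf])).1

lemma NZBC.prod_eta (h : NZBC q q0 qp qm t)
    (hz : DoubleZerosIn (s11 q q0 qp qm t) (outerQuadrant q0) z)
    (hw : DoubleZerosIn (s11 q q0 qp qm t) (quarterArc q0) w) (ξ : ℂ) :
    ∏ n, ((ξ - eta q0 z w n) / (ξ - etaHat q0 z w n)) ^ 2 =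
      ∏ i, ((ξ ^ 2 - quadrantZeros q0 z w i ^ 2) /
        (ξ ^ 2 - star (quadrantZeros q0 z w i ^ 2))) ^ 2 :=
  prod_eta_eq h.pos (fun n h0 => by
    have := (hz.mem n).1.1
    rw [h0] at this
    exact lt_irrefl _ this) (fun m => (hw.mem m).1.2.2) ξ

theorem NZBC.trace_s11 (h : NZBC q q0 qp qm t) (hns : NoSpectralSingularities q q0 qp qm t)
    (hz : DoubleZerosIn (s11 q q0 qp qm t) (outerQuadrant q0) z)
    (hw : DoubleZerosIn (s11 q q0 qp qm t) (quarterArc q0) w) {ξ : ℂ} (hξ : ξ ∈ Dplus) :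
    s11 q q0 qp qm t ξ =
      Complex.exp (1 / (Real.pi * Complex.I) *
          ∫ s : ℝ, (logModulus q q0 qp qm t s : ℂ) / (s - ξ ^ 2)) *
        (∏ n, ((ξ - eta q0 z w n) / (ξ - etaHat q0 z w n)) ^ 2) *
        Complex.exp (-(Complex.I * (v0 q q0 t : ℂ))) := by
  have hu : ξ ^ 2 ∈ upperHalf := by
    have h1 : 0 < ξ.re * ξ.im := hξ
    simp only [upperHalf, Set.mem_ofPred_eq, pow_two, Complex.mul_im]
    linarith
  -- D⁺ consists of two opposite quadrants. In the third one the square root returns -ξ, and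
  -- evenness of s₁₁ applies.
  have hs : s11 q q0 qp qm t (csqrt (ξ ^ 2)) = s11 q q0 qp qm t ξ := by
    rcases sq_eq_sq_iff_eq_or_eq_neg.1 (csqrt_sq (ne_zero_of_mem_upperHalf hu)) with h1 | h1
    · rw [h1]
    · rw [h1, h.s11_neg (Dplus_subset_admissible hξ)]
  rw [h.prod_eta hz hw, mul_comm (Complex.exp _), ← (h.s11_formula hns hz hw hu).2, hs, mul_assoc,
    ← Complex.exp_add]
  simp

/-- Conjugate of the formula for s₁₁ at ξ*. The density log |s₁₁| is real, so conjugation returns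
the same integral, while i, the Blaschke factors and v₀'s phase are inverted. -/
theorem NZBC.trace_s22 (h : NZBC q q0 qp qm t) (hns : NoSpectralSingularities q q0 qp qm t)
    (hz : DoubleZerosIn (s11 q q0 qp qm t) (outerQuadrant q0) z)
    (hw : DoubleZerosIn (s11 q q0 qp qm t) (quarterArc q0) w) {ξ : ℂ} (hξ : ξ ∈ Dminus) :
    s22 q q0 qp qm t ξ =
      Complex.exp (-(1 / (Real.pi * Complex.I)) *
          ∫ s : ℝ, (logModulus q q0 qp qm t s : ℂ) / (s - ξ ^ 2)) *
        (∏ n, ((ξ - etaHat q0 z w n) / (ξ - eta q0 z w n)) ^ 2) *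
        Complex.exp (Complex.I * (v0 q q0 t : ℂ)) := by
  have hξ' : star ξ ∈ Dplus := by
    have h1 : ξ.re * ξ.im < 0 := hξ
    show 0 < (star ξ).re * (star ξ).im
    simp
    linarith
  have h1 : (starRingEnd ℂ) (∫ s : ℝ, (logModulus q q0 qp qm t s : ℂ) / (s - star ξ ^ 2)) =
      ∫ s : ℝ, (logModulus q q0 qp qm t s : ℂ) / (s - ξ ^ 2) := by
    rw [← integral_conj]
    simp
  have h2 : ∏ n, ((ξ - etaHat q0 z w n) / (ξ - eta q0 z w n)) ^ 2 =
      ∏ i, ((ξ ^ 2 - star (quadrantZeros q0 z w i ^ 2)) /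
        (ξ ^ 2 - quadrantZeros q0 z w i ^ 2)) ^ 2 := by
    have e1 := congrArg (fun x => x⁻¹) (h.prod_eta hz hw ξ)
    simpa only [← Finset.prod_inv_distrib, ← inv_pow, inv_div] using e1
  rw [h.s22_eq (Dplus_subset_admissible hξ'), h.trace_s11 hns hz hw hξ', h.prod_eta hz hw, h2]
  simp only [Complex.star_def, map_mul, map_prod, map_pow, map_div₀, map_sub, ← Complex.exp_conj,
    Complex.conj_conj, map_one, Complex.conj_ofReal, Complex.conj_I, map_neg] at h1 ⊢
  rw [h1]
  congr 2
  · congr 2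
    rw [mul_neg, one_div, one_div, inv_neg]
  · ring

/-- The limit `z → 0` of the trace formula. -/
theorem NZBC.theta_exp (h : NZBC q q0 qp qm t) (hns : NoSpectralSingularities q q0 qp qm t)
    (hz : DoubleZerosIn (s11 q q0 qp qm t) (outerQuadrant q0) z)
    (hw : DoubleZerosIn (s11 q q0 qp qm t) (quarterArc q0) w) :
    qm / qp * Complex.exp (2 * Complex.I * (v0 q q0 t : ℂ)) =
      (∏ i, (quadrantZeros q0 z w i ^ 2 / star (quadrantZeros q0 z w i ^ 2)) ^ 2) *
        Complex.exp (1 / (Real.pi * Complex.I) *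
          ∫ s : ℝ, (logModulus q q0 qp qm t s : ℂ) / s) := by
  have hl := h.integrable_logModulus hns hz hw
  have hpath : Tendsto (fun ε : ℝ => (ε : ℂ) * Complex.I) (𝓝[>] 0) (𝓝 0) := by
    have : Continuous fun ε : ℝ => (ε : ℂ) * Complex.I := by fun_prop
    exact ((this.tendsto 0).mono_left nhdsWithin_le_nhds).trans_eq (by simp)
  have hup : ∀ ε : ℝ, 0 < ε → (ε : ℂ) * Complex.I ∈ upperHalf := fun ε hε => by
    simpa [upperHalf] using hε
  have hpath' : Tendsto (fun ε : ℝ => (ε : ℂ) * Complex.I) (𝓝[>] 0) (𝓝[upperHalf] 0) :=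
    tendsto_nhdsWithin_iff.2 ⟨hpath, by filter_upwards [self_mem_nhdsWithin] with ε hε using hup ε hε⟩
  have h1 := (h.tendsto_s11_csqrt_zero.comp hpath').mul_const
    (Complex.exp (Complex.I * (v0 q q0 t : ℂ)))
  have hne : ∀ s : ℝ, s ≠ 0 → ∀ ε : ℝ, |s| ≤ ‖(s : ℂ) - ε * Complex.I‖ := fun s hs ε => by
    have := Complex.abs_re_le_norm ((s : ℂ) - ε * Complex.I)
    simpa using this
  -- The approach u = iε gives |s - iε| ≥ |s|, so the integrable function |log |s₁₁||/|s| dominates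
  -- all the integrands.
  have h2 : Tendsto (fun ε : ℝ => ∫ s : ℝ, (logModulus q q0 qp qm t s : ℂ) / (s - ε * Complex.I))
      (𝓝[>] 0) (𝓝 (∫ s : ℝ, (logModulus q q0 qp qm t s : ℂ) / s)) := by
    refine tendsto_integral_filter_of_dominated_convergence
      (fun s => ‖(logModulus q q0 qp qm t s : ℂ) / s‖) ?_ ?_ hl.norm ?_
    · filter_upwards [self_mem_nhdsWithin] with ε hε
      exact (h.s11_formula hns hz hw (hup ε hε)).1.aestronglyMeasurable
    · refine Eventually.of_forall fun ε => ?_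
      filter_upwards [(Set.finite_singleton (0 : ℝ)).countable.ae_notMem volume] with s hs
      have hs0 : 0 < |s| := abs_pos.2 hs
      rw [norm_div, norm_div, Complex.norm_real s, Real.norm_eq_abs s]
      exact div_le_div_of_nonneg_left (norm_nonneg _) hs0 (hne s hs ε)
    · filter_upwards [(Set.finite_singleton (0 : ℝ)).countable.ae_notMem volume] with s hs
      have hs0 : (s : ℂ) ≠ 0 := by exact_mod_cast hs
      have := (tendsto_const_nhds (x := (s : ℂ))).sub hpath
      rw [sub_zero] at this
      exact tendsto_const_nhds.div this hs0
  have hq0 : ∀ i, star (quadrantZeros q0 z w i ^ 2) ≠ 0 := fun i =>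
    star_ne_zero.2 (ne_zero_of_mem_upperHalf (sq_mem_upperHalf (h.quadrantZeros_mem hz hw i)))
  have h3 : Tendsto (fun u : ℂ => ∏ i, ((u - quadrantZeros q0 z w i ^ 2) /
      (u - star (quadrantZeros q0 z w i ^ 2))) ^ 2) (𝓝 0)
      (𝓝 (∏ i, (quadrantZeros q0 z w i ^ 2 / star (quadrantZeros q0 z w i ^ 2)) ^ 2)) := by
    refine tendsto_finsetProd _ fun i _ => ?_
    have e1 : ContinuousAt (fun u : ℂ => ((u - quadrantZeros q0 z w i ^ 2) /
      (u - star (quadrantZeros q0 z w i ^ 2))) ^ 2) 0 := by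
      refine (ContinuousAt.div (by fun_prop) (by fun_prop) ?_).pow 2
      rw [zero_sub]
      exact neg_ne_zero.2 (hq0 i)
    refine e1.tendsto.trans_eq ?_
    rw [zero_sub, zero_sub, neg_div_neg_eq]
  have h4 := (h3.comp hpath).mul ((Complex.continuous_exp.tendsto _).comp
    (h2.const_mul (1 / (Real.pi * Complex.I))))
  have h5 := tendsto_nhds_unique (h1.congr' ?_) h4
  · rw [← h5, mul_assoc (qm / qp), ← Complex.exp_add]
    ring_nf
  · filter_upwards [self_mem_nhdsWithin] with ε hε
    exact (h.s11_formula hns hz hw (hup ε hε)).2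

lemma sq_div_star_sq {ζ : ℂ} (hζ : ζ ≠ 0) :
    (ζ ^ 2 / star (ζ ^ 2)) ^ 2 = Complex.exp (8 * (Complex.arg ζ : ℂ) * Complex.I) := by
  have h1 := Complex.norm_mul_exp_arg_mul_I ζ
  have hn : (‖ζ‖ : ℂ) ≠ 0 := by exact_mod_cast norm_ne_zero_iff.2 hζ
  have h2 : star ζ = ‖ζ‖ * Complex.exp (-(Complex.arg ζ * Complex.I)) := by
    have := congrArg (starRingEnd ℂ) h1
    rw [map_mul, ← Complex.exp_conj, map_mul, Complex.conj_ofReal, Complex.conj_ofReal,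
      Complex.conj_I, mul_neg] at this
    exact this.symm
  have h3 : ζ / star ζ = Complex.exp (2 * (Complex.arg ζ : ℂ) * Complex.I) := by
    have h4 : ζ = Complex.exp (2 * (Complex.arg ζ : ℂ) * Complex.I) * star ζ := by
      rw [h2, mul_left_comm, ← Complex.exp_add]
      nth_rewrite 1 [← h1]
      congr 2; ring
    exact (div_eq_iff (star_ne_zero.2 hζ)).2 h4
  rw [star_pow, ← div_pow, ← pow_mul, h3, ← Complex.exp_nat_mul]
  congr 1; push_cast; ring

/-- This is why z_n and its inversion together contribute 2 · 8 = 16 arg z_n to the theta condition,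
while a point on the arc contributes 8 arg w_m. -/
lemma arg_circleInv (hq0 : 0 < q0) {ζ : ℂ} (hζ : ζ ≠ 0) :
    Complex.arg (circleInv q0 ζ) = Complex.arg ζ := by
  have h1 : 0 < Complex.normSq ζ := Complex.normSq_pos.2 hζ
  rw [circleInv_eq_mul q0 hζ, Complex.arg_real_mul _ (by positivity)]

/-- Every factor of the limiting identity at the origin is unimodular. Written as exponentials of
imaginary numbers, the two sides have exponents that differ by a multiple of 2πi, which defines j.
-/
theorem NZBC.theta_condition (h : NZBC q q0 qp qm t) (hns : NoSpectralSingularities q q0 qp qm t)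
    (hz : DoubleZerosIn (s11 q q0 qp qm t) (outerQuadrant q0) z)
    (hw : DoubleZerosIn (s11 q q0 qp qm t) (quarterArc q0) w) :
    ContourIntegrable (fun ζ => logRefl q q0 qp qm t ζ / ζ) ∧
      ∃ j : ℤ,
        ((Complex.arg (qm / qp) + 2 * v0 q q0 t : ℝ) : ℂ) =
          ((16 * ∑ n, Complex.arg (z n) + 8 * ∑ m, Complex.arg (w m) + 2 * j * Real.pi : ℝ) : ℂ) +
            1 / (2 * (Real.pi : ℂ)) *
              contourIntegral (fun ζ => logRefl q q0 qp qm t ζ / ζ) := by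
  have hl := h.integrable_logModulus hns hz hw
  have hc := h.contourIntegral_logRefl hns hl (ξ := 0) ⟨1, fun r hr d hd => by
    have hdn : ‖d‖ = 1 := by rcases hd with rfl | rfl | rfl | rfl <;> simp
    rw [sub_zero, norm_mul, hdn, Complex.norm_real, Real.norm_of_nonneg hr.le]
    linarith⟩
  simp only [sub_zero, zero_pow two_ne_zero] at hc
  refine ⟨hc.1, ?_⟩
  set J : ℝ := ∫ s : ℝ, logModulus q q0 qp qm t s / s with hJ
  have hJc : ∫ s : ℝ, (logModulus q q0 qp qm t s : ℂ) / s = J := by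
    rw [hJ, ← integral_complex_ofReal]
    simp
  have hθ := h.theta_exp hns hz hw
  rw [hJc] at hθ
  have hpi : (Real.pi : ℂ) ≠ 0 := by exact_mod_cast Real.pi_ne_zero
  have h1 : qm / qp = Complex.exp (Complex.arg (qm / qp) * Complex.I) := by
    have := Complex.norm_mul_exp_arg_mul_I (qm / qp)
    rw [h.norm_qm_div_qp] at this
    simpa using this.symm
  have hmem := h.quadrantZeros_mem hz hw
  have hne : ∀ i, quadrantZeros q0 z w i ≠ 0 := fun i h0 => by
    have := (hmem i).1
    rw [h0] at this
    exact lt_irrefl _ this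
  have h2 : ∏ i, (quadrantZeros q0 z w i ^ 2 / star (quadrantZeros q0 z w i ^ 2)) ^ 2 =
      Complex.exp ((16 * ∑ n, Complex.arg (z n) + 8 * ∑ m, Complex.arg (w m) : ℝ) * Complex.I) := by
    rw [Finset.prod_congr rfl fun i _ => sq_div_star_sq (hne i), ← Complex.exp_sum]
    congr 1
    have e1 : ∀ n, Complex.arg (circleInv q0 (z n)) = Complex.arg (z n) := fun n =>
      arg_circleInv h.pos (hne (Sum.inl (Sum.inl n)))
    simp only [Fintype.sum_sum_type, quadrantZeros, Sum.elim_inl, Sum.elim_inr, e1,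
      ← Finset.sum_mul, ← Finset.mul_sum]
    push_cast
    ring
  -- The contour integral of log(1 - ρρ̃)/ζ equals -2J, so -J/π is exactly 1/(2π) times it.
  have h3 : 1 / (Real.pi * Complex.I) * (J : ℂ) = (-(J / Real.pi) : ℝ) * Complex.I := by
    have := Complex.I_ne_zero
    push_cast
    field_simp
    rw [Complex.I_sq]; ring
  rw [h2, h3, ← Complex.exp_add, h1, ← Complex.exp_add, Complex.exp_eq_exp_iff_exists_int] at hθ
  obtain ⟨j, hj⟩ := hθ
  refine ⟨j, ?_⟩
  rw [hc.2, hJc]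
  apply mul_right_cancel₀ Complex.I_ne_zero
  push_cast at hj ⊢
  have e2 : 1 / (2 * (Real.pi : ℂ)) * (-2 * J) = -(J / Real.pi) := by field_simp
  rw [e2]
  linear_combination hj

/-- With log(1 - ρρ̃) = 0 and q₋/q₊ = 1 the theta condition loses its integral and its argument.
Halving it gives the value of v₀ modulo π. -/
theorem NZBC.v0_of_reflectionless (h : NZBC q q0 qp qm t)
    (hns : NoSpectralSingularities q q0 qp qm t)
    (hz : DoubleZerosIn (s11 q q0 qp qm t) (outerQuadrant q0) z)
    (hw : DoubleZerosIn (s11 q q0 qp qm t) (quarterArc q0) w)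
    (hr : Reflectionless q q0 qp qm t) :
    ∃ j : ℤ, v0 q q0 t =
      8 * ∑ n, Complex.arg (z n) + 4 * ∑ m, Complex.arg (w m) + j * Real.pi := by
  obtain ⟨-, j, hj⟩ := h.theta_condition hns hz hw
  have hlog : ∀ ζ ∈ contour, logRefl q q0 qp qm t ζ = 0 := fun ζ hζ => by
    by_cases hb : ζ ∈ branchPts q0
    · simp [logRefl, rho, s11_branchPts hζ.2 hb]
    · simp [logRefl, (hr ζ ⟨hζ, hb⟩).1]
  have hray : ∀ d : ℂ, (d.re = 0 ∨ d.im = 0) → d ≠ 0 →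
      rayIntegral (fun ζ => logRefl q q0 qp qm t ζ / ζ) d = 0 := fun d hd hd0 => by
    rw [rayIntegral, setIntegral_congr_fun (g := fun _ => 0) measurableSet_Ioi fun r hr => ?_,
      integral_zero]
    have hr0 : 0 < r := hr
    have : (r : ℂ) * d ∈ contour := ⟨by
      rcases hd with hd | hd
      · right; simp [hd]
      · left; simp [hd], mul_ne_zero (by exact_mod_cast hr0.ne') hd0⟩
    simp [hlog _ this]
  have h0 : contourIntegral (fun ζ => logRefl q q0 qp qm t ζ / ζ) = 0 := by
    rw [contourIntegral, hray 1 (by simp) one_ne_zero, hray (-1) (by simp) (by simp),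
      hray Complex.I (by simp) Complex.I_ne_zero,
      hray (-Complex.I) (by simp) (neg_ne_zero.2 Complex.I_ne_zero)]
    simp
  rw [h0, mul_zero, add_zero, ← (h.reflectionless hns hr).2, div_self h.qp_ne_zero, Complex.arg_one]
    at hj
  have hj' := Complex.ofReal_injective hj
  exact ⟨j, by linarith⟩

end Trace

end

end DNLS

theorem mainTheorem5 (q : ℝ → ℝ → ℂ) (q0 : ℝ) (qp qm : ℂ) (t : ℝ)
    (hq : DNLS.NZBC q q0 qp qm t)
    (hns : DNLS.NoSpectralSingularities q q0 qp qm t)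
    (N₁ N₂ : ℕ) (z : Fin N₁ → ℂ) (w : Fin N₂ → ℂ)
    (hz : DNLS.DoubleZerosIn (DNLS.s11 q q0 qp qm t) (DNLS.outerQuadrant q0) z)
    (hw : DNLS.DoubleZerosIn (DNLS.s11 q q0 qp qm t) (DNLS.quarterArc q0) w) :
    -- the constant `v₀` is given by a convergent integral
    MeasureTheory.Integrable (fun x : ℝ => ‖q x t‖ ^ 2 - q0 ^ 2) ∧
    -- trace formula for `s₁₁`
    (∀ ξ ∈ DNLS.Dplus,
      DNLS.ContourIntegrable (fun ζ => DNLS.logRefl q q0 qp qm t ζ / (ζ - ξ)) ∧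
      DNLS.s11 q q0 qp qm t ξ =
        Complex.exp (-(1 / (2 * (Real.pi : ℂ) * Complex.I)) *
            DNLS.contourIntegral (fun ζ => DNLS.logRefl q q0 qp qm t ζ / (ζ - ξ))) *
          (∏ n, ((ξ - DNLS.eta q0 z w n) / (ξ - DNLS.etaHat q0 z w n)) ^ 2) *
          Complex.exp (-(Complex.I * (DNLS.v0 q q0 t : ℂ)))) ∧
    -- trace formula for `s₂₂`
    (∀ ξ ∈ DNLS.Dminus,
      DNLS.ContourIntegrable (fun ζ => DNLS.logRefl q q0 qp qm t ζ / (ζ - ξ)) ∧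
      DNLS.s22 q q0 qp qm t ξ =
        Complex.exp ((1 / (2 * (Real.pi : ℂ) * Complex.I)) *
            DNLS.contourIntegral (fun ζ => DNLS.logRefl q q0 qp qm t ζ / (ζ - ξ))) *
          (∏ n, ((ξ - DNLS.etaHat q0 z w n) / (ξ - DNLS.eta q0 z w n)) ^ 2) *
          Complex.exp (Complex.I * (DNLS.v0 q q0 t : ℂ))) ∧
    -- theta condition
    (DNLS.ContourIntegrable (fun ζ => DNLS.logRefl q q0 qp qm t ζ / ζ) ∧
      ∃ j : ℤ,
        ((Complex.arg (qm / qp) + 2 * DNLS.v0 q q0 t : ℝ) : ℂ) =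
          ((16 * ∑ n, Complex.arg (z n) + 8 * ∑ m, Complex.arg (w m) + 2 * j * Real.pi : ℝ) : ℂ) +
            1 / (2 * (Real.pi : ℂ)) *
              DNLS.contourIntegral (fun ζ => DNLS.logRefl q q0 qp qm t ζ / ζ)) ∧
    -- reflectionless case
    (DNLS.Reflectionless q q0 qp qm t →
      DNLS.scatMatrix q q0 qp qm t (q0 : ℂ) = 1 ∧ qp = qm ∧
      ∃ j : ℤ,
        DNLS.v0 q q0 t =
          8 * ∑ n, Complex.arg (z n) + 4 * ∑ m, Complex.arg (w m) + j * Real.pi) := by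
  have hl := hq.integrable_logModulus hns hz hw
  have hpi : (Real.pi : ℂ) ≠ 0 := by exact_mod_cast Real.pi_ne_zero
  have hI := Complex.I_ne_zero
  refine ⟨hq.integrable_normSq_sub, fun ξ hξ => ?_, fun ξ hξ => ?_,
    hq.theta_condition hns hz hw, fun hr => ?_⟩
  · obtain ⟨h1, h2⟩ := hq.contourIntegral_logRefl hns hl
      (DNLS.exists_le_mul_norm_ray_sub (ξ := ξ) (show 0 < ξ.re * ξ.im from hξ).ne')
    refine ⟨h1, ?_⟩
    -- The constants agree because -(1/(2πi)) · (-2) = 1/(πi).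
    rw [hq.trace_s11 hns hz hw hξ, h2]
    congr 3
    field_simp
  · obtain ⟨h1, h2⟩ := hq.contourIntegral_logRefl hns hl
      (DNLS.exists_le_mul_norm_ray_sub (ξ := ξ) (show ξ.re * ξ.im < 0 from hξ).ne)
    refine ⟨h1, ?_⟩
    rw [hq.trace_s22 hns hz hw hξ, h2]
    congr 3
    field_simp
  · exact ⟨(hq.reflectionless hns hr).1, (hq.reflectionless hns hr).2,
      hq.v0_of_reflectionless hns hz hw hr⟩
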